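/- Let $\sigma,T>0$, $r\in\mathbb R$, let $S_0\sim\pi_0$ for a probability measure $\pi_0$ with $\pi_0((0,\infty))=1$ (in particular $S_0$ may be deterministic), and let $S_t=S_0e^{(r-\sigma^2/2)t+\sigma W_t}$ be the geometric Brownian motion solving $dS_t=rS_t\,dt+\sigma S_t\,dW_t$, with $W$ a standard Brownian motion independent of $S_0$. Let $\psi:\mathbb R\to\mathbb R$ be a piecewise constant payoff: for some thresholds $\overline S_0<\dots<\overline S_m$, it equals a constant $\psi_L$ on $(-\infty,\overline S_0)$, a constant $\psi_j$ on $[\overline S_{j-1},\overline S_j)$ for $1\le j\le m$, and a constant $\psi_R$ on $[\overline S_m,\infty)$. The price is $\mathbb E[P]$ with $P=e^{-rT}\psi(S_T)$. For $n\ge1$ let $h=T/n$. The $n$-step binomial option pricing model is the chain $\widehat S_0=S_0$, $\widehat S_{k+1}=\widehat S_kY_{k+1}$, where the $Y_k$ are i.i.d., independent of $S_0$, with $\Pr(Y_k=U)=p$ and $\Pr(Y_k=D)=1-p$, and where either (Cox–Ross–Rubinstein) $U=e^{\sigma\sqrt h}$, $D=e^{-\sigma\sqrt h}$, $p=(e^{rh}-D)/(U-D)$,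 or (Jarrow–Rudd) $U=e^{(r-\sigma^2/2)h+\sigma\sqrt h}$, $D=e^{(r-\sigma^2/2)h-\sigma\sqrt h}$, $p=1/2$. An algorithm is a fixed finite program for a randomized real RAM without rounding: its unit-cost instructions are rational constants, $+,-,\times,/$, $\sqrt{\cdot}$, $\exp$, $\log$ on real registers, conditional jumps on $\le$, drawing a fair random bit, drawing a fresh initial price $S_0\sim\pi_0$, and the payoff oracle $O_\psi(S_0,k)=\psi(U^kD^{n-k}S_0)$ for numbers $n\geq 1$ and $0\le k\le n$ held in registers and the last drawn $S_0$. The program has no other access to $\psi$ and $\pi_0$. The cost of a run is the number of executed instructions. For each of the two lattices the following holds. (1) There is a program which on input $(r,\sigma,T,n)$, for every $n\ge2$ with $0\le p\le1$, outputs a random number with exactly the law of $\psi(\widehat S_n)$, in expected cost at most $C\log n$, where $C$ depends only on $r,\sigma,T$. (2) There are a program and a number $c\in\mathbb N$ such that, for all $r,\sigma,T,\psi$ as above, there is $A_0$ such that for every $A\ge A_0$ there is $C$ such that for all $\pi_0$ and all $\epsilon\in(0,1)$: on input $(r,\sigma,T,A,\epsilon)$, the program always halts with cost at most $C\epsilon^{-2}(\log(2/\epsilon))^c$,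 and with probability at least $0.99$ its output differs from $\mathbb E[P]$ by at most $\epsilon$. Thus the price is estimated to additive error $\epsilon$ with probability at least $0.99$ in cost $\widetilde O(\epsilon^{-2})$. -/

import Mathlib

open MeasureTheory ProbabilityTheory
open scoped ENNReal NNReal

noncomputable section

namespace OptionPricing

/-! ### Payoffs, geometric Brownian motion, binomial lattices -/

/-- `ψ` is piecewise constant: there are finitely many thresholds `K 0 < ⋯ < K m` such that
`ψ = ψL` below `K 0`, `ψ = ψR` from `K m` on, and `ψ = ψM j` on `[K j, K (j + 1))`. -/
def IsPiecewiseConstant (ψ : ℝ → ℝ) : Prop :=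
  ∃ (m : ℕ) (K : Fin (m + 1) → ℝ) (ψL ψR : ℝ) (ψM : Fin m → ℝ),
    StrictMono K ∧
    (∀ x, x < K 0 → ψ x = ψL) ∧
    (∀ (j : Fin m) (x : ℝ), K j.castSucc ≤ x → x < K j.succ → ψ x = ψM j) ∧
    (∀ x, K (Fin.last m) ≤ x → ψ x = ψR)

/-- Geometric Brownian motion with rate `r`, volatility `σ`, initial price `S₀` and driving
Brownian motion `W`, i.e. the solution of `dS = r S dt + σ S dW`. -/
def gbm {Ω : Type*} (r σ : ℝ) (S₀ : Ω → ℝ) (W : ℝ≥0 → Ω → ℝ) (t : ℝ≥0) (ω : Ω) : ℝ :=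
  S₀ ω * Real.exp ((r - σ ^ 2 / 2) * t + σ * W t ω)

/-- The price `𝔼[exp (-r T) ψ(S_T)]` of the option with payoff `ψ` and maturity `T`. -/
def optionPrice {Ω : Type*} [MeasurableSpace Ω] (P : Measure Ω) (r σ T : ℝ) (ψ : ℝ → ℝ)
    (S₀ : Ω → ℝ) (W : ℝ≥0 → Ω → ℝ) : ℝ :=
  ∫ ω, Real.exp (-r * T) * ψ (gbm r σ S₀ W T.toNNReal ω) ∂P

/-- The two standard lattices: Cox–Ross–Rubinstein and Jarrow–Rudd (equal probabilities). -/
inductive Lattice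
  | CRR
  | JR

namespace Lattice

/-- The factor `U` of an up-move over a time step `h`. -/
def up (L : Lattice) (r σ h : ℝ) : ℝ :=
  match L with
  | CRR => Real.exp (σ * √h)
  | JR => Real.exp ((r - σ ^ 2 / 2) * h + σ * √h)

/-- The factor `D` of a down-move over a time step `h`. -/
def down (L : Lattice) (r σ h : ℝ) : ℝ :=
  match L with
  | CRR => Real.exp (-(σ * √h))
  | JR => Real.exp ((r - σ ^ 2 / 2) * h - σ * √h)

/-- The probability `p` of an up-move over a time step `h`. -/
def prob (L : Lattice) (r σ h : ℝ) : ℝ :=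
  match L with
  | CRR => (Real.exp (r * h) - CRR.down r σ h) / (CRR.up r σ h - CRR.down r σ h)
  | JR => 1 / 2

end Lattice

/-- The law of `S_n` for the chain `S_{k+1} = S_k Y_{k+1}`, `S_0 ∼ π₀`, where the `Y_k` are
independent of each other and of `S_0`, `Y_k = U` with probability `p` and `Y_k = D` with
probability `1 - p`. -/
def latticeLaw (p U D : ℝ) (π₀ : Measure ℝ) : ℕ → Measure ℝ
  | 0 => π₀
  | n + 1 =>
      ENNReal.ofReal p • (latticeLaw p U D π₀ n).map (fun s => s * U) +
        ENNReal.ofReal (1 - p) • (latticeLaw p U D π₀ n).map (fun s => s * D)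

/-- The law of the price `S_n` at maturity `T` in the `n`-step binomial option pricing model. -/
def bopmLaw (L : Lattice) (r σ T : ℝ) (π₀ : Measure ℝ) (n : ℕ) : Measure ℝ :=
  latticeLaw (L.prob r σ (T / n)) (L.up r σ (T / n)) (L.down r σ (T / n)) π₀ n

/-- The payoff oracle `(n, S₀, k) ↦ ψ(U ^ k D ^ (n - k) S₀)` of the `n`-step model. -/
def payoffOracle (L : Lattice) (r σ T : ℝ) (ψ : ℝ → ℝ) (n : ℕ) (S₀ : ℝ) (k : ℕ) : ℝ :=
  ψ (L.up r σ (T / n) ^ k * L.down r σ (T / n) ^ (n - k) * S₀)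

/-! ### Randomized real random-access machines

A machine has real registers `0, 1, 2, …` addressed by constants. A program is a finite list of
instructions; executing one instruction costs one unit. There are no rounding instructions.
Randomness comes from fair bits; initial prices and payoffs are only available through oracles. -/

inductive Instr
  /-- `R dst := q`, a rational constant -/
  | const (dst : ℕ) (q : ℚ)
  /-- `R dst := R a + R b` -/
  | add (dst a b : ℕ)
  /-- `R dst := R a - R b` -/
  | sub (dst a b : ℕ)
  /-- `R dst := R a * R b` -/
  | mul (dst a b : ℕ)
  /-- `R dst := R a / R b` (division by zero gives zero) -/
  | div (dst a b : ℕ)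
  /-- `R dst := √(R a)` (zero if `R a` is negative) -/
  | sqrt (dst a : ℕ)
  /-- `R dst := exp (R a)` -/
  | exp (dst a : ℕ)
  /-- `R dst := log |R a|` (zero if `R a` is zero) -/
  | log (dst a : ℕ)
  /-- if `R a ≤ R b` then continue at instruction number `target` -/
  | jumpLE (a b target : ℕ)
  /-- `R dst :=` a fresh fair bit (zero or one) -/
  | flip (dst : ℕ)
  /-- `R dst :=` a fresh initial price; it becomes the current initial price -/
  | init (dst : ℕ)
  /-- `R dst :=` the answer of the payoff oracle for `R n` steps, the current initial price, and
  `R k` up-moves -/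
  | query (dst n k : ℕ)

/-- The random input of a machine: fair bits and independent initial prices. -/
abbrev Tape : Type := (ℕ → Bool) × (ℕ → ℝ)

/-- The law of the random input: independent fair bits, and independent of these, independent
initial prices with law `π₀`. -/
def tapeMeasure (π₀ : Measure ℝ) : Measure Tape :=
  (Measure.infinitePi fun _ : ℕ => (PMF.uniformOfFintype Bool).toMeasure).prod
    (Measure.infinitePi fun _ : ℕ => π₀)

/-- A configuration: program counter, registers, current initial price (zero before the first
draw), and the numbers of bits and of initial prices used so far. -/
structure Config where
  pc : ℕ
  reg : ℕ → ℝ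
  price : ℝ
  bits : ℕ
  prices : ℕ

namespace Config

/-- Write `v` to register `dst` and go to the next instruction. -/
def write (c : Config) (dst : ℕ) (v : ℝ) : Config :=
  { c with pc := c.pc + 1, reg := Function.update c.reg dst v }

end Config

/-- The answer to a payoff query with real arguments `x` (number of steps) and `y` (number of
up-moves): the oracle answers only if they are natural numbers `n > 0` and `k ≤ n`, otherwise the
answer is zero. -/
def answer (O : ℕ → ℝ → ℕ → ℝ) (x S₀ y : ℝ) : ℝ :=
  open Classical in
  if (⌊x⌋₊ : ℝ) = x ∧ (⌊y⌋₊ : ℝ) = y ∧ 0 < ⌊x⌋₊ ∧ ⌊y⌋₊ ≤ ⌊x⌋₊ then O ⌊x⌋₊ S₀ ⌊y⌋₊ else 0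

/-- The effect of one instruction. -/
def exec (O : ℕ → ℝ → ℕ → ℝ) (τ : Tape) (c : Config) : Instr → Config
  | .const d q => c.write d q
  | .add d a b => c.write d (c.reg a + c.reg b)
  | .sub d a b => c.write d (c.reg a - c.reg b)
  | .mul d a b => c.write d (c.reg a * c.reg b)
  | .div d a b => c.write d (c.reg a / c.reg b)
  | .sqrt d a => c.write d √(c.reg a)
  | .exp d a => c.write d (Real.exp (c.reg a))
  | .log d a => c.write d (Real.log (c.reg a))
  | .jumpLE a b target =>
      open Classical in
      { c with pc := if c.reg a ≤ c.reg b then target else c.pc + 1 }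
  | .flip d => { c.write d (if τ.1 c.bits then 1 else 0) with bits := c.bits + 1 }
  | .init d =>
      { c.write d (τ.2 c.prices) with price := τ.2 c.prices, prices := c.prices + 1 }
  | .query d n k => c.write d (answer O (c.reg n) c.price (c.reg k))

/-- One step of a program; the machine has halted once the program counter is outside the
program. -/
def step (prog : List Instr) (O : ℕ → ℝ → ℕ → ℝ) (τ : Tape) (c : Config) : Config :=
  match prog[c.pc]? with
  | some i => exec O τ c i
  | none => c

/-- The initial configuration: the input is in the registers `0, 1, …`, the others are zero. -/
def start (input : List ℝ) : Config :=
  { pc := 0, reg := fun i => input.getD i 0, price := 0, bits := 0, prices := 0 }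

/-- The configuration after `t` steps. -/
def run (prog : List Instr) (O : ℕ → ℝ → ℕ → ℝ) (input : List ℝ) (τ : Tape) (t : ℕ) : Config :=
  (step prog O τ)^[t] (start input)

/-- The machine has halted after at most `t` steps. -/
def Halted (prog : List Instr) (O : ℕ → ℝ → ℕ → ℝ) (input : List ℝ) (τ : Tape) (t : ℕ) : Prop :=
  prog.length ≤ (run prog O input τ t).pc

/-- The number of executed instructions (`∞` if the machine does not halt). -/
def cost (prog : List Instr) (O : ℕ → ℝ → ℕ → ℝ) (input : List ℝ) (τ : Tape) : ℝ≥0∞ :=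
  ⨅ (t : ℕ) (_ : Halted prog O input τ t), (t : ℝ≥0∞)

/-- The output: the content of register `0` when the machine halts (zero if it never does). -/
def output (prog : List Instr) (O : ℕ → ℝ → ℕ → ℝ) (input : List ℝ) (τ : Tape) : ℝ :=
  open Classical in
  if h : ∃ t, Halted prog O input τ t then (run prog O input τ (Nat.find h)).reg 0 else 0

end OptionPricing

end

/-! Sampling. Up-moves and down-moves commute, so the price at maturity is `U ^ k * D ^ (n - k) *
S₀` with `k` binomial (`latticeLaw_apply`), and it suffices to draw `k` exactly in expected cost
`O(log n)`. As the time step shrinks, `p` tends to `1 / 2` (`Lattice.tendsto_prob`); hence `p` lies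
outside `[1/4, 3/4]` only for boundedly many `n`, where one coin per step is affordable. Otherwise
rejection is used. With `m` the mode, `w` the binomial weights and `M` a power of two with `16 n ≤ M
^ 2 ≤ 64 n`, a trial picks a side of the mode, a geometric number `b` and a uniform `o < M`, and
accepts the distance `i = b M + o` with probability `2 ^ b * w (m ± i) / w m`. The decay of the
weights makes this at most one (`Side.two_pow_mul_ratio_le_one`), and `w m ≤ 64 / M` makes a trial
succeed with probability at least `1 / 256` (`IsMode.mul_binWeight_le`). The ratio is a product of
`i` factors, too long to compute in each trial. Logarithms give a lower bound with error of order `i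
/ n` (`Side.error_le`), and an auxiliary coin with this error as its bias decides whether the exact
product is needed. The expected cost of the product is then of order `i ^ 2 / n`, that is `(b + 1) ^
2`, which has bounded mean for geometric `b`.

Verification of the sampler. Random runs are replaced by functions of configurations satisfying the
one-step inequality `IsSubvalue`. The truncated expected running time and the probability of having
halted with output in `B` are of this kind, so one bound `κ * E + Q g` for all such functions
controls cost and law together (`cost_and_output_le`). A bound on the law from above suffices,
because a probability measure dominated by a probability measure equals it. Loops without a
deterministic bound on their length become linear inequalities (`RegSubvalue.coin`,
`sampler_reject_le`).

Pricing. Neither random bits nor the sampler are needed. The oracle of the model with `4 q ^ 2`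
steps evaluates `ψ` exactly at Black-Scholes prices whose standardised Brownian value runs through a
grid of mesh `1 / q` (`payoffOracle_grid`). As a function of this value the payoff is a combination
of monotone step functions, so a Gaussian weighted mean over the grid has a bias of the order of
length times mesh plus tail (`abs_mean_sub_integral_gaussianReal_le`), without any smoothness. A
fresh initial price at each grid point gives variance `O(1 / q)`, and Chebyshev's inequality
concludes (`measure_abs_weightedMean_sub_le`). It suffices that `q` is of order `ε⁻²` and the number
of points of order `q log (2 / ε)` (`exists_grid`); constants that the program cannot know, such as
the jumps of `ψ`, are absorbed by the input `A`. -/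

namespace OptionPricing

/-! ### Measurability of runs -/

/-- A random configuration all of whose components are measurable. -/
structure MeasurableConfig {α : Type*} [MeasurableSpace α] (c : α → Config) : Prop where
  pc : Measurable fun a => (c a).pc
  reg : ∀ i, Measurable fun a => (c a).reg i
  price : Measurable fun a => (c a).price
  bits : Measurable fun a => (c a).bits
  prices : Measurable fun a => (c a).prices

/-- Program counters, tape positions and oracle arguments are themselves random, but they are
natural numbers; measurability can be checked for each fixed index. -/
theorem measurable_eval_countable {α β ι : Type*} [MeasurableSpace α] [MeasurableSpace β]
    [Countable ι] [MeasurableSpace ι] [MeasurableSingletonClass ι] {f : ι → α → β} {g : α → ι}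
    (hf : ∀ k, Measurable (f k)) (hg : Measurable g) : Measurable fun a => f (g a) a :=
  (measurable_from_prod_countable_right (f := fun p : ι × α => f p.1 p.2) hf).comp
    (hg.prodMk measurable_id)

theorem MeasurableConfig.write {α : Type*} [MeasurableSpace α] {c : α → Config}
    (hc : MeasurableConfig c) (d : ℕ) {v : α → ℝ} (hv : Measurable v) :
    MeasurableConfig fun a => (c a).write d (v a) where
  pc := hc.pc.add_const 1
  reg i := by
    by_cases h : i = d
    · subst h; simpa [Config.write] using hv
    · simpa [Config.write, Function.update_of_ne h] using hc.reg i
  price := hc.price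
  bits := hc.bits
  prices := hc.prices

theorem measurable_answer {α : Type*} [MeasurableSpace α] {O : ℕ → ℝ → ℕ → ℝ}
    (hO : ∀ n k, Measurable fun s => O n s k) {x s y : α → ℝ} (hx : Measurable x)
    (hs : Measurable s) (hy : Measurable y) :
    Measurable fun a => answer O (x a) (s a) (y a) := by
  unfold answer
  have hfx := Nat.measurable_floor.comp hx
  have hfy := Nat.measurable_floor.comp hy
  refine Measurable.ite ?_ ?_ measurable_const
  · refine (measurableSet_eq_fun (measurable_from_nat.comp hfx) hx).inter
      ((measurableSet_eq_fun (measurable_from_nat.comp hfy) hy).inter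
        ((measurableSet_lt measurable_const hfx).inter (measurableSet_le hfy hfx)))
  · exact measurable_eval_countable
      (f := fun (n : ℕ) a => O n (s a) ⌊y a⌋₊) (fun n => measurable_eval_countable
        (f := fun (k : ℕ) a => O n (s a) k) (fun k => (hO n k).comp hs) hfy) hfx

theorem MeasurableConfig.exec {α : Type*} [MeasurableSpace α] {O : ℕ → ℝ → ℕ → ℝ}
    (hO : ∀ n k, Measurable fun s => O n s k) {c : α → Config} (hc : MeasurableConfig c)
    {τ : α → Tape} (hτ : Measurable τ) (i : Instr) :
    MeasurableConfig fun a => exec O (τ a) (c a) i := by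
  cases i with
  | const d q => exact hc.write d measurable_const
  | add d x y => exact hc.write d ((hc.reg x).add (hc.reg y))
  | sub d x y => exact hc.write d ((hc.reg x).sub (hc.reg y))
  | mul d x y => exact hc.write d ((hc.reg x).mul (hc.reg y))
  | div d x y => exact hc.write d ((hc.reg x).div (hc.reg y))
  | sqrt d x => exact hc.write d (hc.reg x).sqrt
  | exp d x => exact hc.write d (hc.reg x).exp
  | log d x => exact hc.write d (hc.reg x).log
  | jumpLE x y target =>
    exact ⟨Measurable.ite (measurableSet_le (hc.reg x) (hc.reg y)) measurable_const
      (hc.pc.add_const 1), hc.reg, hc.price, hc.bits, hc.prices⟩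
  | flip d =>
    have hb : Measurable fun a => (τ a).1 (c a).bits := measurable_eval_countable
      (f := fun (k : ℕ) a => (τ a).1 k) (fun k => (measurable_pi_apply k).comp hτ.fst) hc.bits
    have := hc.write d (v := fun a => if (τ a).1 (c a).bits then 1 else 0)
      ((measurable_of_countable fun b : Bool => if b then (1 : ℝ) else 0).comp hb)
    exact ⟨this.pc, this.reg, this.price, hc.bits.add_const 1, this.prices⟩
  | init d =>
    have hp : Measurable fun a => (τ a).2 (c a).prices := measurable_eval_countable
      (f := fun (k : ℕ) a => (τ a).2 k) (fun k => (measurable_pi_apply k).comp hτ.snd) hc.prices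
    have := hc.write d hp
    exact ⟨this.pc, this.reg, hp, this.bits, hc.prices.add_const 1⟩
  | query d n k => exact hc.write d (measurable_answer hO (hc.reg n) hc.price (hc.reg k))

theorem MeasurableConfig.step {α : Type*} [MeasurableSpace α] {O : ℕ → ℝ → ℕ → ℝ}
    (hO : ∀ n k, Measurable fun s => O n s k) (prog : List Instr) {c : α → Config}
    (hc : MeasurableConfig c) {τ : α → Tape} (hτ : Measurable τ) :
    MeasurableConfig fun a => step prog O (τ a) (c a) := by
  have key : ∀ k : ℕ, MeasurableConfig fun a => match prog[k]? with
      | some i => OptionPricing.exec O (τ a) (c a) i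
      | none => c a := by
    intro k
    cases prog[k]? with
    | none => exact hc
    | some i => exact hc.exec hO hτ i
  unfold OptionPricing.step
  exact ⟨measurable_eval_countable (fun k => (key k).pc) hc.pc,
    fun i => measurable_eval_countable (fun k => (key k).reg i) hc.pc,
    measurable_eval_countable (fun k => (key k).price) hc.pc,
    measurable_eval_countable (fun k => (key k).bits) hc.pc,
    measurable_eval_countable (fun k => (key k).prices) hc.pc⟩

theorem MeasurableConfig.iterate_step {α : Type*} [MeasurableSpace α] {O : ℕ → ℝ → ℕ → ℝ}
    (hO : ∀ n k, Measurable fun s => O n s k) (prog : List Instr) {c : α → Config}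
    (hc : MeasurableConfig c) {τ : α → Tape} (hτ : Measurable τ) (t : ℕ) :
    MeasurableConfig fun a => (OptionPricing.step prog O (τ a))^[t] (c a) := by
  induction t with
  | zero => exact hc
  | succ t ih => simpa only [Function.iterate_succ_apply'] using ih.step hO prog hτ

theorem MeasurableConfig.const {α : Type*} [MeasurableSpace α] (c : Config) :
    MeasurableConfig fun _ : α => c :=
  ⟨measurable_const, fun _ => measurable_const, measurable_const, measurable_const,
    measurable_const⟩

theorem measurableSet_halted {O : ℕ → ℝ → ℕ → ℝ} (hO : ∀ n k, Measurable fun s => O n s k)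
    (prog : List Instr) (input : List ℝ) (t : ℕ) :
    MeasurableSet {τ | Halted prog O input τ t} :=
  measurableSet_le measurable_const
    ((MeasurableConfig.const (start input)).iterate_step hO prog measurable_id t).pc

theorem step_of_halted {prog : List Instr} {c : Config} (h : prog.length ≤ c.pc)
    (O : ℕ → ℝ → ℕ → ℝ) (τ : Tape) : step prog O τ c = c := by
  simp [step, List.getElem?_eq_none h]

theorem iterate_step_of_halted {prog : List Instr} {c : Config} (h : prog.length ≤ c.pc)
    (O : ℕ → ℝ → ℕ → ℝ) (τ : Tape) (t : ℕ) : (step prog O τ)^[t] c = c :=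
  Function.iterate_fixed (step_of_halted h O τ) t

theorem run_of_halted {prog : List Instr} {O : ℕ → ℝ → ℕ → ℝ} {input : List ℝ} {τ : Tape}
    {s t : ℕ} (h : Halted prog O input τ s) (hst : s ≤ t) :
    run prog O input τ t = run prog O input τ s := by
  obtain ⟨k, rfl⟩ := Nat.exists_eq_add_of_le' hst
  simp only [run, Function.iterate_add_apply]
  exact iterate_step_of_halted h O τ k

theorem Halted.mono {prog : List Instr} {O : ℕ → ℝ → ℕ → ℝ} {input : List ℝ} {τ : Tape}
    {s t : ℕ} (h : Halted prog O input τ s) (hst : s ≤ t) : Halted prog O input τ t := by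
  unfold Halted
  rw [run_of_halted h hst]
  exact h

theorem output_of_halted {prog : List Instr} {O : ℕ → ℝ → ℕ → ℝ} {input : List ℝ} {τ : Tape}
    {t : ℕ} (h : Halted prog O input τ t) :
    output prog O input τ = (run prog O input τ t).reg 0 := by
  classical
  have hex : ∃ t, Halted prog O input τ t := ⟨t, h⟩
  unfold output
  rw [dif_pos hex]
  congr 1
  convert (run_of_halted (Nat.find_spec hex) (Nat.find_min' hex h)).symm

theorem cost_le_of_halted {prog : List Instr} {O : ℕ → ℝ → ℕ → ℝ} {input : List ℝ} {τ : Tape}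
    {t : ℕ} (h : Halted prog O input τ t) : cost prog O input τ ≤ t :=
  iInf₂_le t h

/-- The output is a pointwise limit: the register of the run cut off at time `t` is eventually
constant in `t`, and identically zero if the run never halts. -/
theorem measurable_output {O : ℕ → ℝ → ℕ → ℝ} (hO : ∀ n k, Measurable fun s => O n s k)
    (prog : List Instr) (input : List ℝ) : Measurable (output prog O input) := by
  classical
  have hm : ∀ t, Measurable fun τ =>
      if Halted prog O input τ t then (run prog O input τ t).reg 0 else 0 := fun t =>
    Measurable.ite (measurableSet_halted hO prog input t)
      (((MeasurableConfig.const (start input)).iterate_step hO prog measurable_id t).reg 0)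
      measurable_const
  refine measurable_of_tendsto_metrizable hm (tendsto_pi_nhds.2 fun τ => ?_)
  by_cases h : ∃ t, Halted prog O input τ t
  · obtain ⟨t, ht⟩ := h
    refine tendsto_atTop_of_eventually_const (i₀ := t) fun s hs => ?_
    rw [if_pos (ht.mono hs), output_of_halted (ht.mono hs)]
  · have : output prog O input τ = 0 := by unfold output; rw [dif_neg h]
    rw [this]
    refine tendsto_atTop_of_eventually_const (i₀ := 0) fun s _ => ?_
    rw [if_neg fun hs => h ⟨s, hs⟩]

/-- A running time is the sum of the indicators of still running; integrating turns expected cost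
into a sum of probabilities. -/
theorem cost_le_tsum (prog : List Instr) (O : ℕ → ℝ → ℕ → ℝ) (input : List ℝ) (τ : Tape) :
    cost prog O input τ ≤
      ∑' t, {τ | Halted prog O input τ t}ᶜ.indicator (fun _ => (1 : ℝ≥0∞)) τ := by
  classical
  by_cases h : ∃ t, Halted prog O input τ t
  · refine (cost_le_of_halted (Nat.find_spec h)).trans ?_
    refine le_trans ?_ (ENNReal.sum_le_tsum (Finset.range (Nat.find h)))
    rw [Finset.sum_congr rfl (g := fun _ => (1 : ℝ≥0∞))]
    · simp
    · intro t ht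
      rw [Set.indicator_of_mem]
      exact Nat.find_min h (Finset.mem_range.1 ht)
  · have : ∀ t, {τ | Halted prog O input τ t}ᶜ.indicator (fun _ => (1 : ℝ≥0∞)) τ = 1 := by
      intro t
      rw [Set.indicator_of_mem]
      exact fun ht => h ⟨t, ht⟩
    simp [this]

/-! ### Fair bits -/

/-- The law of a sequence of independent fair bits. -/
noncomputable abbrev bitLaw : Measure (ℕ → Bool) :=
  Measure.infinitePi fun _ : ℕ => (PMF.uniformOfFintype Bool).toMeasure

/-- Prepend a bit to a sequence of bits. -/
def consBit (p : Bool × (ℕ → Bool)) : ℕ → Bool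
  | 0 => p.1
  | n + 1 => p.2 n

/-- Drop the first `k` bits. -/
def dropBits (k : ℕ) (β : ℕ → Bool) : ℕ → Bool := fun n => β (n + k)

theorem measurable_consBit : Measurable consBit := by
  refine measurable_pi_iff.2 fun n => ?_
  cases n with
  | zero => exact measurable_fst
  | succ n => exact (measurable_pi_apply n).comp measurable_snd

theorem measurable_dropBits (k : ℕ) : Measurable (dropBits k) :=
  measurable_pi_iff.2 fun n => measurable_pi_apply (n + k)

theorem map_consBit :
    ((PMF.uniformOfFintype Bool).toMeasure.prod bitLaw).map consBit = bitLaw := by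
  classical
  refine Measure.eq_infinitePi _ fun s t ht => ?_
  -- Padding the constraints by `Set.univ` to an initial segment lets the cylinder split into its
  -- first coordinate and a shifted cylinder.
  set t' : ℕ → Set Bool := fun i => if i ∈ s then t i else Set.univ with ht'
  have hmeas : ∀ i, MeasurableSet (t' i) := fun i => MeasurableSet.of_discrete
  obtain ⟨N, hN⟩ : ∃ N, s ⊆ Finset.range (N + 1) :=
    ⟨s.sup id, fun i hi => Finset.mem_range.2 (Nat.lt_succ_of_le (Finset.le_sup (f := id) hi))⟩
  have hset : Set.pi (s : Set ℕ) t = Set.pi (Finset.range (N + 1) : Set ℕ) t' := by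
    ext β
    simp only [Set.mem_pi, ht']
    constructor
    · intro h i _
      by_cases hi : i ∈ s
      · simpa [hi] using h i hi
      · simp [hi]
    · intro h i hi
      have := h i (hN hi)
      rwa [if_pos (by exact hi)] at this
  have hprod : ∏ i ∈ s, (PMF.uniformOfFintype Bool).toMeasure (t i) =
      ∏ i ∈ Finset.range (N + 1), (PMF.uniformOfFintype Bool).toMeasure (t' i) := by
    rw [← Finset.prod_subset hN]
    · exact Finset.prod_congr rfl fun i hi => by simp [ht', hi]
    · intro i _ hi
      rw [show t' i = Set.univ by simp [ht', hi], measure_univ]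
  rw [hprod, hset, Measure.map_apply measurable_consBit
    (MeasurableSet.pi (Finset.countable_toSet _) fun i _ => hmeas i)]
  have hpre : consBit ⁻¹' Set.pi (Finset.range (N + 1) : Set ℕ) t' =
      t' 0 ×ˢ Set.pi (Finset.range N : Set ℕ) fun i => t' (i + 1) := by
    ext ⟨x, β⟩
    simp only [Set.mem_preimage, Set.mem_pi, Set.mem_prod, Finset.coe_range, Set.mem_Iio]
    constructor
    · intro h
      exact ⟨h 0 (Nat.succ_pos N), fun i hi => h (i + 1) (Nat.succ_lt_succ hi)⟩
    · rintro ⟨h0, h⟩ i hi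
      cases i with
      | zero => exact h0
      | succ i => exact h i (Nat.lt_of_succ_lt_succ hi)
  rw [hpre, Measure.prod_prod, Measure.infinitePi_pi _ fun i _ => hmeas _,
    Finset.prod_range_succ', mul_comm]

/-- Conditioning on the first bit, which is independent of the remaining sequence; the latter has
the same law again. -/
theorem lintegral_bitLaw {F : Bool → (ℕ → Bool) → ℝ≥0∞} (hF : ∀ b, Measurable (F b)) :
    ∫⁻ β, F (β 0) (dropBits 1 β) ∂bitLaw =
      (∫⁻ β, F true β ∂bitLaw + ∫⁻ β, F false β ∂bitLaw) / 2 := by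
  have hF' : Measurable fun p : Bool × (ℕ → Bool) => F p.1 p.2 :=
    measurable_from_prod_countable_right hF
  have h0 : Measurable fun β : ℕ → Bool => F (β 0) (dropBits 1 β) :=
    hF'.comp ((measurable_pi_apply 0).prodMk (measurable_dropBits 1))
  conv_lhs => rw [← map_consBit]
  rw [lintegral_map h0 measurable_consBit]
  have : ∀ p : Bool × (ℕ → Bool), F (consBit p 0) (dropBits 1 (consBit p)) = F p.1 p.2 :=
    fun p => rfl
  simp only [this]
  rw [lintegral_prod _ hF'.aemeasurable, lintegral_fintype]
  simp [ENNReal.div_eq_inv_mul, mul_add, mul_comm]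

theorem map_dropBits (k : ℕ) : bitLaw.map (dropBits k) = bitLaw := by
  have h1 : bitLaw.map (dropBits 1) = bitLaw := by
    refine Measure.ext fun s hs => ?_
    rw [← lintegral_indicator_one hs, ← lintegral_indicator_one hs,
      lintegral_map (measurable_one.indicator hs) (measurable_dropBits 1),
      lintegral_bitLaw (F := fun _ β => s.indicator 1 β) fun _ => measurable_one.indicator hs,
      ← two_mul, mul_comm, ENNReal.mul_div_cancel_right (by simp) (by simp)]
  induction k with
  | zero => exact Measure.map_id
  | succ k ih =>
    have : dropBits (k + 1) = dropBits 1 ∘ dropBits k := by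
      funext β n
      simp [dropBits, add_comm, add_left_comm]
    rw [this, ← Measure.map_map (measurable_dropBits 1) (measurable_dropBits k), ih, h1]

/-! ### Averages over the fair bits, with the initial prices fixed -/

/-- Increase the number of used bits. -/
def Config.addBits (b : ℕ) (c : Config) : Config := { c with bits := c.bits + b }

/-- Only the unread part of the tape matters: having used `b` more bits is the same as running on
the tape shifted by `b`. -/
theorem step_addBits (prog : List Instr) (O : ℕ → ℝ → ℕ → ℝ) (β : ℕ → Bool) (z : ℕ → ℝ)
    (b : ℕ) (c : Config) :
    step prog O (β, z) (c.addBits b) = (step prog O (dropBits b β, z) c).addBits b := by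
  unfold step
  have : (c.addBits b).pc = c.pc := rfl
  rw [this]
  cases prog[c.pc]? with
  | none => rfl
  | some i =>
    cases i with
    | flip d => simp only [exec, Config.addBits, Config.write, dropBits, add_right_comm]; rfl
    | _ => rfl

theorem iterate_step_addBits (prog : List Instr) (O : ℕ → ℝ → ℕ → ℝ) (β : ℕ → Bool)
    (z : ℕ → ℝ) (b t : ℕ) (c : Config) :
    (step prog O (β, z))^[t] (c.addBits b) =
      ((step prog O (dropBits b β, z))^[t] c).addBits b := by
  induction t with
  | zero => rfl
  | succ t ih => rw [Function.iterate_succ_apply', ih, step_addBits, Function.iterate_succ_apply']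

/-- One step in which the next fair bit is `b`. -/
noncomputable def bitStep (prog : List Instr) (O : ℕ → ℝ → ℕ → ℝ) (z : ℕ → ℝ) (b : Bool)
    (c : Config) : Config :=
  step prog O (fun _ => b, z) c

/-- A single step inspects at most the bit at position `c.bits`, so a constant bit sequence can
replace the tape. -/
theorem step_eq_bitStep (prog : List Instr) (O : ℕ → ℝ → ℕ → ℝ) (β : ℕ → Bool) (z : ℕ → ℝ)
    (c : Config) : step prog O (β, z) c = bitStep prog O z (β c.bits) c := by
  unfold bitStep step
  cases prog[c.pc]? with
  | none => rfl
  | some i => cases i <;> rfl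

theorem bitStep_bits (prog : List Instr) (O : ℕ → ℝ → ℕ → ℝ) (z : ℕ → ℝ) (c : Config) :
    (∀ b, (bitStep prog O z b c).bits = c.bits + 1) ∨
      ∀ b, bitStep prog O z b c = bitStep prog O z true c ∧
        (bitStep prog O z b c).bits = c.bits := by
  unfold bitStep step
  cases prog[c.pc]? with
  | none => exact Or.inr fun b => ⟨rfl, rfl⟩
  | some i => cases i <;> first | exact Or.inr fun b => ⟨rfl, rfl⟩ | exact Or.inl fun b => rfl

/-- A test function of configurations that is measurable along measurable random configurations
and that does not depend on the number of used bits. -/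
structure TestFunction (H : Config → ℝ≥0∞) : Prop where
  measurable : ∀ c : (ℕ → Bool) → Config, MeasurableConfig c → Measurable fun β => H (c β)
  addBits : ∀ b c, H (Config.addBits b c) = H c

/-- The expectation of `H` after `t` steps from `c`, over the fair bits. -/
noncomputable def bitMean (prog : List Instr) (O : ℕ → ℝ → ℕ → ℝ) (z : ℕ → ℝ)
    (H : Config → ℝ≥0∞) (t : ℕ) (c : Config) : ℝ≥0∞ :=
  ∫⁻ β, H ((step prog O (β, z))^[t] c) ∂bitLaw

section

variable {prog : List Instr} {O : ℕ → ℝ → ℕ → ℝ} {z : ℕ → ℝ} {H : Config → ℝ≥0∞}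

theorem TestFunction.measurable_iterate (hH : TestFunction H)
    (hO : ∀ n k, Measurable fun s => O n s k) (t : ℕ) (c : Config) :
    Measurable fun β : ℕ → Bool => H ((step prog O (β, z))^[t] c) :=
  hH.measurable _ ((MeasurableConfig.const c).iterate_step hO prog
    (measurable_id.prodMk measurable_const) t)

theorem bitMean_addBits (hH : TestFunction H) (hO : ∀ n k, Measurable fun s => O n s k)
    (b t : ℕ) (c : Config) :
    bitMean prog O z H t (c.addBits b) = bitMean prog O z H t c := by
  unfold bitMean
  simp only [iterate_step_addBits, hH.addBits]
  conv_rhs => rw [← map_dropBits b]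
  rw [lintegral_map (hH.measurable_iterate hO t c) (measurable_dropBits b)]

/-- The Markov property in the form of first-step analysis. When the step reads no bit, the two
successors coincide, so the same formula covers both cases. -/
theorem bitMean_succ (hH : TestFunction H) (hO : ∀ n k, Measurable fun s => O n s k)
    (t : ℕ) (c : Config) :
    bitMean prog O z H (t + 1) c =
      (bitMean prog O z H t (bitStep prog O z true c) +
        bitMean prog O z H t (bitStep prog O z false c)) / 2 := by
  -- The mean does not depend on the number of used bits, so the bit read next may be taken to be
  -- the first of the tape.
  wlog hc : c.bits = 0 generalizing c
  · have h0 : c = Config.addBits c.bits { c with bits := 0 } := by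
      simp [Config.addBits]
    have hb : ∀ b, bitStep prog O z b c =
        (bitStep prog O z b { c with bits := 0 }).addBits c.bits := by
      intro b
      conv_lhs => rw [h0]
      exact step_addBits _ _ _ _ _ _
    rw [hb, hb, h0, bitMean_addBits hH hO, bitMean_addBits hH hO, bitMean_addBits hH hO]
    exact this _ rfl
  rcases bitStep_bits prog O z c with h | h
  · have hb : ∀ b, bitStep prog O z b c =
        Config.addBits 1 { bitStep prog O z b c with bits := 0 } := by
      intro b
      have := h b
      rw [hc, zero_add] at this
      simp only [Config.addBits, zero_add]
      rw [← this]
    have hint : bitMean prog O z H (t + 1) c = ∫⁻ β, (fun b β' =>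
        H ((step prog O (β', z))^[t] { bitStep prog O z b c with bits := 0 })) (β 0)
          (dropBits 1 β) ∂bitLaw := by
      unfold bitMean
      refine lintegral_congr fun β => ?_
      rw [Function.iterate_succ_apply, step_eq_bitStep, hc, hb, iterate_step_addBits, hH.addBits]
    refine hint.trans ((lintegral_bitLaw (F := fun b β' =>
        H ((step prog O (β', z))^[t] { bitStep prog O z b c with bits := 0 }))
      fun b => hH.measurable_iterate hO t _).trans ?_)
    rw [hb true, hb false, bitMean_addBits hH hO, bitMean_addBits hH hO]
    rfl
  · have : bitMean prog O z H (t + 1) c = bitMean prog O z H t (bitStep prog O z true c) := by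
      unfold bitMean
      refine lintegral_congr fun β => ?_
      rw [Function.iterate_succ_apply, step_eq_bitStep, (h _).1]
    rw [this, (h false).1, ← two_mul, mul_comm, ENNReal.mul_div_cancel_right (by simp) (by simp)]

theorem bitMean_of_halted {c : Config} (h : prog.length ≤ c.pc) (t : ℕ) :
    bitMean prog O z H t c = H c := by
  simp [bitMean, iterate_step_of_halted h]

theorem bitMean_le_one (hH : ∀ c, H c ≤ 1) (t : ℕ) (c : Config) :
    bitMean prog O z H t c ≤ 1 := by
  unfold bitMean
  calc _ ≤ ∫⁻ _, 1 ∂bitLaw := lintegral_mono fun β => hH _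
    _ = 1 := by simp

end

/-- A real function of configurations that is bounded above, is at most `g` of the output at
halting configurations, and increases on average by at most `κ` less than one step takes. -/
structure IsSubvalue (prog : List Instr) (O : ℕ → ℝ → ℕ → ℝ) (z : ℕ → ℝ) (κ : ℝ) (g : ℝ → ℝ)
    (V : Config → ℝ) : Prop where
  bounded : ∃ B, ∀ c, V c ≤ B
  halted : ∀ c, prog.length ≤ c.pc → V c ≤ g (c.reg 0)
  step : ∀ c, c.pc < prog.length →
    V c ≤ κ + (V (bitStep prog O z true c) + V (bitStep prog O z false c)) / 2

/-- The indicator of the configurations that have not halted. -/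
noncomputable def runningTest (prog : List Instr) (c : Config) : ℝ≥0∞ :=
  if prog.length ≤ c.pc then 0 else 1

/-- The indicator of the configurations that have halted with an output in `B`. -/
noncomputable def outputTest (prog : List Instr) (B : Set ℝ) (c : Config) : ℝ≥0∞ :=
  open Classical in if prog.length ≤ c.pc ∧ c.reg 0 ∈ B then 1 else 0

theorem testFunction_runningTest (prog : List Instr) : TestFunction (runningTest prog) :=
  ⟨fun _ hc => Measurable.ite (measurableSet_le measurable_const hc.pc) measurable_const
    measurable_const, fun _ _ => rfl⟩

theorem testFunction_outputTest (prog : List Instr) {B : Set ℝ} (hB : MeasurableSet B) :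
    TestFunction (outputTest prog B) :=
  ⟨fun _ hc => Measurable.ite ((measurableSet_le measurable_const hc.pc).inter (hc.reg 0 hB))
    measurable_const measurable_const, fun _ _ => rfl⟩

theorem runningTest_le_one (prog : List Instr) (c : Config) : runningTest prog c ≤ 1 := by
  unfold runningTest; split_ifs <;> simp

theorem outputTest_le_one (prog : List Instr) (B : Set ℝ) (c : Config) :
    outputTest prog B c ≤ 1 := by
  unfold outputTest; split_ifs <;> simp

section

variable {prog : List Instr} {O : ℕ → ℝ → ℕ → ℝ} {z : ℕ → ℝ}

theorem toReal_bitMean_succ {H : Config → ℝ≥0∞} (hH : TestFunction H) (h1 : ∀ c, H c ≤ 1)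
    (hO : ∀ n k, Measurable fun s => O n s k) (t : ℕ) (c : Config) :
    (bitMean prog O z H (t + 1) c).toReal =
      ((bitMean prog O z H t (bitStep prog O z true c)).toReal +
        (bitMean prog O z H t (bitStep prog O z false c)).toReal) / 2 := by
  have hfin : ∀ c, bitMean prog O z H t c ≠ ∞ := fun c =>
    ((bitMean_le_one h1 t c).trans_lt ENNReal.one_lt_top).ne
  rw [bitMean_succ hH hO, ENNReal.toReal_div, ENNReal.toReal_add (hfin _) (hfin _)]
  simp

/-- The expected running time truncated at `t`. The truncation provides boundedness; raising the
horizon from `t` to `t + 1` only increases the sum, which gives the one-step inequality. -/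
theorem isSubvalue_cost (hO : ∀ n k, Measurable fun s => O n s k) (t : ℕ) :
    IsSubvalue prog O z 1 (fun _ => 0) fun c =>
      ∑ s ∈ Finset.range t, (bitMean prog O z (runningTest prog) s c).toReal where
  bounded := ⟨t, fun c => by
    refine (Finset.sum_le_card_nsmul _ _ 1 fun s _ => ?_).trans (by simp)
    exact ENNReal.toReal_mono ENNReal.one_ne_top (bitMean_le_one (runningTest_le_one prog) s c)⟩
  halted c hc := by simp [bitMean_of_halted hc, runningTest, hc]
  step c hc := by
    have hle : ∀ s, (bitMean prog O z (runningTest prog) s c).toReal ≤ 1 := fun s =>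
      ENNReal.toReal_mono ENNReal.one_ne_top (bitMean_le_one (runningTest_le_one prog) s c)
    rw [← Finset.sum_add_distrib, Finset.sum_div]
    calc _ ≤ ∑ s ∈ Finset.range (t + 1), (bitMean prog O z (runningTest prog) s c).toReal :=
          Finset.sum_le_sum_of_subset_of_nonneg (Finset.range_subset_range.2 (Nat.le_succ t))
            fun _ _ _ => ENNReal.toReal_nonneg
      _ = ∑ s ∈ Finset.range t, (bitMean prog O z (runningTest prog) (s + 1) c).toReal +
            (bitMean prog O z (runningTest prog) 0 c).toReal := Finset.sum_range_succ' _ _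
      _ ≤ _ := by
        rw [add_comm]
        refine add_le_add (hle 0) (le_of_eq (Finset.sum_congr rfl fun s _ => ?_))
        exact toReal_bitMean_succ (testFunction_runningTest prog) (runningTest_le_one prog) hO s c

/-- The probability of having halted with output in `B` by time `t` costs nothing per step, hence `κ
= 0`. -/
theorem isSubvalue_output (hO : ∀ n k, Measurable fun s => O n s k) {B : Set ℝ}
    (hB : MeasurableSet B) (t : ℕ) :
    IsSubvalue prog O z 0 (B.indicator 1) fun c =>
      (bitMean prog O z (outputTest prog B) t c).toReal where
  bounded := ⟨1, fun c =>
    ENNReal.toReal_mono ENNReal.one_ne_top (bitMean_le_one (outputTest_le_one prog B) t c)⟩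
  halted c hc := by
    classical
    rw [bitMean_of_halted hc]
    by_cases h : c.reg 0 ∈ B <;> simp [outputTest, hc, h]
  step c hc := by
    rw [zero_add, ← toReal_bitMean_succ (testFunction_outputTest prog hB)
      (outputTest_le_one prog B) hO]
    refine ENNReal.toReal_mono ((bitMean_le_one (outputTest_le_one prog B) _ c).trans_lt
      ENNReal.one_lt_top).ne ?_
    -- A halted run keeps its output, so the test at time `t` is at most the test at time `t + 1`.
    refine lintegral_mono fun β => ?_
    rw [Function.iterate_succ_apply']
    by_cases h : prog.length ≤ ((OptionPricing.step prog O (β, z))^[t] c).pc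
    · rw [step_of_halted h]
    · simp [outputTest, h]

/-- Bounds of all subvalues at the start bound the expected cost and the law of the output. -/
theorem cost_and_output_le (hO : ∀ n k, Measurable fun s => O n s k) {input : List ℝ} {E : ℝ}
    {Q : (ℝ → ℝ) → ℝ} (hQ : Q (fun _ => 0) = 0)
    (hV : ∀ (κ : ℝ) (g : ℝ → ℝ) (V : Config → ℝ), 0 ≤ κ → IsSubvalue prog O z κ g V →
      V (start input) ≤ κ * E + Q g) :
    ∫⁻ β, cost prog O input (β, z) ∂bitLaw ≤ ENNReal.ofReal E ∧
      ∀ B, MeasurableSet B →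
        bitLaw {β | output prog O input (β, z) ∈ B} ≤ ENNReal.ofReal (Q (B.indicator 1)) := by
  have hrun : ∀ t, Measurable fun β : ℕ → Bool => runningTest prog (run prog O input (β, z) t) :=
    fun t => (testFunction_runningTest prog).measurable_iterate hO t _
  have hpart : ∀ t, ∑ s ∈ Finset.range t,
      ∫⁻ β, runningTest prog (run prog O input (β, z) s) ∂bitLaw ≤ ENNReal.ofReal E := by
    intro t
    have := hV 1 _ _ zero_le_one (isSubvalue_cost hO t)
    rw [hQ, add_zero, one_mul] at this
    have hfin : ∀ s ∈ Finset.range t,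
        bitMean prog O z (runningTest prog) s (start input) ≠ ∞ := fun s _ =>
      ((bitMean_le_one (runningTest_le_one prog) s _).trans_lt ENNReal.one_lt_top).ne
    rw [← ENNReal.toReal_sum hfin] at this
    exact ENNReal.le_ofReal_iff_toReal_le (ENNReal.sum_ne_top.2 hfin)
      (ENNReal.toReal_nonneg.trans this) |>.2 this
  have htsum : ∑' t, ∫⁻ β, runningTest prog (run prog O input (β, z) t) ∂bitLaw ≤
      ENNReal.ofReal E := by
    rw [ENNReal.tsum_eq_iSup_nat]
    exact iSup_le hpart
  refine ⟨?_, fun B hB => ?_⟩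
  · refine le_trans ?_ htsum
    rw [← lintegral_tsum fun t => (hrun t).aemeasurable]
    refine lintegral_mono fun β => (cost_le_tsum prog O input (β, z)).trans
      (ENNReal.tsum_le_tsum fun t => ?_)
    by_cases h : Halted prog O input (β, z) t
    · simp [Set.indicator, h]
    · have : ¬ prog.length ≤ (run prog O input (β, z) t).pc := h
      simp [Set.indicator, runningTest, this, h]
  -- A convergent sum of running probabilities has terms tending to zero, so the outputs not yet
  -- produced at time `t` are negligible in the limit.
  · have hlim : Filter.Tendsto
        (fun t => ∫⁻ β, runningTest prog (run prog O input (β, z) t) ∂bitLaw) Filter.atTop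
        (nhds 0) :=
      ENNReal.tendsto_atTop_zero_of_tsum_ne_top (htsum.trans_lt ENNReal.ofReal_lt_top).ne
    have hle : ∀ t, bitLaw {β | output prog O input (β, z) ∈ B} ≤
        ENNReal.ofReal (Q (B.indicator 1)) +
          ∫⁻ β, runningTest prog (run prog O input (β, z) t) ∂bitLaw := by
      intro t
      have h1 := hV 0 _ _ le_rfl (isSubvalue_output hO hB t)
      rw [zero_mul, zero_add] at h1
      have h2 : bitMean prog O z (outputTest prog B) t (start input) ≤
          ENNReal.ofReal (Q (B.indicator 1)) :=
        ENNReal.le_ofReal_iff_toReal_le ((bitMean_le_one (outputTest_le_one prog B) t _).trans_lt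
          ENNReal.one_lt_top).ne (ENNReal.toReal_nonneg.trans h1) |>.2 h1
      refine le_trans ?_ (add_le_add_left h2 _)
      have hm : MeasurableSet {β : ℕ → Bool | output prog O input (β, z) ∈ B} :=
        (measurable_output hO prog input).comp (measurable_id.prodMk measurable_const) hB
      rw [← lintegral_indicator_one hm]
      unfold bitMean
      rw [← lintegral_add_right _ (hrun t)]
      refine lintegral_mono fun β => ?_
      by_cases h : Halted prog O input (β, z) t
      · have h' : prog.length ≤ ((OptionPricing.step prog O (β, z))^[t] (start input)).pc := h
        by_cases hb : output prog O input (β, z) ∈ B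
        · have hb' := hb
          rw [output_of_halted h] at hb'
          have hb'' : ((OptionPricing.step prog O (β, z))^[t] (start input)).reg 0 ∈ B := hb'
          simp [Set.indicator, hb, outputTest, h', hb'']
        · simp [Set.indicator, hb]
      · have : ¬ prog.length ≤ (run prog O input (β, z) t).pc := h
        simp only [runningTest, this, if_false]
        refine le_trans ?_ le_add_self
        exact Set.indicator_le_self' (fun _ _ => zero_le) β |>.trans (by simp)
    refine ge_of_tendsto' (x := Filter.atTop) ?_ hle
    simpa using hlim.const_add (ENNReal.ofReal (Q (B.indicator 1)))

end

/-! ### Piecewise constant payoffs -/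

/-- A piecewise constant function is a linear combination of indicators of half-lines. -/
theorem IsPiecewiseConstant.exists_eq_sum {ψ : ℝ → ℝ} (h : IsPiecewiseConstant ψ) :
    ∃ (m : ℕ) (K : Fin m → ℝ) (a : ℝ) (c : Fin m → ℝ),
      ∀ x, ψ x = a + ∑ j, c j * (Set.Ici (K j)).indicator 1 x := by
  obtain ⟨m, K, ψL, ψR, ψM, hK, hL, hM, hR⟩ := h
  induction m generalizing ψ ψR with
  | zero =>
    refine ⟨1, K, ψL, fun _ => ψR - ψL, fun x => ?_⟩
    by_cases hx : x < K 0
    · simp [hL x hx, hx]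
    · have := hR x (not_lt.1 hx)
      simp [this, not_lt.1 hx]
  | succ m ih =>
    -- Induction on the number of thresholds: `ψ` is flattened beyond its last threshold, and the
    -- removed jump `ψR - a` becomes one more half-line indicator.
    set a := ψM (Fin.last m)
    obtain ⟨m', K', a', c', h'⟩ := ih (ψ := fun x => if K (Fin.last (m + 1)) ≤ x then a else ψ x)
      (K := fun j => K j.castSucc) (ψR := a) (ψM := fun j => ψM j.castSucc)
      (fun i j hij => hK (Fin.castSucc_lt_castSucc_iff.2 hij))
      (fun x hx => by
        have : ¬ K (Fin.last (m + 1)) ≤ x :=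
          not_le.2 (hx.trans_le (hK.monotone (Fin.le_last _)))
        simpa [this] using hL x hx)
      (fun j x h1 h2 => by
        have : ¬ K (Fin.last (m + 1)) ≤ x :=
          not_le.2 (h2.trans_le (hK.monotone (Fin.le_last _)))
        simpa [this] using hM j.castSucc x h1 (by simpa using h2))
      (fun x hx => by
        by_cases h : K (Fin.last (m + 1)) ≤ x
        · simp [h]
        · simp only [h, if_false]
          exact hM (Fin.last m) x hx (not_le.1 h))
    refine ⟨m' + 1, Fin.snoc K' (K (Fin.last (m + 1))), a', Fin.snoc c' (ψR - a), fun x => ?_⟩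
    have hx := h' x
    rw [Fin.sum_univ_castSucc]
    simp only [Fin.snoc_castSucc, Fin.snoc_last]
    by_cases h : K (Fin.last (m + 1)) ≤ x
    · simp only [h, if_true] at hx
      simp only [Set.indicator, Set.mem_Ici, h, if_true, Pi.one_apply, mul_one] at hx ⊢
      rw [hR x h, ← add_assoc, ← hx]
      ring
    · simp only [h, if_false] at hx
      simp only [Set.indicator, Set.mem_Ici, h, if_false, Pi.one_apply, mul_zero] at hx ⊢
      rw [hx, add_zero]

theorem IsPiecewiseConstant.measurable {ψ : ℝ → ℝ} (h : IsPiecewiseConstant ψ) :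
    Measurable ψ := by
  obtain ⟨m, K, a, c, h⟩ := h.exists_eq_sum
  rw [show ψ = _ from funext h]
  exact measurable_const.add (Finset.measurable_sum _ fun j _ =>
    (measurable_one.indicator measurableSet_Ici).const_mul _)

theorem measurable_payoffOracle (L : Lattice) (r σ T : ℝ) {ψ : ℝ → ℝ} (h : Measurable ψ)
    (n k : ℕ) : Measurable fun s => payoffOracle L r σ T ψ n s k :=
  h.comp (measurable_id.const_mul _)

/-! ### Binomial expectations -/

/-- The expectation of `G k` for a binomial number `k` of successes in `n` trials. -/
def binExp (p : ℝ) : ℕ → (ℕ → ℝ) → ℝ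
  | 0, G => G 0
  | n + 1, G => p * binExp p n (fun k => G (k + 1)) + (1 - p) * binExp p n G

/-- The binomial weights. -/
def binWeight (p : ℝ) (n k : ℕ) : ℝ := n.choose k * p ^ k * (1 - p) ^ (n - k)

theorem binExp_eq_sum (p : ℝ) (n : ℕ) (G : ℕ → ℝ) :
    binExp p n G = ∑ k ∈ Finset.range (n + 1), binWeight p n k * G k := by
  induction n generalizing G with
  | zero => simp [binExp, binWeight]
  | succ n ih =>
    rw [binExp, ih, ih, Finset.sum_range_succ' _ (n + 1), Finset.mul_sum, Finset.mul_sum]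
    have h1 : ∀ k ∈ Finset.range (n + 1), binWeight p (n + 1) (k + 1) * G (k + 1) =
        p * (binWeight p n k * G (k + 1)) +
          (1 - p) * (n.choose (k + 1) * p ^ (k + 1) * (1 - p) ^ (n - (k + 1)) * G (k + 1)) := by
      intro k hk
      have hk' : k ≤ n := Nat.lt_succ_iff.1 (Finset.mem_range.1 hk)
      unfold binWeight
      rw [Nat.choose_succ_succ, Nat.add_sub_add_right]
      push_cast
      rcases hk'.lt_or_eq with h | rfl
      · rw [show n - k = n - (k + 1) + 1 by omega]
        ring
      · simp
        ring
    rw [Finset.sum_congr rfl h1, Finset.sum_add_distrib, add_assoc]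
    congr 1
    rw [← Finset.mul_sum, ← Finset.mul_sum]
    have h2 : binWeight p (n + 1) 0 * G 0 = (1 - p) * (binWeight p n 0 * G 0) := by
      simp [binWeight, pow_succ]
      ring
    rw [h2, ← mul_add]
    congr 1
    have := Finset.sum_range_succ' (fun k => binWeight p n k * G k) (n + 1)
    rw [Finset.sum_range_succ, binWeight, Nat.choose_succ_self] at this
    simp only [Nat.cast_zero, zero_mul, add_zero] at this
    exact this

theorem binExp_zero (p : ℝ) (n : ℕ) : binExp p n (fun _ => 0) = 0 := by
  induction n with
  | zero => rfl
  | succ n ih => simp [binExp, ih]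

theorem binExp_nonneg {p : ℝ} (hp : p ∈ Set.Icc (0 : ℝ) 1) (n : ℕ) {G : ℕ → ℝ}
    (hG : ∀ k, 0 ≤ G k) : 0 ≤ binExp p n G := by
  induction n generalizing G with
  | zero => exact hG 0
  | succ n ih =>
    exact add_nonneg (mul_nonneg hp.1 (ih fun k => hG (k + 1)))
      (mul_nonneg (sub_nonneg.2 hp.2) (ih hG))

theorem measurable_binExp {α : Type*} [MeasurableSpace α] (p : ℝ) (n : ℕ) {G : α → ℕ → ℝ}
    (hG : ∀ k, Measurable fun a => G a k) : Measurable fun a => binExp p n (G a) := by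
  induction n generalizing G with
  | zero => exact hG 0
  | succ n ih => exact ((ih fun k => hG (k + 1)).const_mul p).add ((ih hG).const_mul (1 - p))

/-- Multiplications by `U` and `D` commute, so only the number of up-moves matters. The real-valued
`binExp` is used inside because bounds on subvalues are real inequalities. -/
theorem latticeLaw_apply {p : ℝ} (hp : p ∈ Set.Icc (0 : ℝ) 1) (U D : ℝ) (π₀ : Measure ℝ) (n : ℕ)
    {B : Set ℝ} (hB : MeasurableSet B) :
    latticeLaw p U D π₀ n B =
      ∫⁻ s, ENNReal.ofReal (binExp p n fun k => B.indicator 1 (U ^ k * D ^ (n - k) * s)) ∂π₀ := by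
  have hmeas : ∀ (c : ℕ → ℝ) {B : Set ℝ}, MeasurableSet B → ∀ k,
      Measurable fun s : ℝ => B.indicator (1 : ℝ → ℝ) (c k * s) := fun c B hB k =>
    (measurable_one.indicator hB).comp (measurable_id.const_mul _)
  have hnn : ∀ (B : Set ℝ) x, 0 ≤ B.indicator (1 : ℝ → ℝ) x := fun B x =>
    Set.indicator_nonneg (fun _ _ => zero_le_one) x
  induction n generalizing B with
  | zero =>
    simp only [latticeLaw, binExp, pow_zero, one_mul]
    rw [← lintegral_indicator_one hB]
    refine lintegral_congr fun s => ?_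
    by_cases h : s ∈ B <;> simp [h]
  | succ n ih =>
    have hU : Measurable fun s : ℝ => s * U := measurable_id.mul_const U
    have hD : Measurable fun s : ℝ => s * D := measurable_id.mul_const D
    have hpre : ∀ c x : ℝ, ((fun s => s * c) ⁻¹' B).indicator (1 : ℝ → ℝ) x =
        B.indicator 1 (x * c) := fun c x => rfl
    simp only [latticeLaw, Measure.add_apply, Measure.smul_apply, smul_eq_mul]
    rw [Measure.map_apply hU hB, Measure.map_apply hD hB, ih (hU hB), ih (hD hB),
      ← lintegral_const_mul' _ _ ENNReal.ofReal_ne_top,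
      ← lintegral_const_mul' _ _ ENNReal.ofReal_ne_top, ← lintegral_add_left]
    · refine lintegral_congr fun s => ?_
      rw [← ENNReal.ofReal_mul hp.1, ← ENNReal.ofReal_mul (sub_nonneg.2 hp.2),
        ← ENNReal.ofReal_add]
      · congr 1
        rw [binExp, binExp_eq_sum, binExp_eq_sum, binExp_eq_sum, binExp_eq_sum]
        congr 2
        · refine Finset.sum_congr rfl fun k hk => ?_
          have e : U ^ k * D ^ (n - k) * s * U = U ^ (k + 1) * D ^ (n - k) * s := by ring
          rw [hpre, e, Nat.add_sub_add_right]
        · refine Finset.sum_congr rfl fun k hk => ?_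
          have hk' : k ≤ n := Nat.lt_succ_iff.1 (Finset.mem_range.1 hk)
          have e : U ^ k * D ^ (n - k) * s * D = U ^ k * D ^ (n - k + 1) * s := by ring
          rw [hpre, e, Nat.succ_sub hk']
      · exact mul_nonneg hp.1 (binExp_nonneg hp n fun k => hnn _ _)
      · exact mul_nonneg (sub_nonneg.2 hp.2) (binExp_nonneg hp n fun k => hnn _ _)
    · exact (measurable_binExp p n (hmeas (fun k => U ^ k * D ^ (n - k)) (hU hB))).ennreal_ofReal
        |>.const_mul _

theorem isProbabilityMeasure_latticeLaw {p : ℝ} (hp : p ∈ Set.Icc (0 : ℝ) 1) (U D : ℝ)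
    (π₀ : Measure ℝ) [IsProbabilityMeasure π₀] (n : ℕ) :
    IsProbabilityMeasure (latticeLaw p U D π₀ n) := by
  induction n with
  | zero => assumption
  | succ n ih =>
    have hU : Measurable fun s : ℝ => s * U := measurable_id.mul_const U
    have hD : Measurable fun s : ℝ => s * D := measurable_id.mul_const D
    refine ⟨?_⟩
    simp only [latticeLaw, Measure.add_apply, Measure.smul_apply, smul_eq_mul]
    rw [Measure.map_apply hU .univ, Measure.map_apply hD .univ, Set.preimage_univ,
      Set.preimage_univ, measure_univ, mul_one, mul_one,
      ← ENNReal.ofReal_add hp.1 (sub_nonneg.2 hp.2)]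
    simp

instance (π₀ : Measure ℝ) [IsProbabilityMeasure π₀] : IsProbabilityMeasure (tapeMeasure π₀) := by
  unfold tapeMeasure; infer_instance

/-- A bound on all subvalues yields the exact law of the output and a bound on the expected
cost. -/
theorem map_output_eq_and_lintegral_cost_le {prog : List Instr} {L : Lattice} {r σ T E : ℝ}
    {ψ : ℝ → ℝ} (hψ : Measurable ψ) (π₀ : Measure ℝ) [IsProbabilityMeasure π₀] {n : ℕ}
    (hp : L.prob r σ (T / n) ∈ Set.Icc (0 : ℝ) 1) {input : List ℝ}
    (hV : ∀ (z : ℕ → ℝ) (κ : ℝ) (g : ℝ → ℝ) (V : Config → ℝ), 0 ≤ κ →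
      IsSubvalue prog (payoffOracle L r σ T ψ) z κ g V →
      V (start input) ≤ κ * E + binExp (L.prob r σ (T / n)) n
        fun k => g (payoffOracle L r σ T ψ n (z 0) k)) :
    (tapeMeasure π₀).map (output prog (payoffOracle L r σ T ψ) input) =
        (bopmLaw L r σ T π₀ n).map ψ ∧
      ∫⁻ τ, cost prog (payoffOracle L r σ T ψ) input τ ∂(tapeMeasure π₀) ≤ ENNReal.ofReal E := by
  have hO := measurable_payoffOracle L r σ T hψ
  have hout := measurable_output hO prog input
  have key := fun z => cost_and_output_le (z := z) (input := input) (E := E) hO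
    (Q := fun g => binExp (L.prob r σ (T / n)) n
      fun k => g (payoffOracle L r σ T ψ n (z 0) k)) (binExp_zero _ _) (hV z)
  constructor
  · have := isProbabilityMeasure_latticeLaw hp (L.up r σ (T / n)) (L.down r σ (T / n)) π₀ n
    have h1 : IsProbabilityMeasure ((bopmLaw L r σ T π₀ n).map ψ) :=
      Measure.isProbabilityMeasure_map (μ := latticeLaw _ _ _ π₀ n) hψ.aemeasurable
    have := Measure.isProbabilityMeasure_map (μ := tapeMeasure π₀) hout.aemeasurable
    -- Both laws have total mass one, so an upper bound on every measurable set already forces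
    -- equality.
    refine Measure.eq_of_le_of_isProbabilityMeasure (Measure.le_iff.2 fun B hB => ?_)
    rw [Measure.map_apply hout hB, Measure.map_apply hψ hB, bopmLaw,
      latticeLaw_apply hp _ _ _ _ (hψ hB), tapeMeasure, Measure.prod_apply_symm (hout hB)]
    refine (lintegral_mono fun z => (key z).2 B hB).trans (le_of_eq ?_)
    conv_rhs => rw [← Measure.infinitePi_map_eval (fun _ : ℕ => π₀) 0]
    rw [lintegral_map]
    · rfl
    · exact (measurable_binExp _ _ fun k => (measurable_one.indicator (hψ hB)).comp
        (measurable_id.const_mul _)).ennreal_ofReal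
    · exact measurable_pi_apply 0
  · rw [tapeMeasure]
    -- The inequality half of Tonelli's theorem needs no measurability of the cost.
    refine (lintegral_prod_swap _).symm.trans_le ?_
    refine (lintegral_prod_le _).trans ?_
    refine (lintegral_mono fun z => (key z).1).trans ?_
    simp

/-! ### Straight-line code and bounds in terms of registers -/

/-- Arithmetic instructions, which neither branch nor use random input or oracles. -/
def Instr.isArith : Instr → Bool
  | .jumpLE .. => false
  | .flip .. => false
  | .init .. => false
  | .query .. => false
  | _ => true

/-- The effect of an arithmetic instruction on the registers. -/
noncomputable def Instr.eval : Instr → (ℕ → ℝ) → ℕ → ℝ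
  | .const d q, R => Function.update R d q
  | .add d a b, R => Function.update R d (R a + R b)
  | .sub d a b, R => Function.update R d (R a - R b)
  | .mul d a b, R => Function.update R d (R a * R b)
  | .div d a b, R => Function.update R d (R a / R b)
  | .sqrt d a, R => Function.update R d √(R a)
  | .exp d a, R => Function.update R d (Real.exp (R a))
  | .log d a, R => Function.update R d (Real.log (R a))
  | _, R => R

/-- The effect of straight-line code on the registers. -/
noncomputable def evalList (l : List Instr) (R : ℕ → ℝ) : ℕ → ℝ := l.foldl (fun R i => i.eval R) R

theorem step_of_isArith {prog : List Instr} {pc : ℕ} {i : Instr} (h : prog[pc]? = some i)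
    (hi : i.isArith = true) (O : ℕ → ℝ → ℕ → ℝ) (τ : Tape) (R : ℕ → ℝ) (s : ℝ) (b q : ℕ) :
    step prog O τ ⟨pc, R, s, b, q⟩ = ⟨pc + 1, i.eval R, s, b, q⟩ := by
  simp only [step, h]
  cases i <;> first | rfl | simp [Instr.isArith] at hi

theorem take_drop_succ {prog : List Instr} {pc k : ℕ} (h : pc + (k + 1) ≤ prog.length) :
    ∃ i, prog[pc]? = some i ∧ (prog.drop pc).take (k + 1) = i :: (prog.drop (pc + 1)).take k := by
  have hpc : pc < prog.length := by omega
  exact ⟨prog[pc], List.getElem?_eq_getElem hpc, by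
    rw [List.drop_eq_getElem_cons hpc, List.take_succ_cons]⟩

/-- The block is specified as a slice of the program, so that for a concrete program this hypothesis
holds by evaluation. -/
theorem iterate_step_block {prog : List Instr} (l : List Instr) (pc : ℕ)
    (h : (prog.drop pc).take l.length = l) (hl : l.all Instr.isArith = true)
    (O : ℕ → ℝ → ℕ → ℝ) (τ : Tape) (R : ℕ → ℝ) (s : ℝ) (b q : ℕ) :
    (step prog O τ)^[l.length] ⟨pc, R, s, b, q⟩ = ⟨pc + l.length, evalList l R, s, b, q⟩ := by
  have key : ∀ (k pc : ℕ) (R : ℕ → ℝ), pc + k ≤ prog.length →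
      ((prog.drop pc).take k).all Instr.isArith = true →
      (step prog O τ)^[k] ⟨pc, R, s, b, q⟩ =
        ⟨pc + k, evalList ((prog.drop pc).take k) R, s, b, q⟩ := by
    intro k
    induction k with
    | zero => intros; rfl
    | succ k ih =>
      intro pc R h hk
      obtain ⟨i, hi, hl⟩ := take_drop_succ h
      rw [hl, List.all_cons, Bool.and_eq_true] at hk
      rw [Function.iterate_succ_apply, step_of_isArith hi hk.1, ih _ _ (by omega) hk.2, hl]
      simp only [evalList, List.foldl_cons, Config.mk.injEq, and_true]
      omega
  cases l with
  | nil => rfl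
  | cons i l =>
    have hlen : pc + (i :: l).length ≤ prog.length := by
      have := congrArg List.length h
      simp only [List.length_take, List.length_drop, List.length_cons] at this ⊢
      omega
    have := key (i :: l).length pc R hlen (by rwa [h])
    rwa [h] at this

/-- The inequalities that a subvalue satisfies, as a function of program counter and registers
only. The oracle answers `ans x y` to the query `(x, y)`. -/
structure RegSubvalue (prog : List Instr) (ans : ℝ → ℝ → ℝ) (κ : ℝ) (g : ℝ → ℝ)
    (U : ℕ → (ℕ → ℝ) → ℝ) : Prop where
  nonneg : 0 ≤ κ
  bounded : ∃ B, ∀ pc R, U pc R ≤ B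
  halted : ∀ {pc R}, prog.length ≤ pc → U pc R ≤ g (R 0)
  arith : ∀ {pc i} R, prog[pc]? = some i → i.isArith = true → U pc R ≤ κ + U (pc + 1) (i.eval R)
  jump_of_le : ∀ {pc a b t R}, prog[pc]? = some (.jumpLE a b t) → R a ≤ R b →
    U pc R ≤ κ + U t R
  jump_of_lt : ∀ {pc a b t R}, prog[pc]? = some (.jumpLE a b t) → R b < R a →
    U pc R ≤ κ + U (pc + 1) R
  flip : ∀ {pc d} R, prog[pc]? = some (.flip d) →
    U pc R ≤ κ + (U (pc + 1) (Function.update R d 1) + U (pc + 1) (Function.update R d 0)) / 2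
  query : ∀ {pc d n k} R, prog[pc]? = some (.query d n k) →
    U pc R ≤ κ + U (pc + 1) (Function.update R d (ans (R n) (R k)))

theorem lt_length_of_getElem?_eq_some {α : Type*} {l : List α} {i : ℕ} {a : α}
    (h : l[i]? = some a) : i < l.length := by
  by_contra hi
  rw [List.getElem?_eq_none (not_lt.1 hi)] at h
  cases h

/-- `U` is the supremum of `V` over the number of used bits. Every instruction other than `init`
preserves the current price and the price counter and shifts the bit counter uniformly, so the
one-step inequalities survive the supremum. -/
theorem IsSubvalue.exists_regSubvalue {prog : List Instr} {O : ℕ → ℝ → ℕ → ℝ} {z : ℕ → ℝ}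
    {κ : ℝ} {g : ℝ → ℝ} {V : Config → ℝ} (hV : IsSubvalue prog O z κ g V) (hκ : 0 ≤ κ)
    (s : ℝ) (q : ℕ) :
    ∃ U, RegSubvalue prog (fun x y => answer O x s y) κ g U ∧
      ∀ pc R b, V ⟨pc, R, s, b, q⟩ ≤ U pc R := by
  obtain ⟨B, hB⟩ := hV.bounded
  have hbdd : ∀ pc R, BddAbove (Set.range fun b => V ⟨pc, R, s, b, q⟩) := fun pc R =>
    ⟨B, by rintro _ ⟨b, rfl⟩; exact hB _⟩
  have hle : ∀ pc R b, V ⟨pc, R, s, b, q⟩ ≤ ⨆ b, V ⟨pc, R, s, b, q⟩ := fun pc R b =>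
    le_ciSup (hbdd pc R) b
  have hdet : ∀ {pc i} pc' R R', prog[pc]? = some i →
      (∀ τ b, exec O τ ⟨pc, R, s, b, q⟩ i = ⟨pc', R', s, b, q⟩) →
      ⨆ b, V ⟨pc, R, s, b, q⟩ ≤ κ + ⨆ b, V ⟨pc', R', s, b, q⟩ := by
    intro pc i pc' R R' hi he
    refine ciSup_le fun b => ?_
    have := hV.step ⟨pc, R, s, b, q⟩ (lt_length_of_getElem?_eq_some hi)
    simp only [bitStep, OptionPricing.step, hi, he, add_self_div_two] at this
    exact this.trans (add_le_add_right (hle _ _ b) κ)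
  refine ⟨fun pc R => ⨆ b, V ⟨pc, R, s, b, q⟩, ⟨hκ, ⟨B, fun pc R => ciSup_le fun b => hB _⟩,
    fun h => ciSup_le fun b => hV.halted _ h, fun {pc i} R hi ha => ?_,
    fun hi h => ?_, fun hi h => ?_, fun {pc d} R hi => ?_, fun R hi => ?_⟩, hle⟩
  · refine hdet (pc + 1) R (i.eval R) hi fun τ b => ?_
    have := step_of_isArith hi ha O τ R s b q
    simpa only [OptionPricing.step, hi] using this
  · exact hdet _ _ _ hi fun τ b => by simp [exec, h]
  · exact hdet _ _ _ hi fun τ b => by simp [exec, not_le.2 h]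
  · refine ciSup_le fun b => ?_
    have := hV.step ⟨pc, R, s, b, q⟩ (lt_length_of_getElem?_eq_some hi)
    simp only [bitStep, OptionPricing.step, hi, exec, Config.write, if_true] at this
    simp only [Bool.false_eq_true, if_false] at this
    refine this.trans (add_le_add_right ?_ κ)
    linarith [hle (pc + 1) (Function.update R d 1) (b + 1),
      hle (pc + 1) (Function.update R d 0) (b + 1)]
  · exact hdet _ _ _ hi fun τ b => rfl

namespace RegSubvalue

variable {prog : List Instr} {ans : ℝ → ℝ → ℝ} {κ : ℝ} {g : ℝ → ℝ} {U : ℕ → (ℕ → ℝ) → ℝ}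

theorem block (hU : RegSubvalue prog ans κ g U) (l : List Instr) (pc : ℕ) (R : ℕ → ℝ)
    (h : (prog.drop pc).take l.length = l) (hl : l.all Instr.isArith = true) :
    U pc R ≤ κ * l.length + U (pc + l.length) (evalList l R) := by
  have key : ∀ (k pc : ℕ) (R : ℕ → ℝ), pc + k ≤ prog.length →
      ((prog.drop pc).take k).all Instr.isArith = true →
      U pc R ≤ κ * k + U (pc + k) (evalList ((prog.drop pc).take k) R) := by
    intro k
    induction k with
    | zero => simp [evalList]
    | succ k ih =>
      intro pc R h hk
      obtain ⟨i, hi, hl⟩ := take_drop_succ h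
      rw [hl, List.all_cons, Bool.and_eq_true] at hk
      have h1 := hU.arith R hi hk.1
      have h2 := ih (pc + 1) (i.eval R) (by omega) hk.2
      rw [hl]
      rw [show pc + 1 + k = pc + (k + 1) by ring] at h2
      simp only [evalList, List.foldl_cons] at h2 ⊢
      push_cast
      linarith
  cases l with
  | nil => simp [evalList]
  | cons i l =>
    have hlen : pc + (i :: l).length ≤ prog.length := by
      have := congrArg List.length h
      simp only [List.length_take, List.length_drop, List.length_cons] at this ⊢
      omega
    have := key (i :: l).length pc R hlen (by rwa [h])
    rwa [h] at this

/-- The code at `base` tosses a coin with success probability the content of register `27`: it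
compares this number bit by bit with a random number. On success it continues at `acc`, otherwise
at `rej`. Registers `4` and `5` contain zero and one. -/
def coinCode (base acc rej : ℕ) : List Instr :=
  [.add 27 27 27, .flip 20, .sub 27 27 20, .jumpLE 27 4 rej, .jumpLE 5 27 acc, .jumpLE 4 4 base]

/-- The expected cost of tossing a coin is at most `12`. -/
theorem coin (hU : RegSubvalue prog ans κ g U) {base acc rej : ℕ}
    (hcode : (prog.drop base).take 6 = coinCode base acc rej) {R : ℕ → ℝ} {A B : ℝ}
    (h4 : R 4 = 0) (h5 : R 5 = 1) (hx : R 27 ∈ Set.Icc (0 : ℝ) 1)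
    (hA : ∀ R', (∀ i, i ≠ 20 → i ≠ 27 → R' i = R i) → U acc R' ≤ A)
    (hB : ∀ R', (∀ i, i ≠ 20 → i ≠ 27 → R' i = R i) → U rej R' ≤ B) :
    U base R ≤ κ * 12 + R 27 * A + (1 - R 27) * B := by
  obtain ⟨C, hC⟩ := hU.bounded
  have hκ := hU.nonneg
  have hc : ∀ i < 6, prog[base + i]? = (coinCode base acc rej)[i]? := fun i hi => by
    rw [← hcode, List.getElem?_take_of_lt hi, List.getElem?_drop]
  have c0 : prog[base]? = some (.add 27 27 27) := hc 0 (by norm_num)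
  have c1 : prog[base + 1]? = some (.flip 20) := hc 1 (by norm_num)
  have c2 : prog[base + 2]? = some (.sub 27 27 20) := hc 2 (by norm_num)
  have c3 : prog[base + 3]? = some (.jumpLE 27 4 rej) := hc 3 (by norm_num)
  have c4 : prog[base + 4]? = some (.jumpLE 5 27 acc) := hc 4 (by norm_num)
  have c5 : prog[base + 5]? = some (.jumpLE 4 4 base) := hc 5 (by norm_num)
  -- An a priori bound for the error of the claimed inequality. Each round leaves the coin undecided
  -- with probability at most one half, so the error halves; a round of at most `6` instructions
  -- gives the cost `6 + 3 + ⋯ = 12`.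
  set D : ℝ := |C| + |A| + |B| with hD
  have key : ∀ (k : ℕ) (R' : ℕ → ℝ), (∀ i, i ≠ 20 → i ≠ 27 → R' i = R i) →
      R' 27 ∈ Set.Icc (0 : ℝ) 1 →
      U base R' ≤ κ * 12 + R' 27 * A + (1 - R' 27) * B + D * (1 / 2) ^ k := by
    intro k
    induction k with
    | zero =>
      intro R' _ hx'
      have h1 : |R' 27 * A| ≤ |A| := by
        rw [abs_mul, abs_of_nonneg hx'.1]
        exact mul_le_of_le_one_left (abs_nonneg _) hx'.2
      have h2 : |(1 - R' 27) * B| ≤ |B| := by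
        rw [abs_mul, abs_of_nonneg (sub_nonneg.2 hx'.2)]
        exact mul_le_of_le_one_left (abs_nonneg _) (by linarith [hx'.1])
      have := hC base R'
      rw [pow_zero, mul_one]
      linarith [neg_abs_le (R' 27 * A), neg_abs_le ((1 - R' 27) * B), le_abs_self C]
    | succ k ih =>
      intro R' hR' hx'
      set x := R' 27 with hxdef
      have hDk : 0 ≤ D * (1 / 2) ^ k := by positivity
      set R1 := Function.update R' 27 (x + x) with hR1
      -- the effect of one bit
      have after : ∀ y : ℝ, ∃ R2 : ℕ → ℝ, (∀ i, i ≠ 20 → i ≠ 27 → R2 i = R i) ∧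
          R2 27 = 2 * x - y ∧
          U (base + 2) (Function.update R1 20 y) ≤ κ + U (base + 3) R2 := by
        intro y
        refine ⟨(Instr.sub 27 27 20).eval (Function.update R1 20 y), fun i h20 h27 => ?_, ?_,
          hU.arith _ c2 rfl⟩
        · simp [Instr.eval, hR1, h20, h27, hR' i h20 h27]
        · simp [Instr.eval, hR1, two_mul]
      have low : ∀ R2 : ℕ → ℝ, (∀ i, i ≠ 20 → i ≠ 27 → R2 i = R i) → R2 27 ≤ 0 →
          U (base + 3) R2 ≤ κ + B := fun R2 h2 h =>
        (hU.jump_of_le c3 (by rw [h2 4 (by norm_num) (by norm_num), h4]; exact h)).trans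
          (add_le_add_right (hB R2 h2) κ)
      have high : ∀ R2 : ℕ → ℝ, (∀ i, i ≠ 20 → i ≠ 27 → R2 i = R i) → 1 ≤ R2 27 →
          U (base + 3) R2 ≤ κ * 2 + A := fun R2 h2 h => by
        have e1 := hU.jump_of_lt c3 (R := R2)
          (by rw [h2 4 (by norm_num) (by norm_num), h4]; linarith)
        have e2 := hU.jump_of_le c4 (R := R2) (by rwa [h2 5 (by norm_num) (by norm_num), h5])
        linarith [hA R2 h2]
      have mid : ∀ R2 : ℕ → ℝ, (∀ i, i ≠ 20 → i ≠ 27 → R2 i = R i) → 0 < R2 27 → R2 27 < 1 →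
          U (base + 3) R2 ≤
            κ * 15 + R2 27 * A + (1 - R2 27) * B + D * (1 / 2) ^ k := fun R2 h2 h h' => by
        have e1 := hU.jump_of_lt c3 (R := R2)
          (by rwa [h2 4 (by norm_num) (by norm_num), h4])
        have e2 := hU.jump_of_lt c4 (R := R2) (by rwa [h2 5 (by norm_num) (by norm_num), h5])
        have e3 := hU.jump_of_le c5 (R := R2) le_rfl
        linarith [ih R2 h2 ⟨h.le, h'.le⟩]
      have s0 := hU.arith R' c0 rfl
      have s1 := hU.flip ((Instr.add 27 27 27).eval R') c1
      rw [show (Instr.add 27 27 27).eval R' = R1 from rfl] at s0 s1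
      obtain ⟨Ra, ha, ha27, sa⟩ := after 1
      obtain ⟨Rb, hb, hb27, sb⟩ := after 0
      rw [pow_succ]
      -- If `2 x ≤ 1`, the bit one decides for rejection and the bit zero leaves a coin of bias `2
      -- x`. If `2 x > 1`, the bit zero decides for acceptance and the bit one leaves bias `2 x -
      -- 1`. Residual biases zero and one are decided at once.
      rcases le_or_gt (2 * x) 1 with hx1 | hx1
      · have ea := low Ra ha (by rw [ha27]; linarith)
        rcases hx'.1.eq_or_lt with h0 | h0
        · have eb := low Rb hb (by rw [hb27, ← h0]; norm_num)
          rw [← h0]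
          linarith
        · rcases hx1.eq_or_lt with h1 | h1
          · have eb := high Rb hb (by rw [hb27, h1]; norm_num)
            rw [show x = 1 / 2 by linarith]
            linarith
          · have eb := mid Rb hb (by rw [hb27]; linarith) (by rw [hb27]; linarith)
            rw [hb27] at eb
            linarith
      · have eb := high Rb hb (by rw [hb27]; linarith)
        rcases hx'.2.eq_or_lt with h1 | h1
        · have ea := high Ra ha (by rw [ha27, h1]; norm_num)
          rw [h1]
          linarith
        · have ea := mid Ra ha (by rw [ha27]; linarith) (by rw [ha27]; linarith)
          rw [ha27] at ea
          linarith
  have hlim : Filter.Tendsto (fun k : ℕ => κ * 12 + R 27 * A + (1 - R 27) * B + D * (1 / 2) ^ k)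
      Filter.atTop (nhds (κ * 12 + R 27 * A + (1 - R 27) * B + D * 0)) :=
    ((tendsto_pow_atTop_nhds_zero_of_lt_one (by norm_num) (by norm_num)).const_mul D).const_add _
  rw [mul_zero, add_zero] at hlim
  exact ge_of_tendsto' hlim fun k => key k R (fun _ _ _ => rfl) hx

end RegSubvalue

/-! ### Ratios of binomial weights -/

/-- The product of `(a - j) θ / (d + 1 + j)` over `j < i`. -/
noncomputable def ratio (a d : ℕ) (θ : ℝ) (i : ℕ) : ℝ :=
  ∏ j ∈ Finset.range i, ((a - j) * θ / (d + 1 + j))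

theorem ratio_zero (a d : ℕ) (θ : ℝ) : ratio a d θ 0 = 1 := Finset.prod_range_zero _

theorem ratio_succ (a d : ℕ) (θ : ℝ) (i : ℕ) :
    ratio a d θ (i + 1) = ratio a d θ i * ((a - i) * θ / (d + 1 + i)) :=
  Finset.prod_range_succ _ _

theorem ratio_pos {a : ℕ} (d : ℕ) {θ : ℝ} (hθ : 0 < θ) {i : ℕ} (hi : i ≤ a) :
    0 < ratio a d θ i := by
  refine Finset.prod_pos fun j hj => ?_
  have : (j : ℝ) < a := by exact_mod_cast (Finset.mem_range.1 hj).trans_le hi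
  have : 0 < (a : ℝ) - j := sub_pos.2 this
  positivity

theorem ratio_eq_zero {a : ℕ} (d : ℕ) (θ : ℝ) {i : ℕ} (hi : a < i) : ratio a d θ i = 0 :=
  Finset.prod_eq_zero (Finset.mem_range.2 hi) (by simp)

/-- The data of one side of the mode of a binomial distribution: there are `a` values beyond the
mode and `d` before it, and the weights decrease. -/
structure Side (n a d : ℕ) (θ : ℝ) : Prop where
  add : a + d = n
  pos : 0 < θ
  decreasing : a * θ ≤ d + 1
  le_left : n ≤ 4 * a + 3
  le_right : n ≤ 4 * d + 3

/-- By `h.decreasing` the factor with index `j` is at most `1 - j / a`, hence at most `exp (-j /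
n)`; the exponents sum to `i (i - 1) / (2 n)`. -/
theorem Side.ratio_le_exp {n a d : ℕ} {θ : ℝ} (h : Side n a d θ) {i : ℕ} (hi : i ≤ a) :
    ratio a d θ i ≤ Real.exp (-(i * (i - 1) / (2 * n))) := by
  induction i with
  | zero => simp [ratio_zero]
  | succ i ih =>
    have hia : (i : ℝ) + 1 ≤ a := by exact_mod_cast hi
    have ha : (0 : ℝ) < a := by have : (0 : ℝ) ≤ i := Nat.cast_nonneg i; linarith
    have hn : (a : ℝ) ≤ n := by exact_mod_cast (Nat.le_add_right a d).trans h.add.le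
    have hfac : (a - i) * θ / (d + 1 + i) ≤ Real.exp (-(i / n)) := by
      calc (a - i) * θ / (d + 1 + i) ≤ 1 - i / a := by
            rw [div_le_iff₀ (by positivity)]
            have h1 : ((a : ℝ) - i) * θ = (1 - i / a) * (a * θ) := by field_simp
            rw [h1]
            refine mul_le_mul_of_nonneg_left (h.decreasing.trans (by simp)) ?_
            rw [sub_nonneg, div_le_one ha]
            linarith
        _ ≤ 1 - i / n := by
            have : (i : ℝ) / n ≤ i / a := div_le_div_of_nonneg_left (by positivity) ha hn
            linarith
        _ ≤ _ := by
            have := Real.add_one_le_exp (-((i : ℝ) / n))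
            linarith
    rw [ratio_succ]
    calc _ ≤ Real.exp (-(i * (i - 1) / (2 * n))) * Real.exp (-(i / n)) := by
          refine mul_le_mul (ih (by omega)) hfac ?_ (Real.exp_pos _).le
          have := h.pos
          have : (0 : ℝ) ≤ a - i := by linarith
          positivity
      _ = _ := by
          rw [← Real.exp_add]
          congr 1
          push_cast
          field_simp
          ring

/-- Makes `2 ^ b * ratio a d θ i` a legitimate acceptance probability. At distance `i ≥ b M` with `M
^ 2 ≥ 16 n`, the exponent `i (i - 1) / (2 n)` is at least `b`, and `2 ^ b ≤ exp b`. -/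
theorem Side.two_pow_mul_ratio_le_one {n a d : ℕ} {θ : ℝ} (h : Side n a d θ) (hn : 0 < n)
    {M b i : ℕ} (hM : 16 * n ≤ M * M) (hb : b * M ≤ i) (hi : i ≤ a) :
    2 ^ b * ratio a d θ i ≤ 1 := by
  have h2 : (2 : ℝ) ^ b ≤ Real.exp b := by
    rw [← Real.exp_one_pow]
    exact pow_le_pow_left₀ (by norm_num) (by linarith [Real.exp_one_gt_d9]) b
  have hexp : (b : ℝ) ≤ i * (i - 1) / (2 * n) := by
    rcases Nat.eq_zero_or_pos b with rfl | hb0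
    · rcases Nat.eq_zero_or_pos i with rfl | hi0
      · simp
      · have : (1 : ℝ) ≤ i := by exact_mod_cast hi0
        have : (0 : ℝ) ≤ i - 1 := by linarith
        simp only [Nat.cast_zero]
        positivity
    · have hM4 : 4 ≤ M := by nlinarith
      have hMi : M ≤ i := (Nat.le_mul_of_pos_left M hb0).trans hb
      rw [le_div_iff₀ (by positivity)]
      have e1 : (b : ℝ) * M ≤ i := by exact_mod_cast hb
      have e2 : (M : ℝ) ≤ i := by exact_mod_cast hMi
      have e3 : (4 : ℝ) ≤ M := by exact_mod_cast hM4
      have e4 : (16 : ℝ) * n ≤ M * M := by exact_mod_cast hM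
      have e5 : (0 : ℝ) ≤ b := Nat.cast_nonneg b
      calc (b : ℝ) * (2 * n) ≤ b * (M * (M - 1)) := by
            refine mul_le_mul_of_nonneg_left ?_ e5
            nlinarith
        _ = (b * M) * (M - 1) := by ring
        _ ≤ i * (i - 1) := mul_le_mul e1 (by linarith) (by linarith) (by linarith)
  calc 2 ^ b * ratio a d θ i ≤ Real.exp b * Real.exp (-(i * (i - 1) / (2 * n))) :=
        mul_le_mul h2 (h.ratio_le_exp hi) (ratio_pos d h.pos hi).le (Real.exp_pos _).le
    _ ≤ 1 := by
        rw [← Real.exp_add, Real.exp_le_one_iff]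
        linarith

/-- A lower bound for the logarithm of `ratio a d θ i`, from integrals of the logarithm. -/
noncomputable def logLower (a d : ℕ) (θ : ℝ) (i : ℕ) : ℝ :=
  Real.log a * a - Real.log (a - i) * (a - i) + Real.log (d + 1) * (d + 1) -
    Real.log (d + 1 + i) * (d + 1 + i) + Real.log θ * i

/-- Compares `log x` with the integral of the logarithm over `[x - 1, x]`; the linear part of the
antiderivative `t log t - t` accounts for the extra `1`. At `x = 1` the undefined term is `log 0 * 0
= 0`. -/
theorem mul_log_sub_le {x : ℝ} (hx : 1 ≤ x) :
    Real.log x * x - Real.log (x - 1) * (x - 1) ≤ 1 + Real.log x ∧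
      1 + Real.log x - 1 / x ≤ Real.log x * x - Real.log (x - 1) * (x - 1) := by
  rcases hx.eq_or_lt with rfl | hx
  · simp
  have h0 : 0 < x := by linarith
  have h1 : 0 < x - 1 := by linarith
  have e1 := Real.log_le_sub_one_of_pos (div_pos h0 h1)
  have e2 := Real.one_sub_inv_le_log_of_pos (div_pos h0 h1)
  rw [Real.log_div h0.ne' h1.ne'] at e1 e2
  have e3 : (x - 1) * (x / (x - 1) - 1) = 1 := by field_simp; ring
  have e4 : (x - 1) * (1 - (x / (x - 1))⁻¹) = 1 - 1 / x := by field_simp; ring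
  constructor <;> nlinarith [mul_le_mul_of_nonneg_left e1 h1.le, mul_le_mul_of_nonneg_left e2 h1.le]

theorem mul_log_add_le {y : ℝ} (hy : 1 ≤ y) :
    1 + Real.log y ≤ Real.log (y + 1) * (y + 1) - Real.log y * y ∧
      Real.log (y + 1) * (y + 1) - Real.log y * y ≤ 1 + Real.log y + 1 / y := by
  have h0 : 0 < y := by linarith
  have h1 : 0 < y + 1 := by linarith
  have e1 := Real.log_le_sub_one_of_pos (div_pos h1 h0)
  have e2 := Real.one_sub_inv_le_log_of_pos (div_pos h1 h0)
  rw [Real.log_div h1.ne' h0.ne'] at e1 e2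
  have e3 : (y + 1) * ((y + 1) / y - 1) = 1 + 1 / y := by field_simp; ring
  have e4 : (y + 1) * (1 - ((y + 1) / y)⁻¹) = 1 := by field_simp; ring
  constructor <;> nlinarith [mul_le_mul_of_nonneg_left e1 h1.le, mul_le_mul_of_nonneg_left e2 h1.le]

/-- The logarithm is increasing, so sums of `log (a - j)` and `log (d + 1 + j)` lie on opposite
sides of their integrals, and both errors point the same way. The linear parts of the two
antiderivatives are `i` each and cancel in `logLower`. -/
theorem logLower_le_log_ratio {a : ℕ} (d : ℕ) {θ : ℝ} (hθ : 0 < θ) {i : ℕ} (hi : i ≤ a) :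
    logLower a d θ i ≤ Real.log (ratio a d θ i) ∧
      Real.log (ratio a d θ i) ≤ logLower a d θ i +
        ∑ j ∈ Finset.range i, (1 / ((a : ℝ) - j) + 1 / ((d : ℝ) + 1 + j)) := by
  induction i with
  | zero => simp [ratio_zero, logLower]
  | succ i ih =>
    have hia : (i : ℝ) + 1 ≤ a := by exact_mod_cast hi
    have hx : (1 : ℝ) ≤ a - i := by linarith
    have hy : (1 : ℝ) ≤ d + 1 + i := by
      have h1 : (0 : ℝ) ≤ d := Nat.cast_nonneg d
      have h2 : (0 : ℝ) ≤ i := Nat.cast_nonneg i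
      linarith
    have hlog : Real.log (ratio a d θ (i + 1)) = Real.log (ratio a d θ i) +
        (Real.log (a - i) + Real.log θ - Real.log (d + 1 + i)) := by
      have hx' : (a : ℝ) - i ≠ 0 := by linarith
      have hy' : (d : ℝ) + 1 + i ≠ 0 := by linarith
      rw [ratio_succ, Real.log_mul (ratio_pos d hθ (by omega)).ne'
        (div_ne_zero (mul_ne_zero hx' hθ.ne') hy'),
        Real.log_div (mul_ne_zero hx' hθ.ne') hy', Real.log_mul hx' hθ.ne']
    obtain ⟨h1, h2⟩ := ih (by omega)
    obtain ⟨h3, h4⟩ := mul_log_sub_le hx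
    obtain ⟨h5, h6⟩ := mul_log_add_le hy
    rw [hlog, Finset.sum_range_succ]
    unfold logLower at h1 h2 ⊢
    push_cast
    rw [show (a : ℝ) - (i + 1) = a - i - 1 by ring,
      show (d : ℝ) + 1 + (i + 1) = d + 1 + i + 1 by ring]
    constructor <;> linarith

/-- The error of the lower bound, scaled so that the target is a probability. -/
theorem Side.error_le {n a d : ℕ} {θ : ℝ} (h : Side n a d θ) (hn : 0 < n) {w : ℝ} (hw : 0 < w)
    {i : ℕ} (hi : i ≤ a) (h1 : w * ratio a d θ i ≤ 1) :
    Real.exp (logLower a d θ i) * w ≤ w * ratio a d θ i ∧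
      w * ratio a d θ i - Real.exp (logLower a d θ i) * w ≤ 32 * i / n := by
  obtain ⟨hl, hu⟩ := logLower_le_log_ratio d h.pos hi
  have hr := ratio_pos d h.pos hi
  have hlow : Real.exp (logLower a d θ i) ≤ ratio a d θ i := by
    rwa [Real.le_log_iff_exp_le hr] at hl
  refine ⟨by rw [mul_comm]; exact mul_le_mul_of_nonneg_left hlow hw.le, ?_⟩
  have hn' : (0 : ℝ) < n := by exact_mod_cast hn
  rcases Nat.eq_zero_or_pos i with rfl | hi0
  · simp [ratio_zero, logLower]
  -- For `n ≤ 32 i` the bound exceeds one and is trivial. Otherwise `a` and `d` are at least `n / 8`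
  -- and `i < n / 32`, so all denominators are at least `n / 16`.
  rcases le_or_gt n (32 * i) with hbig | hsmall
  · have : (1 : ℝ) ≤ 32 * i / n := by
      rw [le_div_iff₀ hn']
      exact_mod_cast (by omega : 1 * n ≤ 32 * i)
    have := mul_pos (Real.exp_pos (logLower a d θ i)) hw
    linarith
  have ha : n ≤ 8 * a := by have := h.le_left; omega
  have hd : n ≤ 8 * d := by have := h.le_right; omega
  have ha' : (n : ℝ) ≤ 8 * a := by exact_mod_cast ha
  have hd' : (n : ℝ) ≤ 8 * d := by exact_mod_cast hd
  have hs' : (32 : ℝ) * i < n := by exact_mod_cast hsmall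
  have hsum : ∑ j ∈ Finset.range i, (1 / ((a : ℝ) - j) + 1 / ((d : ℝ) + 1 + j)) ≤ 32 * i / n := by
    refine (Finset.sum_le_card_nsmul _ _ (32 / (n : ℝ)) fun j hj => ?_).trans
      (le_of_eq (by simp; ring))
    have hj' : (j : ℝ) ≤ i := by exact_mod_cast (Finset.mem_range.1 hj).le
    have hj0 : (0 : ℝ) ≤ j := Nat.cast_nonneg j
    have e1 : 1 / ((a : ℝ) - j) ≤ 16 / n := by
      rw [div_le_div_iff₀ (by linarith) hn']
      linarith
    have e2 : 1 / ((d : ℝ) + 1 + j) ≤ 16 / n := by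
      rw [div_le_div_iff₀ (by linarith) hn']
      linarith
    calc _ ≤ (16 : ℝ) / n + 16 / n := add_le_add e1 e2
      _ = _ := by ring
  have hexp : Real.exp (logLower a d θ i) =
      ratio a d θ i * Real.exp (logLower a d θ i - Real.log (ratio a d θ i)) := by
    rw [Real.exp_sub, Real.exp_log hr]
    field_simp
  have hone := Real.add_one_le_exp (logLower a d θ i - Real.log (ratio a d θ i))
  have hgap : 0 ≤ Real.log (ratio a d θ i) - logLower a d θ i := by linarith
  have hwr : 0 ≤ w * ratio a d θ i := by positivity
  -- With `F` the target and `t` the gap of the logarithms, the error is `F (1 - exp (-t)) ≤ F t ≤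
  -- t`.
  calc w * ratio a d θ i - Real.exp (logLower a d θ i) * w
      = w * ratio a d θ i *
          (1 - Real.exp (logLower a d θ i - Real.log (ratio a d θ i))) := by
        conv_lhs => rw [hexp]
        ring
    _ ≤ w * ratio a d θ i * (Real.log (ratio a d θ i) - logLower a d θ i) :=
        mul_le_mul_of_nonneg_left (by linarith) hwr
    _ ≤ 1 * (Real.log (ratio a d θ i) - logLower a d θ i) :=
        mul_le_mul_of_nonneg_right h1 hgap
    _ ≤ 32 * i / n := by linarith

/-! ### The mode of a binomial distribution -/

/-- Consecutive weights have quotient `(n - k) p / ((k + 1) (1 - p))`, which is a factor of `ratio`.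
The side below `m` follows by exchanging successes and failures. -/
theorem binWeight_add {p : ℝ} (hp1 : p < 1) {n m i : ℕ} (hi : m + i ≤ n) :
    binWeight p n (m + i) = binWeight p n m * ratio (n - m) m (p / (1 - p)) i := by
  induction i with
  | zero => simp [ratio_zero]
  | succ i ih =>
    have hq : 1 - p ≠ 0 := by linarith
    rw [ratio_succ, ← mul_assoc, ← ih (by omega)]
    unfold binWeight
    have hc : (n.choose (m + i + 1) : ℝ) * (m + i + 1) = n.choose (m + i) * (n - m - i) := by
      have := Nat.choose_succ_right_eq n (m + i)
      have h2 : ((n - (m + i) : ℕ) : ℝ) = n - m - i := by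
        rw [Nat.cast_sub (by omega)]; push_cast; ring
      rw [← h2]
      exact_mod_cast this
    have hs : n - (m + i) = n - (m + (i + 1)) + 1 := by omega
    have hm : ((n - m : ℕ) : ℝ) = n - m := Nat.cast_sub (by omega)
    have hne : (m : ℝ) + 1 + i ≠ 0 := by positivity
    rw [hs, hm, pow_succ (1 - p), ← add_assoc m i 1, pow_succ p]
    field_simp
    linear_combination (p ^ (m + i) * p) * hc

theorem binWeight_symm (p : ℝ) {n k : ℕ} (hk : k ≤ n) :
    binWeight p n k = binWeight (1 - p) n (n - k) := by
  unfold binWeight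
  rw [Nat.choose_symm hk, Nat.sub_sub_self hk]
  ring

theorem binWeight_sub {p : ℝ} (hp0 : 0 < p) {n m i : ℕ} (hm : m ≤ n) (hi : i ≤ m) :
    binWeight p n (m - i) = binWeight p n m * ratio m (n - m) ((1 - p) / p) i := by
  rw [binWeight_symm p (by omega : m - i ≤ n), binWeight_symm p hm,
    show n - (m - i) = n - m + i by omega,
    binWeight_add (by linarith) (by omega : n - m + i ≤ n), Nat.sub_sub_self hm, sub_sub_cancel]

theorem binWeight_pos {p : ℝ} (hp0 : 0 < p) (hp1 : p < 1) {n k : ℕ} (hk : k ≤ n) :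
    0 < binWeight p n k := by
  have : (0 : ℝ) < n.choose k := by exact_mod_cast Nat.choose_pos hk
  have : 0 < 1 - p := by linarith
  unfold binWeight
  positivity

theorem sum_binWeight (p : ℝ) (n : ℕ) : ∑ k ∈ Finset.range (n + 1), binWeight p n k = 1 := by
  have := add_pow p (1 - p) n
  rw [add_sub_cancel, one_pow] at this
  rw [this]
  refine Finset.sum_congr rfl fun k _ => ?_
  unfold binWeight
  ring

/-- `m` is a mode of the binomial distribution with parameters `n` and `p`. -/
structure IsMode (p : ℝ) (n m : ℕ) : Prop where
  le_prob : 1 / 4 ≤ p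
  prob_le : p ≤ 3 / 4
  le : (m : ℝ) ≤ (n + 1) * p
  lt : (n + 1) * p < m + 1

theorem IsMode.le_n {p : ℝ} {n m : ℕ} (h : IsMode p n m) : m ≤ n := by
  have h1 := h.le
  have h2 := h.prob_le
  have : (m : ℝ) < n + 1 := by
    have : (0 : ℝ) < n + 1 := by positivity
    nlinarith
  exact Nat.lt_succ_iff.1 (by exact_mod_cast this)

/-- The first quotient beyond `m` is at most one exactly when `(n + 1) p ≤ m + 1`. The bounds on `p`
keep both sides at about a quarter of `n` or more; the `3` absorbs rounding. -/
theorem IsMode.right {p : ℝ} {n m : ℕ} (h : IsMode p n m) :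
    Side n (n - m) m (p / (1 - p)) := by
  have hm := h.le_n
  have h1 := h.le
  have h2 := h.lt
  have h3 := h.le_prob
  have h4 := h.prob_le
  have hn : (0 : ℝ) ≤ n := Nat.cast_nonneg n
  refine ⟨by omega, div_pos (by linarith) (by linarith), ?_, ?_, ?_⟩
  · rw [Nat.cast_sub hm, ← mul_div_assoc, div_le_iff₀ (by linarith)]
    linarith
  · have : (n : ℝ) ≤ 4 * (n - m) + 3 := by nlinarith
    rw [← Nat.cast_sub hm] at this
    exact_mod_cast this
  · have : (n : ℝ) ≤ 4 * m + 3 := by nlinarith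
    exact_mod_cast this

theorem IsMode.left {p : ℝ} {n m : ℕ} (h : IsMode p n m) :
    Side n m (n - m) ((1 - p) / p) := by
  have hm := h.le_n
  have h1 := h.le
  have h3 := h.le_prob
  have h4 := h.prob_le
  have hr := h.right
  refine ⟨by omega, div_pos (by linarith) (by linarith), ?_, hr.le_right, hr.le_left⟩
  rw [Nat.cast_sub hm, ← mul_div_assoc, div_le_iff₀ (by linarith)]
  linarith

/-- Near the mode the weights are flat: the quotient with index `j` falls short of one by at most `6
(j + 1) / n`, and up to distance `√n / 4` these defects add up to at most `3 i (i + 1) / n ≤ 1 / 2`.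
-/
theorem IsMode.half_le_ratio {p : ℝ} {n m i : ℕ} (h : IsMode p n m) (hn : 0 < n)
    (hi : 16 * (i * i) ≤ n) : 1 / 2 ≤ ratio (n - m) m (p / (1 - p)) i := by
  have hn' : (0 : ℝ) < n := by exact_mod_cast hn
  have key : ∀ i : ℕ, 16 * (i * i) ≤ n →
      1 - 3 * (i * (i + 1)) / n ≤ ratio (n - m) m (p / (1 - p)) i ∧
        ratio (n - m) m (p / (1 - p)) i ≤ 1 := by
    intro i
    induction i with
    | zero => intro _; simp [ratio_zero]
    | succ i ih =>
      intro hi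
      obtain ⟨h1, h2⟩ := ih (by nlinarith)
      have hm := h.le_n
      have e1 := h.le
      have e2 := h.lt
      have e3 := h.le_prob
      have e4 := h.prob_le
      have e5 : (0 : ℝ) ≤ i := Nat.cast_nonneg i
      have e6 : (0 : ℝ) ≤ m := Nat.cast_nonneg m
      have hq : 0 < 1 - p := by linarith
      have hden : (0 : ℝ) < m + 1 + i := by positivity
      set x : ℝ := ((n - m : ℕ) - i) * (p / (1 - p)) / (m + 1 + i) with hx
      have hx1 : 1 - x = (m + 1 + i - p * (n + 1)) / ((m + 1 + i) * (1 - p)) := by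
        rw [hx, Nat.cast_sub hm]
        field_simp
        ring
      have hx2 : 1 - x ≤ 6 * (i + 1) / n := by
        rw [hx1, div_le_div_iff₀ (by positivity) hn']
        have a1 : (n : ℝ) ≤ 6 * ((m + 1 + i) * (1 - p)) := by
          have hpq : 3 / 16 ≤ p * (1 - p) := by nlinarith
          have : 3 * ((n : ℝ) + 1) ≤ 16 * (((n + 1) * p) * (1 - p)) := by nlinarith
          have : ((n + 1) * p) * (1 - p) ≤ (m + 1 + i) * (1 - p) :=
            mul_le_mul_of_nonneg_right (by linarith) hq.le
          linarith
        have a2 : (m : ℝ) + 1 + i - p * (n + 1) ≤ i + 1 := by linarith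
        calc (m + 1 + i - p * (n + 1)) * (n : ℝ) ≤ (i + 1) * n :=
              mul_le_mul_of_nonneg_right a2 hn'.le
          _ ≤ (i + 1) * (6 * ((m + 1 + i) * (1 - p))) :=
              mul_le_mul_of_nonneg_left a1 (by positivity)
          _ = _ := by ring
      have hx3 : x ≤ 1 := by
        have : 0 ≤ 1 - x := by
          rw [hx1]
          have : (0 : ℝ) ≤ m + 1 + i - p * (n + 1) := by linarith
          positivity
        linarith
      have hx0 : 0 ≤ x := by
        have : (6 : ℝ) * (i + 1) / n ≤ 1 := by
          rw [div_le_one hn']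
          exact_mod_cast (by nlinarith : 6 * (i + 1) ≤ n)
        linarith
      have hr0 : 0 ≤ ratio (n - m) m (p / (1 - p)) i := by
        have : (3 : ℝ) * (i * (i + 1)) / n ≤ 1 := by
          rw [div_le_one hn']
          exact_mod_cast (by nlinarith : 3 * (i * (i + 1)) ≤ n)
        linarith
      rw [ratio_succ, ← hx]
      refine ⟨?_, mul_le_one₀ h2 hx0 hx3⟩
      have hsplit : (3 : ℝ) * ((i + 1 : ℕ) * ((i + 1 : ℕ) + 1)) / n =
          3 * (i * (i + 1)) / n + 6 * (i + 1) / n := by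
        push_cast
        field_simp
        ring
      rw [hsplit]
      nlinarith
  refine le_trans ?_ (key i hi).1
  have : (3 : ℝ) * (i * (i + 1)) / n ≤ 1 / 2 := by
    rw [div_le_iff₀ hn']
    have hii : i ≤ i * i := Nat.le_mul_self i
    have : (6 : ℝ) * (i * (i + 1)) ≤ n := by
      exact_mod_cast (by nlinarith : 6 * (i * (i + 1)) ≤ n)
    linarith
  linarith

/-- The maximal binomial weight is of order `n ^ (-1 / 2)`. -/
theorem IsMode.mul_binWeight_le {p : ℝ} {n m M : ℕ} (h : IsMode p n m) (hn : 0 < n)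
    (hM : M * M ≤ 64 * n) : M * binWeight p n m ≤ 64 := by
  -- The `I` weights from the mode upwards are at least half the maximal one and sum to at most one,
  -- so the maximum is at most `2 / I ≤ 64 / M`. Distances `i < I` satisfy `32 i ≤ M ≤ 8 √n`.
  set I := M / 32 + 1 with hI
  have hMI : M ≤ 32 * I := by omega
  have hsmall : ∀ i ∈ Finset.range I, 16 * (i * i) ≤ n := by
    intro i hi
    have : 32 * i ≤ M := by have := Finset.mem_range.1 hi; omega
    nlinarith
  have hp0 : 0 < p := by linarith [h.le_prob]
  have hp1 : p < 1 := by linarith [h.prob_le]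
  have hpos := binWeight_pos hp0 hp1 h.le_n
  have hmem : ∀ i ∈ Finset.range I, m + i ≤ n := by
    intro i hi
    -- Beyond `n` the product `ratio` would contain the factor zero, against the lower bound `1 /
    -- 2`.
    by_contra hc
    have h1 := h.half_le_ratio hn (hsmall i hi)
    rw [ratio_eq_zero m _ (by have := h.le_n; omega)] at h1
    norm_num at h1
  have hsum : I * (binWeight p n m * (1 / 2)) ≤ 1 := by
    calc (I : ℝ) * (binWeight p n m * (1 / 2))
        = ∑ i ∈ Finset.range I, binWeight p n m * (1 / 2) := by simp
      _ ≤ ∑ i ∈ Finset.range I, binWeight p n (m + i) := by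
          refine Finset.sum_le_sum fun i hi => ?_
          rw [binWeight_add hp1 (hmem i hi)]
          exact mul_le_mul_of_nonneg_left (h.half_le_ratio hn (hsmall i hi)) hpos.le
      _ = ∑ k ∈ (Finset.range I).map (addLeftEmbedding m), binWeight p n k := by simp
      _ ≤ ∑ k ∈ Finset.range (n + 1), binWeight p n k := by
          refine Finset.sum_le_sum_of_subset_of_nonneg (fun k hk => ?_) fun k hk _ =>
            (binWeight_pos hp0 hp1 (Nat.lt_succ_iff.1 (Finset.mem_range.1 hk))).le
          obtain ⟨i, hi, rfl⟩ := Finset.mem_map.1 hk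
          exact Finset.mem_range.2 (Nat.lt_succ_of_le (hmem i hi))
      _ = 1 := sum_binWeight p n
  have : (M : ℝ) ≤ 32 * I := by exact_mod_cast hMI
  nlinarith

/-! ### The sampler -/

/-- Eleven instructions that compute the probability of an up-move in register `7`. -/
def probCode : Lattice → List Instr
  | .CRR => [.div 8 2 3, .sqrt 9 8, .mul 9 1 9, .exp 10 9, .sub 11 4 9, .exp 11 11, .mul 8 0 8,
      .exp 8 8, .sub 8 8 11, .sub 10 10 11, .div 7 8 10]
  | .JR => List.replicate 11 (.const 7 (1 / 2))

/-- The preparation of the sampler (`14`): it branches to `133` if the probability of an up-move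
is not in `[1/4, 3/4]`, and otherwise computes the mode `m` of the binomial distribution (`25`,
`29`) and a power of two `M` of order `√n` (`40`). -/
def modeCode : List Instr :=
  [.const 6 (1 / 4), .const 8 (3 / 4), .jumpLE 6 7 18, .jumpLE 4 4 133, .jumpLE 7 8 20,
    .jumpLE 4 4 133, .add 9 3 5, .mul 9 9 7, .add 10 5 4, .const 11 0, .const 12 (1 / 2),
    .jumpLE 10 9 27, .jumpLE 4 4 29, .add 10 10 10, .jumpLE 4 4 25,
    .jumpLE 10 5 36, .mul 10 10 12, .add 13 11 10, .jumpLE 13 9 34, .jumpLE 4 4 29, .add 11 13 4,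
    .jumpLE 4 4 29, .const 36 32, .const 6 16, .mul 15 6 3, .add 14 5 4,
    .mul 13 14 14, .jumpLE 15 13 44, .add 14 14 14, .jumpLE 4 4 40]

/-- A trial (`44`) selects a side of the mode, a geometric number `b` (`56`) and a number `o < M`
(`65`), and checks whether the distance `i = b M + o` from the mode is allowed (`71`). -/
def proposalCode : List Instr :=
  [.flip 16, .sub 17 3 11, .add 18 11 4, .sub 20 5 7, .div 19 7 20, .jumpLE 16 4 54, .add 18 17 4,
    .add 17 11 4, .sub 20 5 7, .div 19 20 7, .add 21 5 4, .const 22 0,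
    .jumpLE 22 3 58, .jumpLE 4 4 44, .flip 20, .jumpLE 20 4 63, .add 21 21 21, .add 22 22 14,
    .jumpLE 4 4 56, .add 23 5 4, .const 24 0,
    .jumpLE 14 23 71, .add 23 23 23, .add 24 24 24, .flip 20, .add 24 24 20, .jumpLE 4 4 65,
    .add 22 22 24, .jumpLE 22 17 74, .jumpLE 4 4 44, .jumpLE 16 4 76, .jumpLE 22 4 44]

/-- The approximation (`76`) of the acceptance probability. -/
def boundCode : List Instr :=
  [.log 25 17, .mul 25 25 17, .sub 32 17 22, .log 33 32, .mul 33 33 32, .sub 25 25 33,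
    .add 32 18 5, .log 33 32, .mul 33 33 32, .add 25 25 33, .add 32 32 22, .log 33 32,
    .mul 33 33 32, .sub 25 25 33, .log 33 19, .mul 33 33 22, .add 25 25 33, .exp 25 25,
    .mul 25 25 21, .mul 26 36 22, .div 26 26 3, .sub 32 5 25]

/-- The bound for the error of the approximation. -/
def errorCode : List Instr := [.jumpLE 26 32 100, .add 26 32 4, .add 27 26 4]

/-- The two ways of finishing the acceptance test, one of which (`110`) computes the acceptance
probability exactly. -/
def exactCode : List Instr :=
  [.sub 32 5 26, .div 27 25 32, .jumpLE 4 4 123, .add 28 21 4, .const 29 0, .jumpLE 22 29 121,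
    .sub 32 17 29, .mul 32 32 19, .mul 28 28 32, .add 32 18 29, .add 32 32 5, .div 28 28 32,
    .add 29 29 5, .jumpLE 4 4 112, .sub 28 28 25, .div 27 28 26]

/-- The end of the rejection method (`129`), and the beginning of the method that tosses a coin
for each step (`133`). -/
def acceptCode : List Instr :=
  [.add 31 18 22, .jumpLE 16 4 146, .sub 31 3 31, .jumpLE 4 4 146, .const 31 0, .add 29 3 4,
    .jumpLE 29 4 146, .sub 29 29 5, .add 27 7 4]

/-- A program that draws an initial price and a binomial number of up-moves and queries the
payoff. It samples by rejection: the value at distance `i = b M + o` from the mode is accepted with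
probability `2 ^ b * ratio a d θ i`, which is only computed exactly if a cheap approximation does
not decide. -/
def sampler (L : Lattice) : List Instr :=
  [Instr.init 30, Instr.const 4 0, Instr.const 5 1] ++ probCode L ++ modeCode ++ proposalCode ++
    boundCode ++ errorCode ++ RegSubvalue.coinCode 101 110 107 ++ exactCode ++
    RegSubvalue.coinCode 123 129 44 ++ acceptCode ++ RegSubvalue.coinCode 138 144 135 ++
    [Instr.add 31 31 5, Instr.jumpLE 4 4 135, Instr.query 0 3 31]

/-- The registers during a trial. -/
structure TrialRegs (n m M a d : ℕ) (p θ : ℝ) (left : Bool) (R : ℕ → ℝ) : Prop where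
  r3 : R 3 = n
  r4 : R 4 = 0
  r5 : R 5 = 1
  r7 : R 7 = p
  r11 : R 11 = m
  r14 : R 14 = M
  r16 : R 16 = if left then 1 else 0
  r17 : R 17 = a
  r18 : R 18 = d
  r19 : R 19 = θ
  r36 : R 36 = 32

theorem TrialRegs.congr {n m M a d : ℕ} {p θ : ℝ} {left : Bool} {R R' : ℕ → ℝ}
    (h : TrialRegs n m M a d p θ left R)
    (h' : ∀ i ∈ [3, 4, 5, 7, 11, 14, 16, 17, 18, 19, 36], R' i = R i) :
    TrialRegs n m M a d p θ left R' := by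
  constructor <;> rw [h' _ (by simp)]
  exacts [h.r3, h.r4, h.r5, h.r7, h.r11, h.r14, h.r16, h.r17, h.r18, h.r19, h.r36]

/-- The registers before a trial. -/
structure ModeRegs (n m M : ℕ) (p : ℝ) (R : ℕ → ℝ) : Prop where
  r3 : R 3 = n
  r4 : R 4 = 0
  r5 : R 5 = 1
  r7 : R 7 = p
  r11 : R 11 = m
  r14 : R 14 = M
  r36 : R 36 = 32

theorem TrialRegs.modeRegs {n m M a d : ℕ} {p θ : ℝ} {left : Bool} {R : ℕ → ℝ}
    (h : TrialRegs n m M a d p θ left R) : ModeRegs n m M p R :=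
  ⟨h.r3, h.r4, h.r5, h.r7, h.r11, h.r14, h.r36⟩

/-- The number of up-moves at distance `i` from the mode. -/
def sideValue (a d : ℕ) (left : Bool) (i : ℕ) : ℕ := if left then a - i else d + i

/-- Whether distance `i` from the mode is allowed; distance `0` counts for one side only. -/
def sideValid (a : ℕ) (left : Bool) (i : ℕ) : Prop := i ≤ a ∧ (left = true → 0 < i)

/-! ### Acceptance and exact evaluation of the acceptance probability. -/

variable {L : Lattice} {ans : ℝ → ℝ → ℝ} {κ X : ℝ} {g : ℝ → ℝ} {U : ℕ → (ℕ → ℝ) → ℝ}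
  {n m M a d : ℕ} {p θ : ℝ} {left : Bool}

theorem sampler_query_le (hU : RegSubvalue (sampler L) ans κ g U) {R : ℕ → ℝ} :
    U 146 R ≤ κ + g (ans (R 3) (R 31)) := by
  have h1 := hU.query (pc := 146) (d := 0) (n := 3) (k := 31) R (by cases L <;> rfl)
  have h2 := hU.halted (pc := 146 + 1) (R := Function.update R 0 (ans (R 3) (R 31)))
    (by cases L <;> exact le_rfl)
  rw [Function.update_self] at h2
  linarith

theorem sampler_accept_le (hU : RegSubvalue (sampler L) ans κ g U) (had : a + d = n)
    {R : ℕ → ℝ} (hR : TrialRegs n m M a d p θ left R) {i : ℕ} (hi : i ≤ a) (h22 : R 22 = i) :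
    U 129 R ≤ κ * 5 + g (ans n (sideValue a d left i)) := by
  have hκ := hU.nonneg
  have h1 := hU.block [.add 31 18 22] 129 R (by cases L <;> rfl) rfl
  norm_num only [List.length] at h1
  set R1 := evalList [.add 31 18 22] R with hR1
  have h31 : R1 31 = d + i := by simp [hR1, evalList, Instr.eval, hR.r18, h22]
  have hR1' : TrialRegs n m M a d p θ left R1 :=
    hR.congr (by simp [hR1, evalList, Instr.eval])
  cases left with
  | false =>
    have h2 := hU.jump_of_le (pc := 130) (a := 16) (b := 4) (t := 146) (R := R1)
      (by cases L <;> rfl) (by simp [hR1'.r16, hR1'.r4])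
    have h3 := sampler_query_le hU (R := R1)
    rw [h31, hR1'.r3] at h3
    simp only [sideValue, Nat.cast_add, Bool.false_eq_true, if_false]
    linarith
  | true =>
    have h2 := hU.jump_of_lt (pc := 130) (a := 16) (b := 4) (t := 146) (R := R1)
      (by cases L <;> rfl) (by simp [hR1'.r16, hR1'.r4])
    have h3 := hU.block [.sub 31 3 31] 131 R1 (by cases L <;> rfl) rfl
    norm_num only [List.length] at h3
    set R2 := evalList [.sub 31 3 31] R1 with hR2
    have h4 := hU.jump_of_le (pc := 132) (a := 4) (b := 4) (t := 146) (R := R2)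
      (by cases L <;> rfl) le_rfl
    have h5 := sampler_query_le hU (R := R2)
    have e31 : R2 31 = (a - i : ℕ) := by
      simp only [hR2, evalList, Instr.eval, List.foldl, Function.update_self]
      rw [h31, hR1'.r3, ← had, Nat.cast_sub hi]
      push_cast
      ring
    have e3 : R2 3 = n := by simp [hR2, evalList, Instr.eval, hR1'.r3]
    rw [e31, e3] at h5
    simp only [sideValue, if_true]
    linarith

/-- Here and below `X` bounds the value of starting a new trial; it is kept abstract until
`sampler_reject_le` closes the loop. -/
theorem sampler_coin_le (hU : RegSubvalue (sampler L) ans κ g U) (had : a + d = n)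
    (hX : ∀ R, ModeRegs n m M p R → U 44 R ≤ X)
    {R : ℕ → ℝ} (hR : TrialRegs n m M a d p θ left R) {i : ℕ} (hi : i ≤ a) (h22 : R 22 = i)
    {x : ℝ} (h27 : R 27 = x) (hx : x ∈ Set.Icc (0 : ℝ) 1) :
    U 123 R ≤ κ * 17 + x * g (ans n (sideValue a d left i)) + (1 - x) * X := by
  have hκ := hU.nonneg
  have := hU.coin (base := 123) (acc := 129) (rej := 44) (R := R)
    (A := κ * 5 + g (ans n (sideValue a d left i))) (B := X)
    (by cases L <;> rfl) hR.r4 hR.r5 (by rwa [h27])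
    (fun R' h' => sampler_accept_le hU had
      (hR.congr fun i hi => h' i (by rintro rfl; simp at hi) (by rintro rfl; simp at hi)) hi
      (by rw [h' 22 (by norm_num) (by norm_num), h22]))
    (fun R' h' => hX R' (hR.congr fun i hi =>
      h' i (by rintro rfl; simp at hi) (by rintro rfl; simp at hi)).modeRegs)
  rw [h27] at this
  nlinarith [mul_nonneg hκ (sub_nonneg.2 hx.2)]

/-- Register `28` accumulates the product `w * ratio a d θ j` at `9` instructions per factor. The
final coin has bias `(F - l) / δ` with `F` the completed product, the conditional acceptance
probability given that the exact value was requested. -/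
theorem sampler_exact_loop_le (hU : RegSubvalue (sampler L) ans κ g U) (had : a + d = n)
    (hX : ∀ R, ModeRegs n m M p R → U 44 R ≤ X) {i : ℕ} (hi : i ≤ a) {w l δ : ℝ}
    (hx : (w * ratio a d θ i - l) / δ ∈ Set.Icc (0 : ℝ) 1) (k : ℕ) {j : ℕ} (hj : j + k = i)
    {R : ℕ → ℝ} (hR : TrialRegs n m M a d p θ left R) (h22 : R 22 = i) (h25 : R 25 = l)
    (h26 : R 26 = δ) (h28 : R 28 = w * ratio a d θ j) (h29 : R 29 = j) :
    U 112 R ≤ κ * (9 * k + 20) +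
      (w * ratio a d θ i - l) / δ * g (ans n (sideValue a d left i)) +
      (1 - (w * ratio a d θ i - l) / δ) * X := by
  have hκ := hU.nonneg
  induction k generalizing j R with
  | zero =>
    obtain rfl : j = i := by omega
    have h1 := hU.jump_of_le (pc := 112) (a := 22) (b := 29) (t := 121) (R := R)
      (by cases L <;> rfl) (by rw [h22, h29])
    have h2 := hU.block [.sub 28 28 25, .div 27 28 26] 121 R (by cases L <;> rfl) rfl
    norm_num only [List.length] at h2
    set R1 := evalList [.sub 28 28 25, .div 27 28 26] R with hR1
    have h3 := sampler_coin_le hU had hX (R := R1)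
      (hR.congr (by simp [hR1, evalList, Instr.eval])) hi
      (by simp [hR1, evalList, Instr.eval, h22])
      (by simp [hR1, evalList, Instr.eval, h28, h25, h26]) hx
    push_cast
    linarith
  | succ k ih =>
    have hlt : (j : ℝ) < i := by exact_mod_cast (by omega : j < i)
    have h1 := hU.jump_of_lt (pc := 112) (a := 22) (b := 29) (t := 121) (R := R)
      (by cases L <;> rfl) (by rw [h22, h29]; exact hlt)
    have h2 := hU.block [.sub 32 17 29, .mul 32 32 19, .mul 28 28 32, .add 32 18 29,
      .add 32 32 5, .div 28 28 32, .add 29 29 5] 113 R (by cases L <;> rfl) rfl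
    norm_num only [List.length] at h2
    set R1 := evalList [.sub 32 17 29, .mul 32 32 19, .mul 28 28 32, .add 32 18 29,
      .add 32 32 5, .div 28 28 32, .add 29 29 5] R with hR1
    have h3 := hU.jump_of_le (pc := 120) (a := 4) (b := 4) (t := 112) (R := R1)
      (by cases L <;> rfl) le_rfl
    have h4 := ih (j := j + 1) (by omega) (R := R1)
      (hR.congr (by simp [hR1, evalList, Instr.eval]))
      (by simp [hR1, evalList, Instr.eval, h22]) (by simp [hR1, evalList, Instr.eval, h25])
      (by simp [hR1, evalList, Instr.eval, h26])
      (by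
        simp only [hR1, evalList, Instr.eval, List.foldl]
        simp [h28, hR.r17, hR.r18, hR.r19, hR.r5, h29, ratio_succ]
        rw [mul_assoc, mul_div_assoc, add_right_comm, mul_div_assoc])
      (by simp [hR1, evalList, Instr.eval, h29, hR.r5])
    push_cast
    linarith

/-! ### The acceptance test with rare exact evaluation, and the uniform offset. -/

variable {L : Lattice} {ans : ℝ → ℝ → ℝ} {κ X : ℝ} {g : ℝ → ℝ} {U : ℕ → (ℕ → ℝ) → ℝ}
  {n m M a d : ℕ} {p θ : ℝ} {left : Bool}

/-- With `F = w * ratio a d θ i`, acceptance has probability `δ * ((F - l) / δ) + (1 - δ) * (l / (1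
- δ)) = F`. The product of length `i` is computed only with probability `δ`, whence the term `9 * (δ
* i)` in the cost. -/
theorem sampler_test_coin_le (hU : RegSubvalue (sampler L) ans κ g U) (had : a + d = n)
    (hX : ∀ R, ModeRegs n m M p R → U 44 R ≤ X) {i : ℕ} (hi : i ≤ a) {w l δ : ℝ}
    (hl0 : 0 ≤ l) (hl : l ≤ w * ratio a d θ i) (hδ0 : 0 ≤ δ) (hδ : w * ratio a d θ i - l ≤ δ)
    (hδl : δ ≤ 1 - l) {R : ℕ → ℝ} (hR : TrialRegs n m M a d p θ left R) (h22 : R 22 = i)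
    (h21 : R 21 = w) (h25 : R 25 = l) (h26 : R 26 = δ) (h27 : R 27 = δ) :
    U 101 R ≤ κ * (34 + 9 * (δ * i)) + w * ratio a d θ i * g (ans n (sideValue a d left i)) +
      (1 - w * ratio a d θ i) * X := by
  have hκ := hU.nonneg
  set G := g (ans n (sideValue a d left i))
  set F := w * ratio a d θ i with hF
  set y := (F - l) / δ with hy
  set x := l / (1 - δ) with hx
  have hy01 : y ∈ Set.Icc (0 : ℝ) 1 :=
    ⟨div_nonneg (by linarith) hδ0, div_le_one_of_le₀ hδ hδ0⟩
  have hx01 : x ∈ Set.Icc (0 : ℝ) 1 :=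
    ⟨div_nonneg hl0 (by linarith), div_le_one_of_le₀ (by linarith) (by linarith)⟩
  -- The degenerate cases are harmless: `δ = 0` forces `F = l`, and below `δ = 1` forces `l = 0`, so
  -- the value of a division by zero does not matter.
  have hδy : δ * y = F - l := by
    rcases hδ0.eq_or_lt with h | h
    · rw [← h]
      linarith
    · rw [hy]
      field_simp
  have hδx : (1 - δ) * x = l := by
    rcases (by linarith : δ ≤ 1).eq_or_lt with h | h
    · rw [h]
      linarith
    · have : 1 - δ ≠ 0 := by linarith
      rw [hx]
      field_simp
  have h1 := hU.coin (base := 101) (acc := 110) (rej := 107) (R := R)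
    (A := κ * (9 * i + 22) + y * G + (1 - y) * X) (B := κ * 20 + x * G + (1 - x) * X)
    (by cases L <;> rfl) hR.r4 hR.r5 (by rw [h27]; exact ⟨hδ0, by linarith⟩)
    (fun R' h' => by
      have h1 := hU.block [.add 28 21 4, .const 29 0] 110 R' (by cases L <;> rfl) rfl
      norm_num only [List.length] at h1
      have hR' : TrialRegs n m M a d p θ left R' := hR.congr fun i hi =>
        h' i (by rintro rfl; simp at hi) (by rintro rfl; simp at hi)
      set R1 := evalList [.add 28 21 4, .const 29 0] R' with hR1
      have h2 := sampler_exact_loop_le hU had hX hi hy01 i (j := 0) (zero_add i) (R := R1)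
        (hR'.congr (by simp [hR1, evalList, Instr.eval]))
        (by simp [hR1, evalList, Instr.eval, h', h22])
        (by simp [hR1, evalList, Instr.eval, h', h25])
        (by simp [hR1, evalList, Instr.eval, h', h26])
        (by simp [hR1, evalList, Instr.eval, h', h21, hR.r4, ratio_zero])
        (by simp [hR1, evalList, Instr.eval])
      linarith)
    (fun R' h' => by
      have h1 := hU.block [.sub 32 5 26, .div 27 25 32] 107 R' (by cases L <;> rfl) rfl
      norm_num only [List.length] at h1
      have hR' : TrialRegs n m M a d p θ left R' := hR.congr fun i hi =>
        h' i (by rintro rfl; simp at hi) (by rintro rfl; simp at hi)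
      set R1 := evalList [.sub 32 5 26, .div 27 25 32] R' with hR1
      have h2 := hU.jump_of_le (pc := 109) (a := 4) (b := 4) (t := 123) (R := R1)
        (by cases L <;> rfl) le_rfl
      have h3 := sampler_coin_le hU had hX (R := R1)
        (hR'.congr (by simp [hR1, evalList, Instr.eval])) hi
        (by simp [hR1, evalList, Instr.eval, h', h22])
        (by simp [hR1, evalList, Instr.eval, h', h25, h26, hR.r5]; rfl) hx01
      linarith)
  rw [h27] at h1
  have e1 : δ * (κ * (9 * i + 22) + y * G + (1 - y) * X) +
      (1 - δ) * (κ * 20 + x * G + (1 - x) * X) =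
      κ * (20 + 9 * (δ * i) + 2 * δ) + (δ * y + (1 - δ) * x) * (G - X) + X := by ring
  rw [hδy, hδx] at e1
  have e2 : κ * (2 * δ) ≤ κ * 2 := mul_le_mul_of_nonneg_left (by linarith) hκ
  linarith

/-- The coin uses `δ = min e (1 - l)` with the error bound `e = 32 i / n`: this dominates `F - l`
because `F ≤ 1`, and it keeps `l / (1 - δ)` a probability. The cost is `9 * e * i = 288 * i ^ 2 / n`
plus a constant. -/
theorem sampler_test_le (hU : RegSubvalue (sampler L) ans κ g U) (hn : 0 < n)
    (hs : Side n a d θ) (hX : ∀ R, ModeRegs n m M p R → U 44 R ≤ X) {i : ℕ} (hi : i ≤ a) {w : ℝ}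
    (hw : 0 < w) (hF : w * ratio a d θ i ≤ 1)
    {R : ℕ → ℝ} (hR : TrialRegs n m M a d p θ left R) (h22 : R 22 = i) (h21 : R 21 = w) :
    U 76 R ≤ κ * (60 + 288 * (i * i / n)) +
      w * ratio a d θ i * g (ans n (sideValue a d left i)) + (1 - w * ratio a d θ i) * X := by
  have hκ := hU.nonneg
  obtain ⟨hl, he⟩ := hs.error_le hn hw hi hF
  set l := Real.exp (logLower a d θ i) * w with hldef
  set e : ℝ := 32 * i / n with hedef
  have hl0 : 0 ≤ l := by positivity
  have he0 : 0 ≤ e := by positivity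
  have h1 := hU.block boundCode 76 R (by cases L <;> rfl) rfl
  norm_num only [boundCode, List.length] at h1
  rw [show [Instr.log 25 17, .mul 25 25 17, .sub 32 17 22, .log 33 32, .mul 33 33 32, .sub 25 25 33,
    .add 32 18 5, .log 33 32, .mul 33 33 32, .add 25 25 33, .add 32 32 22, .log 33 32,
    .mul 33 33 32, .sub 25 25 33, .log 33 19, .mul 33 33 22, .add 25 25 33, .exp 25 25,
    .mul 25 25 21, .mul 26 36 22, .div 26 26 3, .sub 32 5 25] = boundCode from rfl] at h1
  set R1 := evalList boundCode R with hR1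
  have r25 : R1 25 = l := by
    simp [hR1, boundCode, evalList, Instr.eval, hR.r17, hR.r18, hR.r19, hR.r5, h22, h21, hldef,
      logLower]
  have r26 : R1 26 = e := by
    simp [hR1, boundCode, evalList, Instr.eval, hR.r36, hR.r3, h22, hedef]
  have r32 : R1 32 = 1 - l := by
    rw [← r25]
    simp [hR1, boundCode, evalList, Instr.eval, hR.r5]
  have hR1' : TrialRegs n m M a d p θ left R1 :=
    hR.congr (by simp [hR1, boundCode, evalList, Instr.eval])
  have r22 : R1 22 = i := by simp [hR1, boundCode, evalList, Instr.eval, h22]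
  have r21 : R1 21 = w := by simp [hR1, boundCode, evalList, Instr.eval, h21]
  clear_value R1
  have hcost : ∀ δ : ℝ, δ ≤ e → κ * (9 * (δ * i)) ≤ κ * (288 * (i * i / n)) := by
    intro δ hδ
    refine mul_le_mul_of_nonneg_left ?_ hκ
    calc 9 * (δ * i) ≤ 9 * (e * i) := by gcongr
      _ = _ := by rw [hedef]; ring
  have last : ∀ (R2 : ℕ → ℝ) (δ : ℝ), TrialRegs n m M a d p θ left R2 → R2 22 = i → R2 21 = w →
      R2 25 = l → R2 26 = δ → 0 ≤ δ → w * ratio a d θ i - l ≤ δ → δ ≤ 1 - l → δ ≤ e →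
      U 100 R2 ≤ κ * (35 + 288 * (i * i / n)) +
        w * ratio a d θ i * g (ans n (sideValue a d left i)) +
        (1 - w * ratio a d θ i) * X := by
    intro R2 δ hR2 s22 s21 s25 s26 hδ0 hδ hδl hδe
    have h2 := hU.block [.add 27 26 4] 100 R2 (by cases L <;> rfl) rfl
    norm_num only [List.length] at h2
    set R3 := evalList [.add 27 26 4] R2 with hR3
    have h3 := sampler_test_coin_le hU hs.add hX hi hl0 hl hδ0 hδ hδl (R := R3)
      (hR2.congr (by simp [hR3, evalList, Instr.eval])) (by simp [hR3, evalList, Instr.eval, s22])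
      (by simp [hR3, evalList, Instr.eval, s21]) (by simp [hR3, evalList, Instr.eval, s25])
      (by simp [hR3, evalList, Instr.eval, s26])
      (by simp [hR3, evalList, Instr.eval, s26, hR2.r4])
    linarith [hcost δ hδe]
  rcases le_or_gt e (1 - l) with h | h
  · have h2 := hU.jump_of_le (pc := 98) (a := 26) (b := 32) (t := 100) (R := R1)
      (by cases L <;> rfl) (by rwa [r26, r32])
    have h3 := last R1 e hR1' r22 r21 r25 r26 he0 he h le_rfl
    linarith
  · have h2 := hU.jump_of_lt (pc := 98) (a := 26) (b := 32) (t := 100) (R := R1)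
      (by cases L <;> rfl) (by rwa [r26, r32])
    have h3 := hU.block [.add 26 32 4] 99 R1 (by cases L <;> rfl) rfl
    norm_num only [List.length] at h3
    set R2 := evalList [.add 26 32 4] R1 with hR2
    have h4 := last R2 (1 - l) (hR1'.congr (by simp [hR2, evalList, Instr.eval]))
      (by simp [hR2, evalList, Instr.eval, r22]) (by simp [hR2, evalList, Instr.eval, r21])
      (by simp [hR2, evalList, Instr.eval, r25])
      (by simp [hR2, evalList, Instr.eval, r32, hR1'.r4])
      (by linarith) (by linarith) le_rfl h.le
    linarith

open Classical in
/-- The gain of a trial at distance `i` from the mode over rejection, up to scaling. -/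
noncomputable def gain (G : ℕ → ℝ) (X : ℝ) (a d : ℕ) (θ : ℝ) (left : Bool) (i : ℕ) : ℝ :=
  if sideValid a left i then ratio a d θ i * (G (sideValue a d left i) - X) else 0

/-- Values are measured relative to `X`, the value of a rejection; a distance that is not allowed
then contributes zero gain and needs no separate bookkeeping. -/
theorem sampler_valid_le (hU : RegSubvalue (sampler L) ans κ g U) (hn : 0 < n)
    (hs : Side n a d θ) (hM : 16 * n ≤ M * M) (hX : ∀ R, ModeRegs n m M p R → U 44 R ≤ X)
    {b i : ℕ} (hb : b * M ≤ i)
    {R : ℕ → ℝ} (hR : TrialRegs n m M a d p θ left R) (hi : R 22 + R 24 = i)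
    (h21 : R 21 = 2 ^ b) :
    U 71 R ≤ κ * (64 + 288 * (i * i / n)) + X +
      2 ^ b * gain (fun k => g (ans n k)) X a d θ left i := by
  have hκ := hU.nonneg
  have hcost : 0 ≤ κ * (288 * (i * i / n : ℝ)) := by positivity
  have h1 := hU.block [.add 22 22 24] 71 R (by cases L <;> rfl) rfl
  norm_num only [List.length] at h1
  set R1 := evalList [.add 22 22 24] R with hR1
  have r22 : R1 22 = i := by simp [hR1, evalList, Instr.eval, hi]
  have r21 : R1 21 = 2 ^ b := by simp [hR1, evalList, Instr.eval, h21]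
  have hR1' : TrialRegs n m M a d p θ left R1 := hR.congr (by simp [hR1, evalList, Instr.eval])
  clear_value R1
  rcases le_or_gt i a with hia | hia
  · have h2 := hU.jump_of_le (pc := 72) (a := 22) (b := 17) (t := 74) (R := R1)
      (by cases L <;> rfl) (by rw [r22, hR1'.r17]; exact_mod_cast hia)
    have h3 := sampler_test_le hU hn hs hX hia (pow_pos (by norm_num) b)
      (hs.two_pow_mul_ratio_le_one hn hM hb hia) hR1' r22 r21
    have valid : (left = true → 0 < i) → U 76 R1 ≤ κ * (60 + 288 * (i * i / n)) + X +
        2 ^ b * gain (fun k => g (ans n k)) X a d θ left i := by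
      intro hv
      unfold gain
      rw [if_pos ⟨hia, hv⟩]
      linarith
    cases left with
    | false =>
      have h4 := hU.jump_of_le (pc := 74) (a := 16) (b := 4) (t := 76) (R := R1)
        (by cases L <;> rfl) (by simp [hR1'.r16, hR1'.r4])
      have := valid (by simp)
      linarith
    | true =>
      have h4 := hU.jump_of_lt (pc := 74) (a := 16) (b := 4) (t := 76) (R := R1)
        (by cases L <;> rfl) (by simp [hR1'.r16, hR1'.r4])
      rcases Nat.eq_zero_or_pos i with h0 | h0
      · have h5 := hU.jump_of_le (pc := 75) (a := 22) (b := 4) (t := 44) (R := R1)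
          (by cases L <;> rfl) (by rw [r22, hR1'.r4, h0]; simp)
        have h6 := hX R1 hR1'.modeRegs
        unfold gain
        rw [if_neg fun h => absurd (h.2 rfl) (by omega)]
        linarith
      · have h5 := hU.jump_of_lt (pc := 75) (a := 22) (b := 4) (t := 44) (R := R1)
          (by cases L <;> rfl) (by rw [r22, hR1'.r4]; exact_mod_cast h0)
        have := valid fun _ => h0
        linarith
  · have h2 := hU.jump_of_lt (pc := 72) (a := 22) (b := 17) (t := 74) (R := R1)
      (by cases L <;> rfl) (by rw [r22, hR1'.r17]; exact_mod_cast hia)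
    have h3 := hU.jump_of_le (pc := 73) (a := 4) (b := 4) (t := 44) (R := R1)
      (by cases L <;> rfl) le_rfl
    have h4 := hX R1 hR1'.modeRegs
    unfold gain
    rw [if_neg fun h => absurd h.1 (by omega)]
    linarith

/-- The loop that draws the bits of a uniform number below `2 ^ k`. -/
theorem sampler_uniform_le (hU : RegSubvalue (sampler L) ans κ g U) {b k q o : ℕ}
    (hM : q * 2 ^ k = M) {y : ℕ → ℝ}
    (hy : ∀ (R : ℕ → ℝ) (i : ℕ), i < M → TrialRegs n m M a d p θ left R →
      R 22 + R 24 = (b * M + i : ℕ) → R 21 = 2 ^ b → U 71 R ≤ y i)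
    {R : ℕ → ℝ} (hR : TrialRegs n m M a d p θ left R) (h22 : R 22 = (b * M : ℕ))
    (h21 : R 21 = 2 ^ b) (h23 : R 23 = q) (h24 : R 24 = o) (ho : o < q) :
    U 65 R ≤ κ * (6 * k + 1) + (∑ t ∈ Finset.range (2 ^ k), y (o * 2 ^ k + t)) / 2 ^ k := by
  have hκ := hU.nonneg
  induction k generalizing q o R with
  | zero =>
    rw [pow_zero, mul_one] at hM
    have h1 := hU.jump_of_le (pc := 65) (a := 14) (b := 23) (t := 71) (R := R)
      (by cases L <;> rfl) (by rw [hR.r14, h23, hM])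
    have h2 := hy R o (by omega) hR (by rw [h22, h24]; push_cast; ring) h21
    simp only [Nat.cast_zero, mul_zero, zero_add, pow_zero, mul_one, Finset.range_one,
      Finset.sum_singleton, add_zero, div_one]
    linarith
  | succ k ih =>
    have hqM : q < M := by
      rw [← hM]
      exact lt_mul_of_one_lt_right (by omega) (Nat.one_lt_two_pow (by omega))
    have h1 := hU.jump_of_lt (pc := 65) (a := 14) (b := 23) (t := 71) (R := R)
      (by cases L <;> rfl) (by rw [hR.r14, h23]; exact_mod_cast hqM)
    have h2 := hU.block [.add 23 23 23, .add 24 24 24] 66 R (by cases L <;> rfl) rfl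
    norm_num only [List.length] at h2
    set R1 := evalList [.add 23 23 23, .add 24 24 24] R with hR1
    have h3 := hU.flip (pc := 68) (d := 20) R1 (by cases L <;> rfl)
    have branch : ∀ x : ℕ, x < 2 → U 69 (Function.update R1 20 x) ≤ κ * (6 * k + 3) +
        (∑ t ∈ Finset.range (2 ^ k), y ((2 * o + x) * 2 ^ k + t)) / 2 ^ k := by
      intro x hx
      have h4 := hU.block [.add 24 24 20] 69 (Function.update R1 20 (x : ℝ))
        (by cases L <;> rfl) rfl
      norm_num only [List.length] at h4
      set R2 := evalList [.add 24 24 20] (Function.update R1 20 (x : ℝ)) with hR2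
      have h5 := hU.jump_of_le (pc := 70) (a := 4) (b := 4) (t := 65) (R := R2)
        (by cases L <;> rfl) le_rfl
      have h6 := ih (q := 2 * q) (o := 2 * o + x) (by rw [← hM, pow_succ]; ring) (R := R2)
        (hR.congr (by simp [hR2, hR1, evalList, Instr.eval]))
        (by simp [hR2, hR1, evalList, Instr.eval, h22])
        (by simp [hR2, hR1, evalList, Instr.eval, h21])
        (by simp [hR2, hR1, evalList, Instr.eval, h23, two_mul])
        (by simp [hR2, hR1, evalList, Instr.eval, h24, two_mul]) (by omega)
      linarith
    have h4 := branch 0 (by norm_num)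
    have h5 := branch 1 (by norm_num)
    rw [Nat.cast_zero] at h4
    rw [Nat.cast_one] at h5
    have hsum : ∑ t ∈ Finset.range (2 ^ (k + 1)), y (o * 2 ^ (k + 1) + t) =
        ∑ t ∈ Finset.range (2 ^ k), y ((2 * o + 0) * 2 ^ k + t) +
          ∑ t ∈ Finset.range (2 ^ k), y ((2 * o + 1) * 2 ^ k + t) := by
      rw [pow_succ, mul_two, Finset.sum_range_add]
      congr 1 <;> refine Finset.sum_congr rfl fun t _ => ?_ <;> congr 1 <;> ring
    rw [hsum, pow_succ, add_div, ← div_div, ← div_div _ (2 ^ k : ℝ)]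
    push_cast
    linarith

/-! ### A complete trial and the rejection loop. -/

variable {L : Lattice} {ans : ℝ → ℝ → ℝ} {κ X : ℝ} {g : ℝ → ℝ} {U : ℕ → (ℕ → ℝ) → ℝ}
  {n m M a d : ℕ} {p θ : ℝ} {left : Bool}

/-- The constant is `288 * 64`: a distance in block `b` is less than `(b + 1) M`, and `M ^ 2 ≤ 64
n`. -/
theorem sampler_offset_le (hU : RegSubvalue (sampler L) ans κ g U) (hn : 0 < n)
    (hs : Side n a d θ) {k : ℕ} (hk : M = 2 ^ k) (hM : 16 * n ≤ M * M) (hM' : M * M ≤ 64 * n)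
    (hX : ∀ R, ModeRegs n m M p R → U 44 R ≤ X) {b : ℕ}
    {R : ℕ → ℝ} (hR : TrialRegs n m M a d p θ left R) (h22 : R 22 = (b * M : ℕ))
    (h21 : R 21 = 2 ^ b) :
    U 63 R ≤ κ * (67 + 6 * k + 18432 * (b + 1) ^ 2) + X +
      2 ^ b / M * ∑ t ∈ Finset.range M, gain (fun k => g (ans n k)) X a d θ left (b * M + t) := by
  have hκ := hU.nonneg
  have hn' : (0 : ℝ) < n := by exact_mod_cast hn
  have h1 := hU.block [.add 23 5 4, .const 24 0] 63 R (by cases L <;> rfl) rfl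
  norm_num only [List.length] at h1
  set R1 := evalList [.add 23 5 4, .const 24 0] R with hR1
  have h2 := sampler_uniform_le hU (k := k) (q := 1) (o := 0) (b := b) (M := M)
    (by rw [one_mul, hk])
    (y := fun t => κ * (64 + 18432 * (b + 1) ^ 2) + X +
      2 ^ b * gain (fun k => g (ans n k)) X a d θ left (b * M + t))
    (fun R i hi hR hRi hR21 => by
      have := sampler_valid_le hU hn hs hM hX (Nat.le_add_right (b * M) i) hR hRi hR21
      refine this.trans (add_le_add_left (add_le_add_left (mul_le_mul_of_nonneg_left
        (add_le_add_right ?_ 64) hκ) X) _)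
      rw [← mul_div_assoc, div_le_iff₀ hn']
      have e1 : ((b * M + i : ℕ) : ℝ) ≤ (b + 1) * M := by
        exact_mod_cast (by nlinarith : b * M + i ≤ (b + 1) * M)
      have e2 : (M : ℝ) * M ≤ 64 * n := by exact_mod_cast hM'
      calc 288 * (((b * M + i : ℕ) : ℝ) * (b * M + i : ℕ))
          ≤ 288 * (((b + 1) * M) * ((b + 1) * M)) := by gcongr
        _ = 288 * (b + 1) ^ 2 * (M * M) := by ring
        _ ≤ 288 * (b + 1) ^ 2 * (64 * n) := by gcongr
        _ = _ := by ring)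
    (R := R1) (hR.congr (by simp [hR1, evalList, Instr.eval]))
    (by simp [hR1, evalList, Instr.eval, h22]) (by simp [hR1, evalList, Instr.eval, h21])
    (by simp [hR1, evalList, Instr.eval, hR.r5, hR.r4]) (by simp [hR1, evalList, Instr.eval])
    zero_lt_one
  have hM0 : (M : ℝ) ≠ 0 := by rw [hk]; positivity
  have hkM : (2 : ℝ) ^ k = M := by rw [hk]; push_cast; rfl
  rw [hkM, ← hk, Finset.sum_add_distrib, ← Finset.mul_sum, Finset.sum_const, Finset.card_range,
    nsmul_eq_mul, add_div, mul_div_cancel_left₀ _ hM0] at h2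
  simp only [zero_mul, zero_add] at h2
  rw [div_mul_eq_mul_div]
  linarith

theorem gain_eq_zero (G : ℕ → ℝ) (X : ℝ) (d : ℕ) (θ : ℝ) (left : Bool) {i : ℕ} (h : a < i) :
    gain G X a d θ left i = 0 :=
  if_neg fun h' => absurd h'.1 (by omega)

/-- Continuing halves the probability and doubles the weight `2 ^ b`, so all distances get the same
coefficient. The polynomial `f b = b ^ 2 + 4 b + 6` solves `f b = ((b + 1) ^ 2 + f (b + 1)) / 2`,
the recursion for the mean cost. The number `j` only serves the induction: `j` further blocks
exhaust the range up to `n`. -/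
theorem sampler_geometric_le (hU : RegSubvalue (sampler L) ans κ g U) (hn : 0 < n)
    (hs : Side n a d θ) {k : ℕ} (hk : M = 2 ^ k) (hM : 16 * n ≤ M * M) (hM' : M * M ≤ 64 * n)
    (hX : ∀ R, ModeRegs n m M p R → U 44 R ≤ X) {j b : ℕ} (hj : n < (b + j) * M)
    {R : ℕ → ℝ} (hR : TrialRegs n m M a d p θ left R) (h22 : R 22 = (b * M : ℕ))
    (h21 : R 21 = 2 ^ b) :
    U 56 R ≤ κ * (79 + 6 * k + 18432 * (b ^ 2 + 4 * b + 6)) + X +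
      2 ^ b / (2 * M) *
        ∑ t ∈ Finset.range (j * M), gain (fun k => g (ans n k)) X a d θ left (b * M + t) := by
  have hκ := hU.nonneg
  induction j generalizing b R with
  | zero =>
    have h1 := hU.jump_of_lt (pc := 56) (a := 22) (b := 3) (t := 58) (R := R)
      (by cases L <;> rfl) (by rw [h22, hR.r3]; exact_mod_cast hj)
    have h2 := hU.jump_of_le (pc := 57) (a := 4) (b := 4) (t := 44) (R := R)
      (by cases L <;> rfl) le_rfl
    have h3 := hX R hR.modeRegs
    have h4 : 0 ≤ κ * (77 + 6 * k + 18432 * (b ^ 2 + 4 * b + 6)) := by positivity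
    simp only [zero_mul, Finset.range_zero, Finset.sum_empty, mul_zero, add_zero]
    linarith
  | succ j ih =>
    rcases lt_or_ge n (b * M) with hnb | hnb
    · have h1 := hU.jump_of_lt (pc := 56) (a := 22) (b := 3) (t := 58) (R := R)
        (by cases L <;> rfl) (by rw [h22, hR.r3]; exact_mod_cast hnb)
      have h2 := hU.jump_of_le (pc := 57) (a := 4) (b := 4) (t := 44) (R := R)
        (by cases L <;> rfl) le_rfl
      have h3 := hX R hR.modeRegs
      have h4 : 0 ≤ κ * (77 + 6 * k + 18432 * (b ^ 2 + 4 * b + 6)) := by positivity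
      -- All distances from here on exceed `n ≥ a`, so restarting the trial loses no gain.
      rw [Finset.sum_eq_zero fun t _ => gain_eq_zero _ _ _ _ _ (by have := hs.add; omega),
        mul_zero, add_zero]
      linarith
    have h1 := hU.jump_of_le (pc := 56) (a := 22) (b := 3) (t := 58) (R := R)
      (by cases L <;> rfl) (by rw [h22, hR.r3]; exact_mod_cast hnb)
    have h2 := hU.flip (pc := 58) (d := 20) R (by cases L <;> rfl)
    -- continue with the next block
    have h3 := hU.jump_of_lt (pc := 59) (a := 20) (b := 4) (t := 63)
      (R := Function.update R 20 1) (by cases L <;> rfl) (by simp [hR.r4])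
    have h4 := hU.block [.add 21 21 21, .add 22 22 14] 60 (Function.update R 20 1)
      (by cases L <;> rfl) rfl
    norm_num only [List.length] at h4
    set R1 := evalList [.add 21 21 21, .add 22 22 14] (Function.update R 20 1) with hR1
    have h5 := hU.jump_of_le (pc := 62) (a := 4) (b := 4) (t := 56) (R := R1)
      (by cases L <;> rfl) le_rfl
    have h6 := ih (b := b + 1) (by rwa [add_assoc, add_comm 1 j]) (R := R1)
      (hR.congr (by simp [hR1, evalList, Instr.eval]))
      (by simp [hR1, evalList, Instr.eval, h22, hR.r14, add_mul])
      (by simp [hR1, evalList, Instr.eval, h21, pow_succ, mul_two])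
    -- stop
    have h7 := hU.jump_of_le (pc := 59) (a := 20) (b := 4) (t := 63)
      (R := Function.update R 20 0) (by cases L <;> rfl) (by simp [hR.r4])
    have h8 := sampler_offset_le hU hn hs hk hM hM' hX (b := b) (R := Function.update R 20 0)
      (hR.congr (by simp)) (by simp [h22]) (by simp [h21])
    rw [add_mul j 1 M, one_mul, add_comm (j * M) M, Finset.sum_range_add]
    have hidx : ∀ t, (b + 1) * M + t = b * M + (M + t) := fun t => by ring
    simp only [hidx] at h6
    set S1 := ∑ t ∈ Finset.range (j * M),
      gain (fun k => g (ans n k)) X a d θ left (b * M + (M + t))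
    set S0 := ∑ t ∈ Finset.range M, gain (fun k => g (ans n k)) X a d θ left (b * M + t)
    have e1 : (2 : ℝ) ^ (b + 1) / (2 * M) * S1 = 2 * (2 ^ b / (2 * M) * S1) := by
      rw [pow_succ]; ring
    have e0 : (2 : ℝ) ^ b / M * S0 = 2 * (2 ^ b / (2 * M) * S0) := by
      rw [← div_div]; ring
    rw [e1] at h6
    rw [e0] at h8
    push_cast at h6
    rw [mul_add (2 ^ b / (2 * (M : ℝ)))]
    nlinarith

/-- The sum of the gains on both sides of the mode. -/
theorem mul_sum_gain (hm : IsMode p n m) (G : ℕ → ℝ) (X : ℝ) {K : ℕ} (hK : n < K) :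
    binWeight p n m *
        (∑ t ∈ Finset.range K, gain G X (n - m) m (p / (1 - p)) false t +
          ∑ t ∈ Finset.range K, gain G X m (n - m) ((1 - p) / p) true t) =
      binExp p n G - X := by
  have hp0 : 0 < p := by linarith [hm.le_prob]
  have hp1 : p < 1 := by linarith [hm.prob_le]
  have hmn := hm.le_n
  have hright : ∑ t ∈ Finset.range K, gain G X (n - m) m (p / (1 - p)) false t =
      ∑ t ∈ Finset.range (n - m + 1), ratio (n - m) m (p / (1 - p)) t * (G (m + t) - X) := by
    rw [← Finset.sum_subset (Finset.range_subset_range.2 (by omega : n - m + 1 ≤ K))]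
    · refine Finset.sum_congr rfl fun t ht => ?_
      have : t ≤ n - m := Nat.lt_succ_iff.1 (Finset.mem_range.1 ht)
      unfold gain
      rw [if_pos ⟨this, by simp⟩]
      rfl
    · intro t _ ht
      exact gain_eq_zero _ _ _ _ _ (by simpa using ht)
  have hleft : ∑ t ∈ Finset.range K, gain G X m (n - m) ((1 - p) / p) true t =
      ∑ t ∈ Finset.range m, ratio m (n - m) ((1 - p) / p) (t + 1) * (G (m - (t + 1)) - X) := by
    rw [← Finset.sum_subset (Finset.range_subset_range.2 (by omega : m + 1 ≤ K)),
      Finset.sum_range_succ']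
    · have : gain G X m (n - m) ((1 - p) / p) true 0 = 0 :=
        if_neg fun h => absurd (h.2 rfl) (by omega)
      rw [this, add_zero]
      refine Finset.sum_congr rfl fun t ht => ?_
      unfold gain
      rw [if_pos ⟨Finset.mem_range.1 ht, fun _ => Nat.succ_pos t⟩]
      rfl
    · intro t _ ht
      exact gain_eq_zero _ _ _ _ _ (by simpa using ht)
  have htotal : binExp p n G - X = ∑ k ∈ Finset.range (n + 1), binWeight p n k * (G k - X) := by
    simp only [mul_sub, Finset.sum_sub_distrib, ← Finset.sum_mul]
    rw [sum_binWeight, one_mul, binExp_eq_sum]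
  rw [htotal, hright, hleft, mul_add, Finset.mul_sum, Finset.mul_sum,
    show n + 1 = m + (n - m + 1) by omega, Finset.sum_range_add _ m (n - m + 1)]
  refine (add_comm _ _).trans ?_
  congr 1
  · rw [← Finset.sum_range_reflect]
    refine Finset.sum_congr rfl fun t ht => ?_
    have ht' := Finset.mem_range.1 ht
    rw [← mul_assoc, show m - 1 - t + 1 = m - t by omega, ← binWeight_sub hp0 hmn (Nat.sub_le m t),
      Nat.sub_sub_self ht'.le]
  · refine Finset.sum_congr rfl fun t ht => ?_
    have ht' := Finset.mem_range.1 ht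
    rw [← mul_assoc, ← binWeight_add hp1 (by omega)]

/-- A distance is proposed and accepted with probability `1/2 * 2 ^ (-(b + 1)) / M * 2 ^ b * ratio =
ratio / (4 M)`. As `ratio` is the weight relative to the mode, the trial moves the value from `X`
towards the binomial mean by the fraction `1 / (4 M w)`, with `w` the weight of the mode. -/
theorem sampler_trial_le (hU : RegSubvalue (sampler L) ans κ g U) (hn : 0 < n)
    (hm : IsMode p n m) {k : ℕ} (hk : M = 2 ^ k) (hM : 16 * n ≤ M * M) (hM' : M * M ≤ 64 * n)
    (hX : ∀ R, ModeRegs n m M p R → U 44 R ≤ X) {R : ℕ → ℝ} (hR : ModeRegs n m M p R) :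
    U 44 R ≤ κ * (110683 + 6 * k) + X +
      (binExp p n (fun k => g (ans n k)) - X) / (4 * (M * binWeight p n m)) := by
  have hκ := hU.nonneg
  have hMpos : 0 < M := by rw [hk]; positivity
  have hK : n < (0 + (n + 1)) * M := by
    rw [zero_add]
    exact (Nat.lt_succ_self n).trans_le (Nat.le_mul_of_pos_right _ hMpos)
  have h1 := hU.flip (pc := 44) (d := 16) R (by cases L <;> rfl)
  -- right
  have r1 := hU.block [.sub 17 3 11, .add 18 11 4, .sub 20 5 7, .div 19 7 20] 45
    (Function.update R 16 0) (by cases L <;> rfl) rfl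
  norm_num only [List.length] at r1
  set A1 := evalList [.sub 17 3 11, .add 18 11 4, .sub 20 5 7, .div 19 7 20]
    (Function.update R 16 0) with hA1
  have r2 := hU.jump_of_le (pc := 49) (a := 16) (b := 4) (t := 54) (R := A1)
    (by cases L <;> rfl) (by simp [hA1, evalList, Instr.eval, hR.r4])
  have r3 := hU.block [.add 21 5 4, .const 22 0] 54 A1 (by cases L <;> rfl) rfl
  norm_num only [List.length] at r3
  set A2 := evalList [.add 21 5 4, .const 22 0] A1 with hA2
  have tA : TrialRegs n m M (n - m) m p (p / (1 - p)) false A2 := by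
    constructor <;> simp [hA2, hA1, evalList, Instr.eval, hR.r3, hR.r4, hR.r5, hR.r7, hR.r11,
      hR.r14, hR.r36, Nat.cast_sub hm.le_n]
  have r4 := sampler_geometric_le hU hn hm.right hk hM hM' hX (b := 0) hK tA
    (by simp [hA2, evalList, Instr.eval])
    (by simp [hA2, hA1, evalList, Instr.eval, hR.r4, hR.r5])
  -- left
  have l1 := hU.block [.sub 17 3 11, .add 18 11 4, .sub 20 5 7, .div 19 7 20] 45
    (Function.update R 16 1) (by cases L <;> rfl) rfl
  norm_num only [List.length] at l1
  set B1 := evalList [.sub 17 3 11, .add 18 11 4, .sub 20 5 7, .div 19 7 20]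
    (Function.update R 16 1) with hB1
  have l2 := hU.jump_of_lt (pc := 49) (a := 16) (b := 4) (t := 54) (R := B1)
    (by cases L <;> rfl) (by simp [hB1, evalList, Instr.eval, hR.r4])
  have l3 := hU.block [.add 18 17 4, .add 17 11 4, .sub 20 5 7, .div 19 20 7, .add 21 5 4,
    .const 22 0] 50 B1 (by cases L <;> rfl) rfl
  norm_num only [List.length] at l3
  set B2 := evalList [.add 18 17 4, .add 17 11 4, .sub 20 5 7, .div 19 20 7, .add 21 5 4,
    .const 22 0] B1 with hB2
  have tB : TrialRegs n m M m (n - m) p ((1 - p) / p) true B2 := by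
    constructor <;> simp [hB2, hB1, evalList, Instr.eval, hR.r3, hR.r4, hR.r5, hR.r7, hR.r11,
      hR.r14, hR.r36, Nat.cast_sub hm.le_n]
  have l4 := sampler_geometric_le hU hn hm.left hk hM hM' hX (b := 0) hK tB
    (by simp [hB2, evalList, Instr.eval])
    (by simp [hB2, hB1, evalList, Instr.eval, hR.r4, hR.r5])
  simp only [pow_zero, zero_mul, zero_add] at r4 l4
  have hsum := mul_sum_gain hm (fun k => g (ans n k)) X
    (K := (n + 1) * M) (by rwa [zero_add] at hK)
  set SR := ∑ t ∈ Finset.range ((n + 1) * M),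
    gain (fun k => g (ans n k)) X (n - m) m (p / (1 - p)) false t
  set SL := ∑ t ∈ Finset.range ((n + 1) * M),
    gain (fun k => g (ans n k)) X m (n - m) ((1 - p) / p) true t
  have hpos := binWeight_pos (p := p) (by linarith [hm.le_prob]) (by linarith [hm.prob_le]) hm.le_n
  have hM0 : (0 : ℝ) < M := by exact_mod_cast hMpos
  have e1 : (binExp p n (fun k => g (ans n k)) - X) / (4 * (M * binWeight p n m)) =
      (1 / (2 * M) * SR + 1 / (2 * M) * SL) / 2 := by
    rw [← hsum]
    field_simp
    ring
  rw [e1]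
  norm_num at r4 l4
  norm_num
  linarith

/-- Taking for `X` the supremum over all configurations before a trial, `sampler_trial_le` becomes
an inequality for `X` itself, with `X` cancelling except in the success term. Boundedness of `U`
makes the supremum finite, and `256 = 4 * 64` bounds the expected number of trials. -/
theorem sampler_reject_le (hU : RegSubvalue (sampler L) ans κ g U) (hn : 0 < n)
    (hm : IsMode p n m) {k : ℕ} (hk : M = 2 ^ k) (hM : 16 * n ≤ M * M) (hM' : M * M ≤ 64 * n)
    {R : ℕ → ℝ} (hR : ModeRegs n m M p R) :
    U 44 R ≤ κ * (256 * (110683 + 6 * k)) + binExp p n (fun k => g (ans n k)) := by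
  have hκ := hU.nonneg
  obtain ⟨C, hC⟩ := hU.bounded
  set S : Set ℝ := {x | ∃ R, ModeRegs n m M p R ∧ x = U 44 R} with hS
  have hbdd : BddAbove S := ⟨C, by rintro _ ⟨R, -, rfl⟩; exact hC _ _⟩
  have hX : ∀ R, ModeRegs n m M p R → U 44 R ≤ sSup S := fun R hR => le_csSup hbdd ⟨R, hR, rfl⟩
  have hle : sSup S ≤ κ * (110683 + 6 * k) + sSup S +
      (binExp p n (fun k => g (ans n k)) - sSup S) / (4 * (M * binWeight p n m)) := by
    refine csSup_le ⟨_, R, hR, rfl⟩ ?_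
    rintro _ ⟨R', hR', rfl⟩
    exact sampler_trial_le hU hn hm hk hM hM' hX hR'
  have hpos := binWeight_pos (p := p) (by linarith [hm.le_prob]) (by linarith [hm.prob_le]) hm.le_n
  have hM0 : (0 : ℝ) < M := by rw [hk]; positivity
  have hc := hm.mul_binWeight_le hn hM'
  set c := (M : ℝ) * binWeight p n m
  have hc0 : 0 < 4 * c := by positivity
  have h1 : (sSup S - binExp p n fun k => g (ans n k)) / (4 * c) ≤ κ * (110683 + 6 * k) := by
    rw [← neg_sub, neg_div]
    linarith
  rw [div_le_iff₀ hc0] at h1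
  have h2 : κ * (110683 + 6 * k) * (4 * c) ≤ κ * (110683 + 6 * k) * 256 :=
    mul_le_mul_of_nonneg_left (by linarith) (by positivity)
  linarith [hX R hR]

/-! ### Computation of mode and scale, and the method with one coin per step. -/

variable {L : Lattice} {ans : ℝ → ℝ → ℝ} {κ : ℝ} {g : ℝ → ℝ} {U : ℕ → (ℕ → ℝ) → ℝ}
  {n m : ℕ} {p : ℝ}

/-- The registers while the mode is computed. -/
structure SetupRegs (n : ℕ) (p : ℝ) (R : ℕ → ℝ) : Prop where
  r3 : R 3 = n
  r4 : R 4 = 0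
  r5 : R 5 = 1
  r7 : R 7 = p
  r9 : R 9 = (n + 1) * p
  r12 : R 12 = 1 / 2

theorem SetupRegs.congr {R R' : ℕ → ℝ} (h : SetupRegs n p R)
    (h' : ∀ i ∈ [3, 4, 5, 7, 9, 12], R' i = R i) : SetupRegs n p R' := by
  constructor <;> rw [h' _ (by simp)]
  exacts [h.r3, h.r4, h.r5, h.r7, h.r9, h.r12]

/-- The loop that doubles `M` until `16 n ≤ M ^ 2`. -/
theorem sampler_sqrt_le (hU : RegSubvalue (sampler L) ans κ g U) (hn : 0 < n)
    (hm : IsMode p n m) {K : ℕ} (hK : n ≤ 2 ^ K) {k j : ℕ} (hj : k + j = K + 4)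
    (hk : 2 ^ k * 2 ^ k ≤ 64 * n) {R : ℕ → ℝ} (hR : ModeRegs n m (2 ^ k) p R)
    (h15 : R 15 = 16 * n) :
    U 40 R ≤ κ * (4 * j + 2 + 256 * (110683 + 6 * (K + 4))) +
      binExp p n (fun k => g (ans n k)) := by
  have hκ := hU.nonneg
  induction j generalizing k R with
  | zero =>
    rw [add_zero] at hj
    have h1 := hU.block [.mul 13 14 14] 40 R (by cases L <;> rfl) rfl
    norm_num only [List.length] at h1
    set R1 := evalList [.mul 13 14 14] R with hR1
    -- After `K + 4` doublings the loop must have ended, since `2 ^ K ≥ n`.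
    have hbig : 16 * n ≤ 2 ^ k * 2 ^ k := by
      rw [hj, pow_add]
      nlinarith [Nat.one_le_two_pow (n := K)]
    have h2 := hU.jump_of_le (pc := 41) (a := 15) (b := 13) (t := 44) (R := R1)
      (by cases L <;> rfl) (by
        simp [hR1, evalList, Instr.eval, h15, hR.r14]
        exact_mod_cast hbig)
    have h3 := sampler_reject_le hU hn hm rfl hbig hk (R := R1)
      (by constructor <;> simp [hR1, evalList, Instr.eval, hR.r3, hR.r4, hR.r5, hR.r7, hR.r11,
            hR.r14, hR.r36])
    rw [hj] at h3
    push_cast at h3 ⊢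
    linarith
  | succ j ih =>
    have h1 := hU.block [.mul 13 14 14] 40 R (by cases L <;> rfl) rfl
    norm_num only [List.length] at h1
    set R1 := evalList [.mul 13 14 14] R with hR1
    have hR1' : ModeRegs n m (2 ^ k) p R1 := by
      constructor <;> simp [hR1, evalList, Instr.eval, hR.r3, hR.r4, hR.r5, hR.r7, hR.r11,
        hR.r14, hR.r36]
    rcases le_or_gt (16 * n) (2 ^ k * 2 ^ k) with hbig | hbig
    · have h2 := hU.jump_of_le (pc := 41) (a := 15) (b := 13) (t := 44) (R := R1)
        (by cases L <;> rfl) (by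
          simp [hR1, evalList, Instr.eval, h15, hR.r14]
          exact_mod_cast hbig)
      have h3 := sampler_reject_le hU hn hm rfl hbig hk hR1'
      have h4 : κ * (256 * (110683 + 6 * k)) ≤ κ * (256 * (110683 + 6 * (K + 4))) := by
        have : (k : ℝ) ≤ K + 4 := by exact_mod_cast (by omega : k ≤ K + 4)
        gcongr
      have h5 : 0 ≤ κ * (4 * (j + 1)) := by positivity
      push_cast
      linarith
    · have h2 := hU.jump_of_lt (pc := 41) (a := 15) (b := 13) (t := 44) (R := R1)
        (by cases L <;> rfl) (by
          simp [hR1, evalList, Instr.eval, h15, hR.r14]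
          exact_mod_cast hbig)
      have h3 := hU.block [.add 14 14 14] 42 R1 (by cases L <;> rfl) rfl
      norm_num only [List.length] at h3
      set R2 := evalList [.add 14 14 14] R1 with hR2
      have h4 := hU.jump_of_le (pc := 43) (a := 4) (b := 4) (t := 40) (R := R2)
        (by cases L <;> rfl) le_rfl
      -- One doubling multiplies `M ^ 2 < 16 n` by four, which preserves `M ^ 2 ≤ 64 n`.
      have h5 := ih (k := k + 1) (by omega) (by rw [pow_succ]; nlinarith) (R := R2)
        (by constructor <;> simp [hR2, evalList, Instr.eval, hR1'.r3, hR1'.r4, hR1'.r5, hR1'.r7,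
              hR1'.r11, hR1'.r14, hR1'.r36, pow_succ, mul_two])
        (by simp [hR2, hR1, evalList, Instr.eval, h15])
      push_cast at h5 ⊢
      linarith

/-- The loop that computes the mode by bisection. -/
theorem sampler_bisect_le (hU : RegSubvalue (sampler L) ans κ g U) (hn : 0 < n)
    (hp : 1 / 4 ≤ p) (hp' : p ≤ 3 / 4) {K : ℕ} (hK : n ≤ 2 ^ K) {k m : ℕ}
    (hm : (m : ℝ) ≤ (n + 1) * p) (hm' : (n + 1) * p < m + 2 ^ k) {R : ℕ → ℝ}
    (hR : SetupRegs n p R) (h10 : R 10 = 2 ^ k) (h11 : R 11 = m) :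
    U 29 R ≤ κ * (6 * k + 28345000 + 1540 * K) + binExp p n (fun k => g (ans n k)) := by
  have hκ := hU.nonneg
  induction k generalizing m R with
  | zero =>
    have h1 := hU.jump_of_le (pc := 29) (a := 10) (b := 5) (t := 36) (R := R)
      (by cases L <;> rfl) (by rw [h10, hR.r5, pow_zero])
    have h2 := hU.block [.const 36 32, .const 6 16, .mul 15 6 3, .add 14 5 4] 36 R
      (by cases L <;> rfl) rfl
    norm_num only [List.length] at h2
    set R1 := evalList [.const 36 32, .const 6 16, .mul 15 6 3, .add 14 5 4] R with hR1
    -- The search starts from `M = 1`. The claimed constants come from `256 * (110683 + 24)` plus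
    -- small terms, and from `1540 = 256 * 6 + 4` for the coefficient of `K`.
    have h3 := sampler_sqrt_le hU hn (m := m) ⟨hp, hp', hm, by simpa using hm'⟩ hK (k := 0)
      (j := K + 4) (zero_add _) (by omega) (R := R1)
      (by constructor <;> simp [hR1, evalList, Instr.eval, hR.r3, hR.r4, hR.r5, hR.r7, h11])
      (by simp [hR1, evalList, Instr.eval, hR.r3])
    push_cast at h3 ⊢
    have h4 : 0 ≤ κ * K := by positivity
    linarith
  | succ k ih =>
    have hpow : (1 : ℝ) < 2 ^ (k + 1) := one_lt_pow₀ (by norm_num) (by omega)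
    have h1 := hU.jump_of_lt (pc := 29) (a := 10) (b := 5) (t := 36) (R := R)
      (by cases L <;> rfl) (by rwa [h10, hR.r5])
    have h2 := hU.block [.mul 10 10 12, .add 13 11 10] 30 R (by cases L <;> rfl) rfl
    norm_num only [List.length] at h2
    set R1 := evalList [.mul 10 10 12, .add 13 11 10] R with hR1
    have r10 : R1 10 = 2 ^ k := by
      simp [hR1, evalList, Instr.eval, h10, hR.r12, pow_succ]
    have r13 : R1 13 = m + 2 ^ k := by
      rw [← r10]
      simp [hR1, evalList, Instr.eval, h11]
    have r11 : R1 11 = m := by simp [hR1, evalList, Instr.eval, h11]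
    have hR1' : SetupRegs n p R1 := hR.congr (by simp [hR1, evalList, Instr.eval])
    rcases le_or_gt ((m : ℝ) + 2 ^ k) ((n + 1) * p) with h | h
    · have h3 := hU.jump_of_le (pc := 32) (a := 13) (b := 9) (t := 34) (R := R1)
        (by cases L <;> rfl) (by rwa [r13, hR1'.r9])
      have h4 := hU.block [.add 11 13 4] 34 R1 (by cases L <;> rfl) rfl
      norm_num only [List.length] at h4
      set R2 := evalList [.add 11 13 4] R1 with hR2
      have h5 := hU.jump_of_le (pc := 35) (a := 4) (b := 4) (t := 29) (R := R2)
        (by cases L <;> rfl) le_rfl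
      have h6 := ih (m := m + 2 ^ k) (by push_cast; exact h)
        (by push_cast; rw [pow_succ] at hm'; linarith) (R := R2)
        (hR1'.congr (by simp [hR2, evalList, Instr.eval]))
        (by simp [hR2, evalList, Instr.eval, r10])
        (by simp [hR2, evalList, Instr.eval, r13, hR1'.r4])
      push_cast
      linarith
    · have h3 := hU.jump_of_lt (pc := 32) (a := 13) (b := 9) (t := 34) (R := R1)
        (by cases L <;> rfl) (by rwa [r13, hR1'.r9])
      have h4 := hU.jump_of_le (pc := 33) (a := 4) (b := 4) (t := 29) (R := R1)
        (by cases L <;> rfl) le_rfl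
      have h6 := ih hm h hR1' r10 r11
      push_cast
      linarith

/-- The loop that finds a power of two above the mode. -/
theorem sampler_double_le (hU : RegSubvalue (sampler L) ans κ g U) (hn : 0 < n)
    (hp : 1 / 4 ≤ p) (hp' : p ≤ 3 / 4) {K : ℕ} (hK : n + 1 ≤ 2 ^ K) {k j : ℕ} (hj : k + j = K)
    {R : ℕ → ℝ} (hR : SetupRegs n p R) (h10 : R 10 = 2 ^ k) (h11 : R 11 = 0) :
    U 25 R ≤ κ * (3 * j + 28345002 + 1546 * K) + binExp p n (fun k => g (ans n k)) := by
  have hκ := hU.nonneg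
  -- Once `2 ^ k` exceeds `(n + 1) p`, bisection takes over with `k ≤ K` rounds of `6` instructions
  -- each.
  have exit : ∀ {k : ℕ} {R : ℕ → ℝ}, k ≤ K → SetupRegs n p R → R 10 = 2 ^ k → R 11 = 0 →
      (n + 1) * p < 2 ^ k →
      U 25 R ≤ κ * (28345002 + 1546 * K) + binExp p n (fun k => g (ans n k)) := by
    intro k R hk hR h10 h11 h
    have h1 := hU.jump_of_lt (pc := 25) (a := 10) (b := 9) (t := 27) (R := R)
      (by cases L <;> rfl) (by rwa [h10, hR.r9])
    have h2 := hU.jump_of_le (pc := 26) (a := 4) (b := 4) (t := 29) (R := R)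
      (by cases L <;> rfl) le_rfl
    have h3 := sampler_bisect_le hU hn hp hp' (by omega : n ≤ 2 ^ K) (m := 0) (k := k)
      (by rw [Nat.cast_zero]; positivity) (by simpa using h) hR h10 (by rw [h11, Nat.cast_zero])
    have h4 : κ * k ≤ κ * K := mul_le_mul_of_nonneg_left (by exact_mod_cast hk) hκ
    linarith
  induction j generalizing k R with
  | zero =>
    have h : (n + 1) * p < 2 ^ k := by
      have h1 : (n : ℝ) + 1 ≤ 2 ^ k := by
        rw [← hj, add_zero] at hK
        exact_mod_cast hK
      have h2 : (0 : ℝ) ≤ n := Nat.cast_nonneg n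
      nlinarith
    simpa using exit (by omega) hR h10 h11 h
  | succ j ih =>
    rcases lt_or_ge ((n + 1) * p) (2 ^ k) with h | h
    · have h1 := exit (by omega) hR h10 h11 h
      have h2 : 0 ≤ κ * (3 * (j + 1 : ℕ)) := by positivity
      linarith
    · have h1 := hU.jump_of_le (pc := 25) (a := 10) (b := 9) (t := 27) (R := R)
        (by cases L <;> rfl) (by rwa [h10, hR.r9])
      have h2 := hU.block [.add 10 10 10] 27 R (by cases L <;> rfl) rfl
      norm_num only [List.length] at h2
      set R1 := evalList [.add 10 10 10] R with hR1
      have h3 := hU.jump_of_le (pc := 28) (a := 4) (b := 4) (t := 25) (R := R1)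
        (by cases L <;> rfl) le_rfl
      have h4 := ih (k := k + 1) (by omega) (R := R1)
        (hR.congr (by simp [hR1, evalList, Instr.eval]))
        (by simp [hR1, evalList, Instr.eval, h10, pow_succ, mul_two])
        (by simp [hR1, evalList, Instr.eval, h11])
      push_cast
      linarith

/-- The method that tosses a coin for each step. -/
theorem sampler_naive_le (hU : RegSubvalue (sampler L) ans κ g U) (hp : p ∈ Set.Icc (0 : ℝ) 1)
    {j k : ℕ} {R : ℕ → ℝ} (h3 : R 3 = n) (h4 : R 4 = 0) (h5 : R 5 = 1) (h7 : R 7 = p)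
    (h29 : R 29 = j) (h31 : R 31 = k) :
    U 135 R ≤ κ * (17 * j + 2) + binExp p j (fun i => g (ans n (k + i : ℕ))) := by
  have hκ := hU.nonneg
  induction j generalizing k R with
  | zero =>
    have h1 := hU.jump_of_le (pc := 135) (a := 29) (b := 4) (t := 146) (R := R)
      (by cases L <;> rfl) (by simp [h29, h4])
    have h2 := sampler_query_le hU (R := R)
    rw [h3, h31] at h2
    simp only [binExp, add_zero, Nat.cast_zero, mul_zero, zero_add]
    linarith
  | succ j ih =>
    have h1 := hU.jump_of_lt (pc := 135) (a := 29) (b := 4) (t := 146) (R := R)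
      (by cases L <;> rfl) (by rw [h29, h4]; positivity)
    have h2 := hU.block [.sub 29 29 5, .add 27 7 4] 136 R (by cases L <;> rfl) rfl
    norm_num only [List.length] at h2
    set R1 := evalList [.sub 29 29 5, .add 27 7 4] R with hR1
    have r27 : R1 27 = p := by simp [hR1, evalList, Instr.eval, h7, h4]
    have e3 := hU.coin (base := 138) (acc := 144) (rej := 135) (R := R1)
      (A := κ * (17 * j + 4) + binExp p j (fun i => g (ans n (k + 1 + i : ℕ))))
      (B := κ * (17 * j + 2) + binExp p j (fun i => g (ans n (k + i : ℕ))))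
      (by cases L <;> rfl) (by simp [hR1, evalList, Instr.eval, h4])
      (by simp [hR1, evalList, Instr.eval, h5]) (by rwa [r27])
      (fun R' h' => by
        have e1 := hU.block [.add 31 31 5] 144 R' (by cases L <;> rfl) rfl
        norm_num only [List.length] at e1
        set R2 := evalList [.add 31 31 5] R' with hR2
        have e2 := hU.jump_of_le (pc := 145) (a := 4) (b := 4) (t := 135) (R := R2)
          (by cases L <;> rfl) le_rfl
        have e3 := ih (k := k + 1) (R := R2)
          (by simp [hR2, hR1, evalList, Instr.eval, h', h3])
          (by simp [hR2, hR1, evalList, Instr.eval, h', h4])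
          (by simp [hR2, hR1, evalList, Instr.eval, h', h5])
          (by simp [hR2, hR1, evalList, Instr.eval, h', h7])
          (by simp [hR2, hR1, evalList, Instr.eval, h', h29, h5])
          (by simp [hR2, hR1, evalList, Instr.eval, h', h31, h5])
        linarith)
      (fun R' h' => ih
        (by simp [hR1, evalList, Instr.eval, h', h3])
        (by simp [hR1, evalList, Instr.eval, h', h4])
        (by simp [hR1, evalList, Instr.eval, h', h5])
        (by simp [hR1, evalList, Instr.eval, h', h7])
        (by simp [hR1, evalList, Instr.eval, h', h29, h5])
        (by simp [hR1, evalList, Instr.eval, h', h31]))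
    rw [r27] at e3
    have hidx : (fun i => g (ans n (k + (i + 1) : ℕ))) = fun i => g (ans n (k + 1 + i : ℕ)) := by
      funext i
      rw [add_assoc, add_comm 1 i]
    rw [binExp, hidx]
    -- One pass costs `3` for the loop, `12` for the coin and `2` more on success, in all at most
    -- `17`.
    have e4 : κ * p ≤ κ * 1 := mul_le_mul_of_nonneg_left hp.2 hκ
    rw [Nat.cast_succ]
    linarith

/-- The sampler after the computation of the probability of an up-move. -/
theorem sampler_main_le (hU : RegSubvalue (sampler L) ans κ g U) (hn : 0 < n)
    (hp : p ∈ Set.Icc (0 : ℝ) 1) {K : ℕ} (hK : n + 1 ≤ 2 ^ K) {N : ℕ}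
    (hN : ¬ (1 / 4 ≤ p ∧ p ≤ 3 / 4) → n ≤ N)
    {R : ℕ → ℝ} (h3 : R 3 = n) (h4 : R 4 = 0) (h5 : R 5 = 1) (h7 : R 7 = p) :
    U 14 R ≤ κ * (28345100 + 1549 * K + 17 * N) + binExp p n (fun k => g (ans n k)) := by
  have hκ := hU.nonneg
  have hN0 : 0 ≤ κ * N := by positivity
  have hK0 : 0 ≤ κ * K := by positivity
  have h1 := hU.block [.const 6 (1 / 4), .const 8 (3 / 4)] 14 R (by cases L <;> rfl) rfl
  norm_num only [List.length] at h1
  set R1 := evalList [.const 6 (1 / 4), .const 8 (3 / 4)] R with hR1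
  have r3 : R1 3 = n := by simp [hR1, evalList, Instr.eval, h3]
  have r4 : R1 4 = 0 := by simp [hR1, evalList, Instr.eval, h4]
  have r5 : R1 5 = 1 := by simp [hR1, evalList, Instr.eval, h5]
  have r6 : R1 6 = 1 / 4 := by simp [hR1, evalList, Instr.eval]
  have r7 : R1 7 = p := by simp [hR1, evalList, Instr.eval, h7]
  have r8 : R1 8 = 3 / 4 := by simp [hR1, evalList, Instr.eval]
  clear_value R1
  have naive : n ≤ N → U 133 R1 ≤ κ * (17 * N + 4) + binExp p n (fun k => g (ans n k)) := by
    intro hnN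
    have e1 := hU.block [.const 31 0, .add 29 3 4] 133 R1 (by cases L <;> rfl) rfl
    norm_num only [List.length] at e1
    set R2 := evalList [.const 31 0, .add 29 3 4] R1 with hR2
    have e2 := sampler_naive_le hU hp (n := n) (j := n) (k := 0) (R := R2)
      (by simp [hR2, evalList, Instr.eval, r3]) (by simp [hR2, evalList, Instr.eval, r4])
      (by simp [hR2, evalList, Instr.eval, r5]) (by simp [hR2, evalList, Instr.eval, r7])
      (by simp [hR2, evalList, Instr.eval, r3, r4]) (by simp [hR2, evalList, Instr.eval])
    simp only [zero_add] at e2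
    have e3 : κ * n ≤ κ * N := mul_le_mul_of_nonneg_left (by exact_mod_cast hnN) hκ
    linarith
  rcases lt_or_ge p (1 / 4) with h | h
  · have h2 := hU.jump_of_lt (pc := 16) (a := 6) (b := 7) (t := 18) (R := R1)
      (by cases L <;> rfl) (by rwa [r6, r7])
    have h3 := hU.jump_of_le (pc := 17) (a := 4) (b := 4) (t := 133) (R := R1)
      (by cases L <;> rfl) le_rfl
    have h4 := naive (hN fun h' => absurd h'.1 (not_le.2 h))
    linarith
  have h2 := hU.jump_of_le (pc := 16) (a := 6) (b := 7) (t := 18) (R := R1)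
    (by cases L <;> rfl) (by rwa [r6, r7])
  rcases lt_or_ge (3 / 4) p with h' | h'
  · have h3 := hU.jump_of_lt (pc := 18) (a := 7) (b := 8) (t := 20) (R := R1)
      (by cases L <;> rfl) (by rwa [r7, r8])
    have h4 := hU.jump_of_le (pc := 19) (a := 4) (b := 4) (t := 133) (R := R1)
      (by cases L <;> rfl) le_rfl
    have h5 := naive (hN fun h'' => absurd h''.2 (not_le.2 h'))
    linarith
  have h3 := hU.jump_of_le (pc := 18) (a := 7) (b := 8) (t := 20) (R := R1)
    (by cases L <;> rfl) (by rwa [r7, r8])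
  have h4 := hU.block [.add 9 3 5, .mul 9 9 7, .add 10 5 4, .const 11 0, .const 12 (1 / 2)] 20 R1
    (by cases L <;> rfl) rfl
  norm_num only [List.length] at h4
  set R2 := evalList [.add 9 3 5, .mul 9 9 7, .add 10 5 4, .const 11 0, .const 12 (1 / 2)] R1
    with hR2
  have h5 := sampler_double_le hU hn h h' hK (k := 0) (j := K) (zero_add K) (R := R2)
    (by constructor <;> simp [hR2, evalList, Instr.eval, r3, r4, r5, r7])
    (by simp [hR2, evalList, Instr.eval, r5, r4]) (by simp [hR2, evalList, Instr.eval])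
  linarith

/-! ### The up-probability for small steps, and the total cost of the sampler. -/

theorem answer_natCast (O : ℕ → ℝ → ℕ → ℝ) (s : ℝ) {n k : ℕ} (hn : 0 < n) (hk : k ≤ n) :
    answer O n s k = O n s k := by
  unfold answer
  rw [if_pos (by simp [hn, hk]), Nat.floor_natCast, Nat.floor_natCast]

theorem binExp_congr (p : ℝ) (n : ℕ) {G G' : ℕ → ℝ} (h : ∀ k ≤ n, G k = G' k) :
    binExp p n G = binExp p n G' := by
  rw [binExp_eq_sum, binExp_eq_sum]
  exact Finset.sum_congr rfl fun k hk => by rw [h k (Nat.lt_succ_iff.1 (Finset.mem_range.1 hk))]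

open Filter Topology in
/-- For small time steps the probability of an up-move is close to `1 / 2`. -/
theorem Lattice.tendsto_prob (L : Lattice) (r : ℝ) {σ : ℝ} (hσ : 0 < σ) (T : ℝ) (hT : 0 < T) :
    Tendsto (fun n : ℕ => L.prob r σ (T / n)) atTop (𝓝 (1 / 2)) := by
  cases L with
  | JR => exact tendsto_const_nhds
  | CRR =>
    -- In the variable `u = √h`, numerator and denominator of `p` vanish at zero and have
    -- derivatives `σ` and `2 * σ` there; `p` is the quotient of the two slopes.
    have h1 : HasDerivAt (fun u : ℝ => Real.exp (r * u ^ 2) - Real.exp (-(σ * u))) σ 0 := by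
      have a := (((hasDerivAt_id (0 : ℝ)).pow 2).const_mul r).exp
      have b := (((hasDerivAt_id (0 : ℝ)).const_mul σ).neg).exp
      exact (a.sub b).congr_deriv (by simp)
    have h2 : HasDerivAt (fun u : ℝ => Real.exp (σ * u) - Real.exp (-(σ * u))) (2 * σ) 0 := by
      have a := ((hasDerivAt_id (0 : ℝ)).const_mul σ).exp
      have b := (((hasDerivAt_id (0 : ℝ)).const_mul σ).neg).exp
      exact (a.sub b).congr_deriv (by simp; ring)
    have h3 := (hasDerivAt_iff_tendsto_slope.1 h1).div (hasDerivAt_iff_tendsto_slope.1 h2)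
      (by positivity)
    have h4 : Tendsto (fun n : ℕ => √(T / n)) atTop (𝓝[≠] 0) := by
      refine tendsto_nhdsWithin_iff.2 ⟨?_, ?_⟩
      · have := (tendsto_const_div_atTop_nhds_zero_nat T).sqrt
        rwa [Real.sqrt_zero] at this
      · filter_upwards [eventually_gt_atTop 0] with n hn
        have : (0 : ℝ) < n := by exact_mod_cast hn
        exact (Real.sqrt_pos.2 (by positivity)).ne'
    have h5 := h3.comp h4
    rw [show σ / (2 * σ) = 1 / 2 by field_simp] at h5
    refine h5.congr' ?_
    filter_upwards [eventually_gt_atTop 0] with n hn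
    have hn' : (0 : ℝ) < n := by exact_mod_cast hn
    have hs : √(T / n) ≠ 0 := (Real.sqrt_pos.2 (by positivity)).ne'
    simp only [Function.comp, Pi.div_apply, slope_def_field, sub_zero, mul_zero, neg_zero,
      Real.exp_zero, sub_self, Lattice.prob, Lattice.up, Lattice.down]
    rw [Real.sq_sqrt (by positivity)]
    rw [zero_pow two_ne_zero, mul_zero, Real.exp_zero, sub_self, sub_zero,
      div_div_div_cancel_right₀ hs]

/-- The registers after the computation of the probability of an up-move. -/
theorem evalList_probCode (L : Lattice) {R : ℕ → ℝ} {r σ T x : ℝ} (h0 : R 0 = r) (h1 : R 1 = σ)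
    (h2 : R 2 = T) (h3 : R 3 = x) (h4 : R 4 = 0) (h5 : R 5 = 1) :
    evalList (probCode L) R 3 = x ∧ evalList (probCode L) R 4 = 0 ∧
      evalList (probCode L) R 5 = 1 ∧ evalList (probCode L) R 7 = L.prob r σ (T / x) := by
  cases L with
  | CRR =>
    simp [probCode, evalList, Instr.eval, h0, h1, h2, h3, h4, h5, Lattice.prob, Lattice.up,
      Lattice.down]
  | JR => simp [probCode, evalList, Instr.eval, h3, h4, h5, Lattice.prob]

/-- All subvalues of the sampler are bounded by the sum of a cost and a binomial expectation. -/
theorem sampler_start_le (L : Lattice) (r σ T : ℝ) (ψ : ℝ → ℝ) {n : ℕ} (hn : 0 < n)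
    (hp : L.prob r σ (T / n) ∈ Set.Icc (0 : ℝ) 1) {K N : ℕ} (hK : n + 1 ≤ 2 ^ K)
    (hN : ¬ (1 / 4 ≤ L.prob r σ (T / n) ∧ L.prob r σ (T / n) ≤ 3 / 4) → n ≤ N)
    (z : ℕ → ℝ) {κ : ℝ} {g : ℝ → ℝ} {V : Config → ℝ} (hκ : 0 ≤ κ)
    (hV : IsSubvalue (sampler L) (payoffOracle L r σ T ψ) z κ g V) :
    V (start [r, σ, T, n]) ≤ κ * (28345200 + 1549 * K + 17 * N) +
      binExp (L.prob r σ (T / n)) n fun k => g (payoffOracle L r σ T ψ n (z 0) k) := by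
  -- The only `init` instruction comes first; afterwards the current price is `z 0` and one price
  -- has been used, so the reduction to registers applies.
  obtain ⟨U, hU, hVU⟩ := hV.exists_regSubvalue hκ (z 0) 1
  set R0 : ℕ → ℝ := fun i => [r, σ, T, (n : ℝ)].getD i 0 with hR0
  set R1 := Function.update R0 30 (z 0) with hR1
  have h0 : V (start [r, σ, T, n]) ≤ κ + U 1 R1 := by
    have h := hV.step (start [r, σ, T, n]) (by cases L <;> simp [start, sampler])
    have hb : ∀ b, bitStep (sampler L) (payoffOracle L r σ T ψ) z b (start [r, σ, T, n]) =
        ⟨1, R1, z 0, 0, 1⟩ := fun b => by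
      have : (sampler L)[0]? = some (.init 30) := by cases L <;> rfl
      simp only [bitStep, step, start, this]
      rfl
    rw [hb, hb, add_self_div_two] at h
    exact h.trans (add_le_add_right (hVU _ _ _) κ)
  have h1 := hU.block [.const 4 0, .const 5 1] 1 R1 (by cases L <;> rfl) rfl
  norm_num only [List.length] at h1
  set R2 := evalList [.const 4 0, .const 5 1] R1 with hR2
  have h2 := hU.block (probCode L) 3 R2 (by cases L <;> rfl) (by cases L <;> rfl)
  rw [show (probCode L).length = 11 by cases L <;> rfl] at h2
  norm_num only at h2
  obtain ⟨r3, r4, r5, r7⟩ := evalList_probCode L (R := R2) (r := r) (σ := σ) (T := T) (x := n)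
    (by simp [hR2, hR1, hR0, evalList, Instr.eval]) (by simp [hR2, hR1, hR0, evalList, Instr.eval])
    (by simp [hR2, hR1, hR0, evalList, Instr.eval]) (by simp [hR2, hR1, hR0, evalList, Instr.eval])
    (by simp [hR2, evalList, Instr.eval]) (by simp [hR2, evalList, Instr.eval])
  have h3 := sampler_main_le hU hn hp hK hN r3 r4 r5 r7
  rw [binExp_congr _ _ (G' := fun k => g (payoffOracle L r σ T ψ n (z 0) k)) fun k hk => by
    rw [answer_natCast _ _ hn hk]] at h3
  linarith

/-- The sampler is exact, and its expected cost is of order `log n`. -/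
theorem sampler_spec (L : Lattice) (r : ℝ) {σ T : ℝ} (hσ : 0 < σ) (hT : 0 < T) :
    ∃ C : ℝ, ∀ ψ : ℝ → ℝ, IsPiecewiseConstant ψ → ∀ (π₀ : Measure ℝ) [IsProbabilityMeasure π₀],
      ∀ n : ℕ, 2 ≤ n → L.prob r σ (T / n) ∈ Set.Icc (0 : ℝ) 1 →
        (tapeMeasure π₀).map (output (sampler L) (payoffOracle L r σ T ψ) [r, σ, T, n]) =
          (bopmLaw L r σ T π₀ n).map ψ ∧
        ∫⁻ τ, cost (sampler L) (payoffOracle L r σ T ψ) [r, σ, T, n] τ ∂(tapeMeasure π₀) ≤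
          ENNReal.ofReal (C * Real.log n) := by
  -- From `N` on, rejection is always available; the linear method runs only for `n < N`, and `N`
  -- depends on `r`, `σ`, `T` alone.
  obtain ⟨N, hN⟩ : ∃ N : ℕ, ∀ n ≥ N, L.prob r σ (T / n) ∈ Set.Icc (1 / 4 : ℝ) (3 / 4) :=
    Filter.eventually_atTop.1 (L.tendsto_prob r hσ T hT (Icc_mem_nhds (by norm_num) (by norm_num)))
  refine ⟨2 * (28345200 + 34 * N) + 1549 * 5, fun ψ hψ π₀ _ n hn hp => ?_⟩
  set K := Nat.log 2 (n + 1) + 1 with hK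
  have hn0 : (0 : ℝ) < n := by exact_mod_cast (by omega : 0 < n)
  have hlog2 := Real.log_two_gt_d9
  have hlogn : Real.log 2 ≤ Real.log n := Real.log_le_log (by norm_num) (by exact_mod_cast hn)
  -- `n + 1 ≤ n ^ 2` gives `K * log 2 ≤ 2 * log n + log 2 ≤ 3 * log n`. Additive constants are
  -- absorbed in the same way, as `1 ≤ 2 * log n`.
  have hKlog : (K : ℝ) ≤ 5 * Real.log n := by
    have h1 : (2 : ℝ) ^ Nat.log 2 (n + 1) ≤ n ^ 2 := by
      exact_mod_cast (Nat.pow_log_le_self 2 (by omega)).trans (by nlinarith)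
    have h2 := Real.log_le_log (by positivity) h1
    rw [Real.log_pow, Real.log_pow] at h2
    push_cast at h2
    rw [hK]
    push_cast
    nlinarith
  have key := map_output_eq_and_lintegral_cost_le (prog := sampler L) (L := L) (r := r) (σ := σ)
    (T := T) (E := 28345200 + 1549 * K + 17 * N) (ψ := ψ) hψ.measurable π₀ hp
    (input := [r, σ, T, n]) fun z κ g V hκ hV =>
      sampler_start_le L r σ T ψ (by omega) hp (Nat.lt_pow_succ_log_self (by norm_num) _).le
        (fun h => (not_le.1 fun h' => h (hN n h')).le) z hκ hV
  refine ⟨key.1, key.2.trans (ENNReal.ofReal_le_ofReal ?_)⟩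
  have hN0 : (0 : ℝ) ≤ N := Nat.cast_nonneg N
  nlinarith

/-! ### A program that estimates the price -/

theorem step_jumpLE_of_le {prog : List Instr} {pc a b t : ℕ}
    (h : prog[pc]? = some (.jumpLE a b t)) {R : ℕ → ℝ} (hR : R a ≤ R b) (O : ℕ → ℝ → ℕ → ℝ)
    (τ : Tape) (s : ℝ) (u v : ℕ) : step prog O τ ⟨pc, R, s, u, v⟩ = ⟨t, R, s, u, v⟩ := by
  simp [step, h, exec, hR]

theorem step_jumpLE_of_lt {prog : List Instr} {pc a b t : ℕ}
    (h : prog[pc]? = some (.jumpLE a b t)) {R : ℕ → ℝ} (hR : R b < R a) (O : ℕ → ℝ → ℕ → ℝ)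
    (τ : Tape) (s : ℝ) (u v : ℕ) : step prog O τ ⟨pc, R, s, u, v⟩ = ⟨pc + 1, R, s, u, v⟩ := by
  simp [step, h, exec, not_le.2 hR]

/-- The code at `base` increases register `d` by one until it is at least register `a`, and
continues after this code. Registers `5` and `6` contain zero and one. -/
def ceilCode (base a d : ℕ) : List Instr :=
  [.jumpLE a d (base + 3), .add d d 6, .jumpLE 5 5 base]

/-- Counting up takes the place of rounding. It costs three instructions per unit, which is
affordable because the pricer needs only ceilings of the order of its cost bound. -/
theorem iterate_step_ceilCode {prog : List Instr} {base a d : ℕ}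
    (hcode : (prog.drop base).take 3 = ceilCode base a d) (had : a ≠ d) (hd : d ≠ 6)
    {R : ℕ → ℝ} (hRd : R d = 0) (h6 : R 6 = 1)
    (O : ℕ → ℝ → ℕ → ℝ) (τ : Tape) (s : ℝ) (u v : ℕ) :
    (step prog O τ)^[3 * ⌈R a⌉₊ + 1] ⟨base, R, s, u, v⟩ =
      ⟨base + 3, Function.update R d ⌈R a⌉₊, s, u, v⟩ := by
  have hc : ∀ i < 3, prog[base + i]? = (ceilCode base a d)[i]? := fun i hi => by
    rw [← hcode, List.getElem?_take_of_lt hi, List.getElem?_drop]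
  have c0 : prog[base]? = some (.jumpLE a d (base + 3)) := hc 0 (by norm_num)
  have c1 : prog[base + 1]? = some (.add d d 6) := hc 1 (by norm_num)
  have c2 : prog[base + 2]? = some (.jumpLE 5 5 base) := hc 2 (by norm_num)
  have key : ∀ k ≤ ⌈R a⌉₊, (step prog O τ)^[3 * k] ⟨base, R, s, u, v⟩ =
      ⟨base, Function.update R d k, s, u, v⟩ := by
    intro k
    induction k with
    | zero =>
      intro _
      simp [← hRd]
    | succ k ih =>
      intro hk
      rw [show 3 * (k + 1) = 3 + 3 * k by ring, Function.iterate_add_apply, ih (by omega)]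
      have hlt : (k : ℝ) < R a := Nat.lt_ceil.1 hk
      simp only [Function.iterate_succ, Function.comp, Function.iterate_zero, id]
      rw [step_jumpLE_of_lt c0 (by simpa [had] using hlt), step_of_isArith c1 rfl,
        step_jumpLE_of_le c2 le_rfl]
      simp [Instr.eval, hd.symm, h6]
  rw [add_comm, Function.iterate_add_apply, key _ le_rfl, Function.iterate_one,
    step_jumpLE_of_le c0 (by simpa [had] using Nat.le_ceil _)]

/-- Registers `13` and `14` become `A ^ 4 / ε ^ 2` and `A * log (2 / ε)`. -/
def targetCode : List Instr :=
  [.const 5 0, .const 6 1, .const 7 2, .mul 13 3 3, .mul 13 13 13, .div 13 13 4, .div 13 13 4,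
    .div 14 7 4, .log 14 14, .mul 14 3 14]

/-- Register `12` becomes the difference between the standardised logarithmic price factors of the
Black-Scholes model and of the lattice. -/
def shiftCode : Lattice → List Instr
  | .CRR => [.mul 12 1 1, .div 12 12 7, .sub 12 0 12, .sqrt 22 2, .mul 12 12 22, .div 12 12 1]
  | .JR => [.const 12 0, .const 12 0, .const 12 0, .const 12 0, .const 12 0, .const 12 0]

/-- The grid: `n` and `k` in registers `10` and `11`, the number of points in register `16`, the
mesh in register `24`, the first point in register `19`. -/
def gridCode (L : Lattice) : List Instr :=
  [.mul 11 8 8, .mul 11 11 7, .add 10 11 11, .sub 11 11 9, .add 16 9 9] ++ (shiftCode L ++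
    [.div 24 6 8, .div 19 9 8, .add 19 19 12, .sub 19 5 19])

/-- The contribution of one point, with the payoff in register `21`. -/
def pointCode : List Instr :=
  [.mul 20 19 19, .div 20 20 7, .sub 20 5 20, .exp 20 20, .mul 21 20 21, .add 17 17 21,
    .add 18 18 20, .add 19 19 24, .add 15 15 6, .add 11 11 6]

/-- The discounted weighted mean. -/
def meanCode : List Instr :=
  [.mul 22 0 2, .sub 22 5 22, .exp 22 22, .div 17 17 18, .mul 0 17 22]

/-- The program estimating the price: it evaluates the payoff for a Gaussian quadrature on an
equidistant grid, with a fresh initial price for every point of the grid. -/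
def pricer (L : Lattice) : List Instr :=
  targetCode ++ (ceilCode 10 13 8 ++ ([.mul 14 14 8] ++ (ceilCode 14 14 9 ++ (gridCode L ++
    ([.jumpLE 16 15 46, .init 23, .query 21 10 11] ++ (pointCode ++ ([.jumpLE 5 5 32] ++
      meanCode)))))))

/-- The shift of the grid. -/
noncomputable def Lattice.shift (L : Lattice) (r σ T : ℝ) : ℝ :=
  match L with
  | CRR => (r - σ ^ 2 / 2) * √T / σ
  | JR => 0

/-- The density of the standard normal distribution up to a factor. -/
noncomputable def bell (x : ℝ) : ℝ := Real.exp (-(x ^ 2 / 2))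

/-- The machine in the main loop of the pricer, before point number `i` of the grid. -/
structure AtPoint (O : ℕ → ℝ → ℕ → ℝ) (τ : Tape) (r T n k₀ N x₀ δ : ℝ) (i : ℕ) (c : Config) :
    Prop where
  pc : c.pc = 32
  prices : c.prices = i
  reg0 : c.reg 0 = r
  reg2 : c.reg 2 = T
  reg5 : c.reg 5 = 0
  reg6 : c.reg 6 = 1
  reg7 : c.reg 7 = 2
  reg10 : c.reg 10 = n
  reg11 : c.reg 11 = k₀ + i
  reg15 : c.reg 15 = i
  reg16 : c.reg 16 = N
  reg17 : c.reg 17 = ∑ j ∈ Finset.range i, bell (x₀ + j * δ) * answer O n (τ.2 j) (k₀ + j)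
  reg18 : c.reg 18 = ∑ j ∈ Finset.range i, bell (x₀ + j * δ)
  reg19 : c.reg 19 = x₀ + i * δ
  reg24 : c.reg 24 = δ

/-- One grid point costs `14` instructions: the loop test, a draw, a query, `10` arithmetic
instructions and the jump back. -/
theorem AtPoint.succ {L : Lattice} {O : ℕ → ℝ → ℕ → ℝ} {τ : Tape} {r T n k₀ N x₀ δ : ℝ} {i : ℕ}
    {c : Config} (h : AtPoint O τ r T n k₀ N x₀ δ i c) (hi : (i : ℝ) < N) :
    AtPoint O τ r T n k₀ N x₀ δ (i + 1) ((step (pricer L) O τ)^[14] c) := by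
  obtain ⟨pc, R, s, u, v⟩ := c
  obtain ⟨hpc, hv, h0, h2, h5, h6, h7, h10, h11, h15, h16, h17, h18, h19, h24⟩ := h
  simp only at hpc hv h0 h2 h5 h6 h7 h10 h11 h15 h16 h17 h18 h19 h24
  subst hpc hv
  have c0 : (pricer L)[32]? = some (.jumpLE 16 15 46) := by cases L <;> rfl
  have c1 : (pricer L)[33]? = some (.init 23) := by cases L <;> rfl
  have c2 : (pricer L)[34]? = some (.query 21 10 11) := by cases L <;> rfl
  have c3 : (pricer L)[45]? = some (.jumpLE 5 5 32) := by cases L <;> rfl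
  set R1 := Function.update R 23 (τ.2 v) with hR1
  set R2 := Function.update R1 21 (answer O n (τ.2 v) (k₀ + v)) with hR2
  have e1 : step (pricer L) O τ ⟨33, R, s, u, v⟩ = ⟨34, R1, τ.2 v, u, v + 1⟩ := by
    simp [step, c1, exec, Config.write, hR1]
  have e2 : step (pricer L) O τ ⟨34, R1, τ.2 v, u, v + 1⟩ = ⟨35, R2, τ.2 v, u, v + 1⟩ := by
    simp [step, c2, exec, Config.write, hR2, hR1, h10, h11]
  have e3 := iterate_step_block (prog := pricer L) pointCode 35 (by cases L <;> rfl) rfl O τ R2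
    (τ.2 v) u (v + 1)
  rw [show pointCode.length = 10 from rfl] at e3
  rw [show 14 = 1 + (10 + 3) from rfl, Function.iterate_add_apply, Function.iterate_add_apply,
    Function.iterate_one]
  simp only [Function.iterate_succ _ 2, Function.iterate_succ _ 1, Function.iterate_one,
    Function.comp]
  rw [step_jumpLE_of_lt c0 (by rw [h15, h16]; exact hi), e1, e2, e3, step_jumpLE_of_le c3 le_rfl]
  constructor <;> simp [pointCode, evalList, Instr.eval, *, Finset.sum_range_succ, bell,
    -mul_eq_mul_right_iff, -mul_eq_mul_left_iff]
  all_goals ring_nf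

/-- The preparation takes `10 + (3 q + 1) + 1 + (3 J + 1) + 15` instructions. The grid starts at
`-(J / q + shift)`, and register `11` starts at `2 q ^ 2 - J`, so that each point of the grid
matches a number of up-moves. -/
theorem exists_atPoint_zero (L : Lattice) (O : ℕ → ℝ → ℕ → ℝ) (τ : Tape) (r σ T A ε : ℝ)
    {q J : ℕ} (hq : q = ⌈A ^ 4 / ε ^ 2⌉₊) (hJ : J = ⌈A * Real.log (2 / ε) * q⌉₊) :
    AtPoint O τ r T (4 * q ^ 2) (2 * q ^ 2 - J) (2 * J) (-(J / q + L.shift r σ T)) (1 / q) 0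
      (run (pricer L) O [r, σ, T, A, ε] τ (28 + 3 * q + 3 * J)) := by
  set R0 : ℕ → ℝ := fun i => [r, σ, T, A, ε].getD i 0 with hR0
  have hstart : start [r, σ, T, A, ε] = ⟨0, R0, 0, 0, 0⟩ := rfl
  have e1 := iterate_step_block (prog := pricer L) targetCode 0 (by cases L <;> rfl) rfl O τ R0
    0 0 0
  set R1 := evalList targetCode R0 with hR1
  have a13 : R1 13 = A ^ 4 / ε ^ 2 := by
    simp [hR1, targetCode, evalList, Instr.eval, hR0]
    ring
  have a14 : R1 14 = A * Real.log (2 / ε) := by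
    simp [hR1, targetCode, evalList, Instr.eval, hR0]
  have a : R1 0 = r ∧ R1 1 = σ ∧ R1 2 = T ∧ R1 5 = 0 ∧ R1 6 = 1 ∧ R1 7 = 2 ∧ R1 8 = 0 ∧ R1 9 = 0 ∧
      R1 15 = 0 ∧ R1 17 = 0 ∧ R1 18 = 0 := by
    simp [hR1, targetCode, evalList, Instr.eval, hR0]
  obtain ⟨a0, a1, a2, a5, a6, a7, a8, a9, a15, a17, a18⟩ := a
  have e2 := iterate_step_ceilCode (prog := pricer L) (base := 10) (a := 13) (d := 8)
    (by cases L <;> rfl) (by norm_num) (by norm_num) a8 a6 O τ 0 0 0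
  rw [a13, ← hq] at e2
  set R2 := Function.update R1 8 (q : ℝ) with hR2
  have e3 := iterate_step_block (prog := pricer L) [.mul 14 14 8] 13 (by cases L <;> rfl) rfl O τ
    R2 0 0 0
  set R3 := evalList [.mul 14 14 8] R2 with hR3
  have b14 : R3 14 = A * Real.log (2 / ε) * q := by
    simp [hR3, hR2, evalList, Instr.eval, a14]
  have b : R3 0 = r ∧ R3 1 = σ ∧ R3 2 = T ∧ R3 5 = 0 ∧ R3 6 = 1 ∧ R3 7 = 2 ∧ R3 8 = q ∧ R3 9 = 0 ∧
      R3 15 = 0 ∧ R3 17 = 0 ∧ R3 18 = 0 := by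
    simp [hR3, hR2, evalList, Instr.eval, a0, a1, a2, a5, a6, a7, a9, a15, a17, a18]
  obtain ⟨b0, b1, b2, b5, b6, b7, b8, b9, b15, b17, b18⟩ := b
  have e4 := iterate_step_ceilCode (prog := pricer L) (base := 14) (a := 14) (d := 9)
    (by cases L <;> rfl) (by norm_num) (by norm_num) b9 b6 O τ 0 0 0
  rw [b14, ← hJ] at e4
  set R4 := Function.update R3 9 (J : ℝ) with hR4
  have e5 := iterate_step_block (prog := pricer L) (gridCode L) 17 (by cases L <;> rfl)
    (by cases L <;> rfl) O τ R4 0 0 0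
  rw [show (gridCode L).length = 15 by cases L <;> rfl] at e5
  norm_num only [show targetCode.length = 10 from rfl, List.length] at e1 e2 e3 e4 e5
  have hrun : run (pricer L) O [r, σ, T, A, ε] τ (28 + 3 * q + 3 * J) =
      ⟨32, evalList (gridCode L) R4, 0, 0, 0⟩ := by
    rw [run, hstart, show 28 + 3 * q + 3 * J = 15 + ((3 * J + 1) + (1 + ((3 * q + 1) + 10))) by ring,
      Function.iterate_add_apply _ 15, Function.iterate_add_apply _ (3 * J + 1),
      Function.iterate_add_apply _ 1 (3 * q + 1 + 10), Function.iterate_add_apply _ (3 * q + 1), e1, e2, e3, e4, e5]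
  rw [hrun]
  cases L <;> constructor <;>
    simp [gridCode, shiftCode, evalList, Instr.eval, hR4, b0, b1, b2, b5, b6, b7, b8, b15, b17, b18,
      Lattice.shift]
  all_goals ring

/-- The weighted mean of the payoffs that the pricer computes. -/
theorem pricer_run (L : Lattice) (O : ℕ → ℝ → ℕ → ℝ) (τ : Tape) (r σ T A ε : ℝ)
    {q J : ℕ} (hq : q = ⌈A ^ 4 / ε ^ 2⌉₊) (hJ : J = ⌈A * Real.log (2 / ε) * q⌉₊)
    (hJq : J ≤ 2 * q ^ 2) (hq0 : 0 < q) {x : ℕ → ℝ}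
    (hx : ∀ i, x i = -(J / q + L.shift r σ T) + i * (1 / q)) :
    cost (pricer L) O [r, σ, T, A, ε] τ ≤ ((34 + 3 * q + 31 * J : ℕ) : ℝ≥0∞) ∧
      output (pricer L) O [r, σ, T, A, ε] τ =
        (∑ i ∈ Finset.range (2 * J),
          bell (x i) * O (4 * q ^ 2) (τ.2 i) (2 * q ^ 2 - J + i)) /
        (∑ i ∈ Finset.range (2 * J), bell (x i)) * Real.exp (-r * T) := by
  have h0 := exists_atPoint_zero L O τ r σ T A ε hq hJ
  set x₀ := -(J / q + L.shift r σ T) with hx₀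
  have h1 : ∀ i ≤ 2 * J, AtPoint O τ r T (4 * q ^ 2) (2 * q ^ 2 - J) (2 * J) x₀ (1 / q) i
      (run (pricer L) O [r, σ, T, A, ε] τ (14 * i + (28 + 3 * q + 3 * J))) := by
    intro i
    induction i with
    | zero => intro _; simpa using h0
    | succ i ih =>
      intro hi
      have := (ih (by omega)).succ (L := L) (by exact_mod_cast hi)
      rwa [run, ← Function.iterate_add_apply, ← add_assoc, add_comm 14 (14 * i)] at this
  have h2 := h1 (2 * J) le_rfl
  set t := 14 * (2 * J) + (28 + 3 * q + 3 * J) with ht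
  rcases hc : run (pricer L) O [r, σ, T, A, ε] τ t with ⟨pc, R, s, u, v⟩
  rw [hc] at h2
  obtain ⟨hpc, -, g0, g2, g5, g6, g7, g10, g11, g15, g16, g17, g18, g19, g24⟩ := h2
  simp only at hpc g0 g2 g5 g6 g7 g10 g11 g15 g16 g17 g18 g19 g24
  subst hpc
  have c0 : (pricer L)[32]? = some (.jumpLE 16 15 46) := by cases L <;> rfl
  have e := iterate_step_block (prog := pricer L) meanCode 46 (by cases L <;> rfl) rfl O τ R s u v
  norm_num only [show meanCode.length = 5 from rfl] at e
  -- The last six instructions are the jump out of the loop and the five of `meanCode`.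
  have hrun : run (pricer L) O [r, σ, T, A, ε] τ (34 + 3 * q + 31 * J) =
      ⟨51, evalList meanCode R, s, u, v⟩ := by
    rw [run, show 34 + 3 * q + 31 * J = 5 + (1 + t) by rw [ht]; ring, Function.iterate_add_apply,
      Function.iterate_add_apply, ← run, hc, Function.iterate_one,
      step_jumpLE_of_le c0 (by rw [g15, g16]; push_cast; rfl), e]
  have hhalt : Halted (pricer L) O [r, σ, T, A, ε] τ (34 + 3 * q + 31 * J) := by
    unfold Halted
    rw [hrun]
    cases L <;> exact le_of_eq rfl
  refine ⟨cost_le_of_halted hhalt, ?_⟩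
  rw [output_of_halted hhalt, hrun]
  have : evalList meanCode R 0 = R 17 / R 18 * Real.exp (-r * T) := by
    simp [meanCode, evalList, Instr.eval, g0, g2, g5]
  simp only [this, g17, g18]
  congr 2
  · refine Finset.sum_congr rfl fun i hi => ?_
    have hi := Finset.mem_range.1 hi
    -- `J ≤ 2 q ^ 2` keeps the number of up-moves between `0` and `4 q ^ 2`; outside this range the
    -- oracle would answer zero.
    rw [hx, ← answer_natCast O (τ.2 i) (show 0 < 4 * q ^ 2 by positivity)
      (show 2 * q ^ 2 - J + i ≤ 4 * q ^ 2 by omega)]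
    push_cast [hJq]
    rfl
  · exact Finset.sum_congr rfl fun i _ => by rw [hx]

/-! ### Gaussian quadrature of monotone functions -/

theorem bell_pos (x : ℝ) : 0 < bell x := Real.exp_pos _

theorem bell_le_one (x : ℝ) : bell x ≤ 1 := Real.exp_le_one_iff.2 (by nlinarith [sq_nonneg x])

theorem continuous_bell : Continuous bell := by unfold bell; fun_prop

theorem bell_eq (x : ℝ) : bell x = Real.exp (-(1 / 2) * x ^ 2) := by
  unfold bell
  congr 1
  ring

theorem integrable_bell : Integrable bell := by
  simpa only [← bell_eq] using integrable_exp_neg_mul_sq (b := 1 / 2) (by norm_num)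

theorem integral_bell : ∫ x, bell x = √(2 * Real.pi) := by
  simp only [bell_eq, integral_gaussian]
  congr 1
  ring

theorem two_le_integral_bell : 2 ≤ ∫ x, bell x := by
  rw [integral_bell]
  exact Real.le_sqrt_of_sq_le (by linarith [Real.pi_gt_three])

/-- The derivative has modulus `|z| * exp (-z ^ 2 / 2)`, at most one because `|z| ≤ 1 + z ^ 2 / 2`.
-/
theorem abs_bell_sub_bell_le (x y : ℝ) : |bell x - bell y| ≤ |x - y| := by
  have hd : ∀ z, HasDerivAt bell (bell z * -z) z := fun z => by
    have := ((((hasDerivAt_id z).pow 2).div_const 2).neg).exp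
    exact this.congr_deriv (by simp [bell])
  have hb : ∀ z, ‖bell z * -z‖ ≤ 1 := fun z => by
    rw [norm_mul, norm_neg, Real.norm_of_nonneg (bell_pos z).le, Real.norm_eq_abs, bell,
      Real.exp_neg, inv_mul_le_iff₀ (Real.exp_pos _), mul_one]
    have := Real.add_one_le_exp (z ^ 2 / 2)
    nlinarith [sq_nonneg (|z| - 1), sq_abs z]
  simpa using convex_univ.norm_image_sub_le_of_norm_hasDerivWithin_le
    (fun z _ => (hd z).hasDerivWithinAt) (fun z _ => hb z) (Set.mem_univ y) (Set.mem_univ x)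

/-- Half of the Gaussian exponent pays for smallness, via `x ^ 2 / 4 ≥ |x| - 1 ≥ R - 1`; the other
half remains integrable. -/
theorem bell_le_of_le_abs {R x : ℝ} (h : R ≤ |x|) :
    bell x ≤ Real.exp (1 - R) * Real.exp (-(1 / 4) * x ^ 2) := by
  rw [bell, ← Real.exp_add, Real.exp_le_exp]
  nlinarith [sq_nonneg (|x| / 2 - 1), sq_abs x]

theorem exp_one_sub_mul_integral_le (R : ℝ) :
    Real.exp (1 - R) * ∫ x : ℝ, Real.exp (-(1 / 4) * x ^ 2) ≤ 10 * Real.exp (-R) := by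
  rw [integral_gaussian, sub_eq_add_neg, Real.exp_add]
  have h1 : √(Real.pi / (1 / 4)) ≤ 3.6 := Real.sqrt_le_iff.2
    ⟨by norm_num, by nlinarith [Real.pi_lt_d2]⟩
  have h2 := Real.exp_one_lt_d9
  have h3 := Real.exp_pos 1
  have h4 := Real.exp_pos (-R)
  have h5 : Real.exp 1 * √(Real.pi / (1 / 4)) ≤ 10 :=
    (mul_le_mul h2.le h1 (by positivity) (by norm_num)).trans (by norm_num)
  nlinarith

section Quadrature

variable {f : ℝ → ℝ} {x₀ δ R : ℝ} {N : ℕ}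

theorem integrable_bell_mul (hf : Monotone f) (h0 : ∀ x, 0 ≤ f x) (h1 : ∀ x, f x ≤ 1) :
    Integrable fun x => bell x * f x :=
  integrable_bell.mono (continuous_bell.measurable.mul hf.measurable).aestronglyMeasurable
    (ae_of_all _ fun x => by
      rw [norm_mul, Real.norm_of_nonneg (h0 x)]
      exact mul_le_of_le_one_right (norm_nonneg _) (h1 x))

/-- On each cell the integrand deviates from its value at the left end by at most `δ`, as `bell` is
Lipschitz, plus the increment of `f`. The increments telescope to at most one, so the jumps of `f`
cost a single `δ` in total. -/
theorem abs_sum_bell_mul_sub_intervalIntegral_le (hf : Monotone f) (h0 : ∀ x, 0 ≤ f x)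
    (h1 : ∀ x, f x ≤ 1) (hδ : 0 ≤ δ) :
    |δ * ∑ i ∈ Finset.range N, bell (x₀ + i * δ) * f (x₀ + i * δ) -
      ∫ x in x₀..x₀ + N * δ, bell x * f x| ≤ N * δ ^ 2 + δ := by
  have hint := integrable_bell_mul hf h0 h1
  have hcell : ∀ i : ℕ, |δ * (bell (x₀ + i * δ) * f (x₀ + i * δ)) -
      ∫ x in x₀ + i * δ..x₀ + (i + 1 : ℕ) * δ, bell x * f x| ≤
      δ ^ 2 + δ * (f (x₀ + (i + 1 : ℕ) * δ) - f (x₀ + i * δ)) := fun i => by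
    set a := x₀ + i * δ with ha
    have hb : x₀ + (i + 1 : ℕ) * δ = a + δ := by rw [ha]; push_cast; ring
    rw [hb]
    have e1 : δ * (bell a * f a) = ∫ _ in a..a + δ, bell a * f a := by simp; ring
    rw [e1, ← intervalIntegral.integral_sub intervalIntegrable_const hint.intervalIntegrable]
    have := intervalIntegral.norm_integral_le_of_norm_le_const (a := a) (b := a + δ)
      (f := fun x => bell a * f a - bell x * f x) (C := δ + (f (a + δ) - f a)) fun x hx => by
        rw [Set.uIoc_of_le (by linarith)] at hx
        have l1 := abs_bell_sub_bell_le a x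
        rw [abs_sub_comm a x, abs_of_nonneg (by linarith [hx.1] : 0 ≤ x - a)] at l1
        have l2 := hf hx.1.le
        have l3 := hf hx.2
        rw [show bell a * f a - bell x * f x =
          (bell a - bell x) * f x + bell a * (f a - f x) by ring]
        refine (norm_add_le _ _).trans (add_le_add ?_ ?_)
        · rw [norm_mul, Real.norm_of_nonneg (h0 x), Real.norm_eq_abs]
          have := mul_le_of_le_one_right (abs_nonneg (bell a - bell x)) (h1 x)
          linarith [hx.2]
        · rw [norm_mul, Real.norm_of_nonneg (bell_pos a).le, Real.norm_eq_abs, abs_sub_comm,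
            abs_of_nonneg (by linarith)]
          have := mul_le_of_le_one_left (sub_nonneg.2 l2) (bell_le_one a)
          linarith
    rw [Real.norm_eq_abs, add_sub_cancel_left, abs_of_nonneg hδ] at this
    linarith
  have hsum := intervalIntegral.sum_integral_adjacent_intervals (μ := volume)
    (f := fun x => bell x * f x) (a := fun i : ℕ => x₀ + i * δ) (n := N)
    fun k _ => hint.intervalIntegrable
  simp only [Nat.cast_zero, zero_mul, add_zero] at hsum
  rw [← hsum, Finset.mul_sum, ← Finset.sum_sub_distrib]
  refine (Finset.abs_sum_le_sum_abs _ _).trans ((Finset.sum_le_sum fun i _ => hcell i).trans ?_)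
  rw [Finset.sum_add_distrib, ← Finset.mul_sum,
    Finset.sum_range_sub fun i : ℕ => f (x₀ + i * δ), Finset.sum_const, Finset.card_range,
    nsmul_eq_mul]
  have := mul_le_of_le_one_right hδ
    (by linarith [h1 (x₀ + N * δ), h0 (x₀ + (0 : ℕ) * δ)] :
      f (x₀ + N * δ) - f (x₀ + (0 : ℕ) * δ) ≤ 1)
  linarith

theorem abs_sum_bell_mul_sub_integral_le (hf : Monotone f) (h0 : ∀ x, 0 ≤ f x)
    (h1 : ∀ x, f x ≤ 1) (hδ : 0 ≤ δ) (hl : x₀ ≤ -R) (hr : R ≤ x₀ + N * δ) :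
    |δ * ∑ i ∈ Finset.range N, bell (x₀ + i * δ) * f (x₀ + i * δ) - ∫ x, bell x * f x| ≤
      N * δ ^ 2 + δ + 10 * Real.exp (-R) := by
  have hint := integrable_bell_mul hf h0 h1
  have hle : x₀ ≤ x₀ + N * δ := le_add_of_nonneg_right (by positivity)
  have hsplit := integral_add_compl (measurableSet_Ioc (a := x₀) (b := x₀ + N * δ)) hint
  rw [← intervalIntegral.integral_of_le hle] at hsplit
  have hg : Integrable fun x : ℝ => Real.exp (1 - R) * Real.exp (-(1 / 4) * x ^ 2) :=
    (integrable_exp_neg_mul_sq (by norm_num)).const_mul _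
  have htail : ∫ x in (Set.Ioc x₀ (x₀ + N * δ))ᶜ, bell x * f x ≤ 10 * Real.exp (-R) :=
    calc ∫ x in (Set.Ioc x₀ (x₀ + N * δ))ᶜ, bell x * f x
        ≤ ∫ x in (Set.Ioc x₀ (x₀ + N * δ))ᶜ, Real.exp (1 - R) * Real.exp (-(1 / 4) * x ^ 2) := by
          refine setIntegral_mono_on hint.integrableOn hg.integrableOn measurableSet_Ioc.compl
            fun x hx => ?_
          refine (mul_le_of_le_one_right (bell_pos x).le (h1 x)).trans (bell_le_of_le_abs ?_)
          by_cases hx0 : x ≤ x₀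
          · exact le_abs.2 (Or.inr (by linarith))
          · refine le_abs.2 (Or.inl ?_)
            by_contra h
            exact hx ⟨not_le.1 hx0, by linarith⟩
      _ ≤ ∫ x, Real.exp (1 - R) * Real.exp (-(1 / 4) * x ^ 2) :=
          setIntegral_le_integral hg (ae_of_all _ fun x => by positivity)
      _ = Real.exp (1 - R) * ∫ x : ℝ, Real.exp (-(1 / 4) * x ^ 2) := integral_const_mul _ _
      _ ≤ 10 * Real.exp (-R) := exp_one_sub_mul_integral_le R
  have htail0 : 0 ≤ ∫ x in (Set.Ioc x₀ (x₀ + N * δ))ᶜ, bell x * f x :=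
    integral_nonneg fun x => mul_nonneg (bell_pos x).le (h0 x)
  have := abs_le.1 (abs_sum_bell_mul_sub_intervalIntegral_le (x₀ := x₀) (N := N) hf h0 h1 hδ)
  rw [abs_le, ← hsplit]
  constructor <;> linarith [this.1, this.2]

theorem integral_gaussianReal_eq_div (g : ℝ → ℝ) :
    ∫ x, g x ∂(gaussianReal 0 1) = (∫ x, bell x * g x) / ∫ x, bell x := by
  rw [integral_gaussianReal_eq_integral_smul one_ne_zero, integral_bell, div_eq_inv_mul,
    ← integral_const_mul]
  refine integral_congr_ae (ae_of_all _ fun x => ?_)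
  simp [gaussianPDFReal, bell, mul_assoc, neg_div]

/-- Normalising by the sum of the weights applies the quadrature bound twice, to `f` and to the
constant one; the resulting factor two is absorbed by `∫ bell ≥ 2`. -/
theorem abs_mean_sub_integral_gaussianReal_le (hf : Monotone f) (h0 : ∀ x, 0 ≤ f x)
    (h1 : ∀ x, f x ≤ 1) (hδ : 0 < δ) (hN : 0 < N) (hl : x₀ ≤ -R) (hr : R ≤ x₀ + N * δ) :
    |(∑ i ∈ Finset.range N, bell (x₀ + i * δ) * f (x₀ + i * δ)) /
        (∑ i ∈ Finset.range N, bell (x₀ + i * δ)) - ∫ x, f x ∂(gaussianReal 0 1)| ≤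
      N * δ ^ 2 + δ + 10 * Real.exp (-R) := by
  have hS := abs_sum_bell_mul_sub_integral_le (f := fun _ => 1) monotone_const
    (fun _ => zero_le_one) (fun _ => le_rfl) hδ.le hl hr
  have hf' := abs_sum_bell_mul_sub_integral_le hf h0 h1 hδ.le hl hr
  simp only [mul_one] at hS
  rw [integral_gaussianReal_eq_div]
  have hF := two_le_integral_bell
  set e := N * δ ^ 2 + δ + 10 * Real.exp (-R)
  set S := ∑ i ∈ Finset.range N, bell (x₀ + i * δ) with hSdef
  set G := ∑ i ∈ Finset.range N, bell (x₀ + i * δ) * f (x₀ + i * δ) with hG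
  set F := ∫ x, bell x
  set H := ∫ x, bell x * f x
  have hS0 : 0 < S := Finset.sum_pos (fun i _ => bell_pos _) ⟨0, Finset.mem_range.2 hN⟩
  have hG0 : 0 ≤ G := Finset.sum_nonneg fun i _ => mul_nonneg (bell_pos _).le (h0 _)
  have hGS : G ≤ S := Finset.sum_le_sum fun i _ => mul_le_of_le_one_right (bell_pos _).le (h1 _)
  have he : 0 ≤ e := (abs_nonneg _).trans hS
  have hF0 : 0 < F := by linarith
  have hd : G / S - H / F = (G * (F - δ * S) + S * (δ * G - H)) / (S * F) := by
    field_simp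
    ring
  rw [hd, abs_div, abs_of_pos (mul_pos hS0 hF0), div_le_iff₀ (mul_pos hS0 hF0)]
  have h2 : |G * (F - δ * S)| ≤ S * e := by
    rw [abs_mul, abs_of_nonneg hG0, abs_sub_comm]
    exact mul_le_mul hGS hS (abs_nonneg _) hS0.le
  have h3 : |S * (δ * G - H)| ≤ S * e := by
    rw [abs_mul, abs_of_pos hS0]
    exact mul_le_mul_of_nonneg_left hf' hS0.le
  have := abs_add_le (G * (F - δ * S)) (S * (δ * G - H))
  nlinarith [mul_le_mul_of_nonneg_left hF (mul_nonneg hS0.le he)]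

/-- The total weight of the grid is at least of the order of the inverse mesh. -/
theorem one_le_mul_sum_bell (hδ : 0 ≤ δ) (hl : x₀ ≤ -R) (hr : R ≤ x₀ + N * δ)
    (he : N * δ ^ 2 + δ + 10 * Real.exp (-R) ≤ 1) :
    1 ≤ δ * ∑ i ∈ Finset.range N, bell (x₀ + i * δ) := by
  have hS := abs_sum_bell_mul_sub_integral_le (f := fun _ => 1) monotone_const
    (fun _ => zero_le_one) (fun _ => le_rfl) hδ hl hr
  simp only [mul_one] at hS
  linarith [(abs_le.1 hS).1, two_le_integral_bell]

end Quadrature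

/-! ### The price as a Gaussian integral, and the error of the weighted mean -/

/-- The price at maturity if the initial price is `s` and the standardised Brownian motion at
maturity is `x`. -/
noncomputable def terminalPrice (r σ T s x : ℝ) : ℝ :=
  s * Real.exp ((r - σ ^ 2 / 2) * T + σ * √T * x)

theorem measurable_terminalPrice (r σ T : ℝ) :
    Measurable fun p : ℝ × ℝ => terminalPrice r σ T p.1 p.2 := by
  unfold terminalPrice
  fun_prop

theorem monotone_terminalPrice (r : ℝ) {σ : ℝ} (hσ : 0 < σ) (T : ℝ) {s : ℝ} (hs : 0 < s) :
    Monotone (terminalPrice r σ T s) := fun x y h => by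
  unfold terminalPrice
  gcongr

/-- On the grid of the pricer the oracle evaluates the payoff exactly. -/
theorem payoffOracle_grid (L : Lattice) (r : ℝ) {σ T : ℝ} (hσ : 0 < σ) (hT : 0 < T) (ψ : ℝ → ℝ)
    (s : ℝ) {q J i : ℕ} (hq : 0 < q) (hJ : J ≤ 2 * q ^ 2) (hi : i ≤ 2 * J) :
    payoffOracle L r σ T ψ (4 * q ^ 2) s (2 * q ^ 2 - J + i) =
      ψ (terminalPrice r σ T s (-(J / q + L.shift r σ T) + i * (1 / q))) := by
  have hq' : (0 : ℝ) < q := by exact_mod_cast hq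
  -- The number of steps is a square so that `√h = √T / (2 q)`. One more up-move multiplies the
  -- price by `exp (2 σ √h) = exp (σ √T / q)`, one mesh width in the standardised variable. The
  -- `shift` accounts for the drift missing in the Cox–Ross–Rubinstein factors.
  have hsqrt : √(T / ((4 * q ^ 2 : ℕ) : ℝ)) = √T / (2 * q) := by
    rw [Real.sqrt_div hT.le]
    congr 1
    rw [Real.sqrt_eq_iff_eq_sq (by positivity) (by positivity)]
    push_cast
    ring
  have hk : ((2 * q ^ 2 - J + i : ℕ) : ℝ) = 2 * q ^ 2 - J + i := by push_cast [hJ]; rfl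
  have hnk : ((4 * q ^ 2 - (2 * q ^ 2 - J + i) : ℕ) : ℝ) = 2 * q ^ 2 + J - i := by
    rw [Nat.cast_sub (by omega), hk]
    push_cast
    ring
  have hTT : √T * √T = T := Real.mul_self_sqrt hT.le
  unfold payoffOracle terminalPrice
  rw [mul_comm _ s]
  congr 2
  cases L with
  | CRR =>
    simp only [Lattice.up, Lattice.down, Lattice.shift]
    rw [← Real.exp_nat_mul, ← Real.exp_nat_mul, ← Real.exp_add, hk, hnk, hsqrt]
    congr 1
    field_simp
    linear_combination (2 * r * q - q * σ ^ 2) * hTT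
  | JR =>
    simp only [Lattice.up, Lattice.down, Lattice.shift]
    rw [← Real.exp_nat_mul, ← Real.exp_nat_mul, ← Real.exp_add, hk, hnk, hsqrt]
    congr 1
    push_cast
    field_simp
    ring

theorem optionPrice_eq {Ω : Type*} [MeasurableSpace Ω] {P : Measure Ω} [IsProbabilityMeasure P]
    {π₀ : Measure ℝ} [IsProbabilityMeasure π₀] {S₀ : Ω → ℝ} {W : ℝ≥0 → Ω → ℝ}
    (hS : HasLaw S₀ π₀ P) (hW : IsBrownianReal W P) (hSW : IndepFun S₀ (fun ω t => W t ω) P)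
    (r σ : ℝ) {T : ℝ} (hT : 0 < T) {ψ : ℝ → ℝ} (hψ : Measurable ψ) {Ψ : ℝ}
    (hb : ∀ x, |ψ x| ≤ Ψ) :
    optionPrice P r σ T ψ S₀ W =
      Real.exp (-r * T) * ∫ s, ∫ x, ψ (terminalPrice r σ T s x) ∂(gaussianReal 0 1) ∂π₀ := by
  have hTe : HasLaw (W T.toNNReal) (gaussianReal 0 T.toNNReal) P :=
    hW.toIsPreBrownianReal.hasLaw_eval _
  have hind : IndepFun S₀ (W T.toNNReal) P :=
    hSW.comp measurable_id (measurable_pi_apply T.toNNReal)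
  have hlaw := (indepFun_iff_hasLaw_prodMk_prod hS hTe).1 hind
  have hg : gaussianReal 0 T.toNNReal = (gaussianReal 0 1).map (√T * ·) := by
    rw [gaussianReal_map_const_mul]
    congr 1
    · simp
    · ext
      simp [Real.sq_sqrt hT.le, hT.le]
  have hm : Measurable fun p : ℝ × ℝ => ψ (p.1 * Real.exp ((r - σ ^ 2 / 2) * T + σ * p.2)) :=
    hψ.comp (by fun_prop)
  have hint : Integrable (fun p : ℝ × ℝ => ψ (p.1 * Real.exp ((r - σ ^ 2 / 2) * T + σ * p.2)))
      (π₀.prod (gaussianReal 0 T.toNNReal)) :=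
    Integrable.of_bound hm.aestronglyMeasurable Ψ (ae_of_all _ fun _ => hb _)
  have := hlaw.integral_comp hm.aestronglyMeasurable
  rw [integral_prod _ hint] at this
  unfold optionPrice
  rw [integral_const_mul]
  congr 1
  refine Eq.trans ?_ (this.trans ?_)
  · refine integral_congr_ae (ae_of_all _ fun ω => ?_)
    simp [gbm, Real.coe_toNNReal _ hT.le]
  · refine integral_congr_ae (ae_of_all _ fun s => ?_)
    simp only
    have hms : Measurable fun y => ψ (s * Real.exp ((r - σ ^ 2 / 2) * T + σ * y)) :=
      hψ.comp (by fun_prop)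
    rw [hg, integral_map (by fun_prop) hms.aestronglyMeasurable]
    simp only [terminalPrice, mul_assoc]

section WeightedMean

variable {α : Type*} [MeasurableSpace α] {μ : Measure α} [IsProbabilityMeasure μ] {w : ℕ → ℝ}
  {φ : ℕ → α → ℝ} {Ψ : ℝ} {N : ℕ}

/-- The variance of a weighted mean of independent bounded random variables. -/
theorem variance_weightedMean_le (hw0 : ∀ i, 0 < w i) (hw1 : ∀ i, w i ≤ 1)
    (hφ : ∀ i, Measurable (φ i)) (hb : ∀ i a, |φ i a| ≤ Ψ) (hN : 0 < N) :
    variance (fun ω : ℕ → α => (∑ i ∈ Finset.range N, w i * φ i (ω i)) / ∑ i ∈ Finset.range N, w i)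
      (Measure.infinitePi fun _ => μ) ≤ Ψ ^ 2 / ∑ i ∈ Finset.range N, w i := by
  set S := ∑ i ∈ Finset.range N, w i with hS
  have hS0 : 0 < S := Finset.sum_pos (fun i _ => hw0 _) ⟨0, Finset.mem_range.2 hN⟩
  set ν : Measure (ℕ → α) := Measure.infinitePi fun _ => μ
  have hΨ : 0 ≤ Ψ ^ 2 := sq_nonneg Ψ
  set X : ℕ → (ℕ → α) → ℝ := fun i ω => w i * φ i (ω i) with hX
  have hXm : ∀ i, Measurable (X i) := fun i =>
    ((hφ i).comp (measurable_pi_apply i)).const_mul (w i)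
  have hXb : ∀ i ω, |X i ω| ≤ w i * Ψ := fun i ω => by
    rw [hX, abs_mul, abs_of_pos (hw0 i)]
    exact mul_le_mul_of_nonneg_left (hb _ _) (hw0 i).le
  have hXL : ∀ i, MemLp (X i) 2 ν := fun i =>
    MemLp.of_bound (hXm i).aestronglyMeasurable (w i * Ψ) (ae_of_all _ fun ω => hXb i ω)
  have hind : iIndepFun X ν := iIndepFun_infinitePi (X := fun i a => w i * φ i a)
    fun i => (hφ i).const_mul (w i)
  -- Weights at most one satisfy `w i ^ 2 ≤ w i`, which makes the total variance linear in the total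
  -- weight.
  have hvar : ∀ i, variance (X i) ν ≤ w i * Ψ ^ 2 := fun i => by
    have h := variance_le_sq_of_bounded (μ := ν) (X := X i) (a := -(w i * Ψ)) (b := w i * Ψ)
      (ae_of_all _ fun ω => abs_le.1 (hXb i ω)) (hXm i).aemeasurable
    refine h.trans ?_
    have : w i * w i ≤ w i * 1 := mul_le_mul_of_nonneg_left (hw1 i) (hw0 i).le
    nlinarith
  have hsum := IndepFun.variance_sum (s := Finset.range N) (fun i _ => hXL i)
    fun i _ j _ hij => hind.indepFun hij
  have heq : (fun ω : ℕ → α => (∑ i ∈ Finset.range N, w i * φ i (ω i)) / S) =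
      fun ω => S⁻¹ * (∑ i ∈ Finset.range N, X i) ω := by
    ext ω
    rw [Finset.sum_apply, div_eq_inv_mul]
  rw [heq, variance_const_mul, hsum]
  have : ∑ i ∈ Finset.range N, variance (X i) ν ≤ S * Ψ ^ 2 := by
    rw [hS, Finset.sum_mul]
    exact Finset.sum_le_sum fun i _ => hvar i
  calc S⁻¹ ^ 2 * ∑ i ∈ Finset.range N, variance (X i) ν ≤ S⁻¹ ^ 2 * (S * Ψ ^ 2) := by gcongr
    _ = Ψ ^ 2 / S := by field_simp

/-- A weighted mean of independent bounded random variables with small bias and large total weight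
is accurate with high probability. -/
theorem measure_abs_weightedMean_sub_le (hw0 : ∀ i, 0 < w i) (hw1 : ∀ i, w i ≤ 1)
    (hφ : ∀ i, Measurable (φ i)) (hb : ∀ i a, |φ i a| ≤ Ψ) (hN : 0 < N) {D ε m : ℝ} (hD : 0 < D)
    (hε : 0 < ε)
    (hbias : |∫ a, (∑ i ∈ Finset.range N, w i * φ i a) / (∑ i ∈ Finset.range N, w i) ∂μ - m| * D ≤
      ε / 2)
    (hvar : 400 * (D * Ψ) ^ 2 ≤ ε ^ 2 * ∑ i ∈ Finset.range N, w i) :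
    ENNReal.ofReal 0.99 ≤ (Measure.infinitePi fun _ : ℕ => μ)
      {ω | |(∑ i ∈ Finset.range N, w i * φ i (ω i)) / (∑ i ∈ Finset.range N, w i) * D - D * m| ≤
        ε} := by
  have hV := variance_weightedMean_le (μ := μ) hw0 hw1 hφ hb hN
  set S := ∑ i ∈ Finset.range N, w i with hS
  have hS0 : 0 < S := Finset.sum_pos (fun i _ => hw0 _) ⟨0, Finset.mem_range.2 hN⟩
  set ν : Measure (ℕ → α) := Measure.infinitePi fun _ => μ
  set X : (ℕ → α) → ℝ := fun ω => (∑ i ∈ Finset.range N, w i * φ i (ω i)) / S with hX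
  have hXm : Measurable X := (Finset.measurable_sum _ fun i _ =>
    ((hφ i).comp (measurable_pi_apply i)).const_mul (w i)).div_const S
  have hint1 : ∀ i, Integrable (φ i) μ := fun i =>
    Integrable.of_bound (hφ i).aestronglyMeasurable Ψ (ae_of_all _ fun a => hb i a)
  have hmp : ∀ i : ℕ, MeasurePreserving (fun ω : ℕ → α => ω i) ν μ := fun i =>
    measurePreserving_eval_infinitePi (fun _ => μ) i
  have hint2 : ∀ i, Integrable (fun ω : ℕ → α => φ i (ω i)) ν := fun i =>
    (hmp i).integrable_comp_of_integrable (hint1 i)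
  have hEX : ∫ ω, X ω ∂ν = ∫ a, (∑ i ∈ Finset.range N, w i * φ i a) / S ∂μ := by
    rw [hX, integral_div, integral_div, integral_finsetSum _ fun i _ => (hint2 i).const_mul _,
      integral_finsetSum _ fun i _ => (hint1 i).const_mul _]
    congr 1
    refine Finset.sum_congr rfl fun i _ => ?_
    rw [integral_const_mul, integral_const_mul, ← (hmp i).map_eq,
      integral_map (hmp i).measurable.aemeasurable (hφ i).aestronglyMeasurable]
  have hXL : MemLp X 2 ν := by
    refine MemLp.of_bound hXm.aestronglyMeasurable Ψ (ae_of_all _ fun ω => ?_)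
    rw [hX, Real.norm_eq_abs, abs_div, abs_of_pos hS0, div_le_iff₀ hS0, hS, Finset.mul_sum]
    refine (Finset.abs_sum_le_sum_abs _ _).trans (Finset.sum_le_sum fun i _ => ?_)
    rw [abs_mul, abs_of_pos (hw0 i), mul_comm]
    exact mul_le_mul_of_nonneg_right (hb _ _) (hw0 i).le
  have hcheb := meas_ge_le_variance_div_sq hXL (c := ε / (2 * D)) (by positivity)
  -- Half of `ε` is left for the random deviation; the `400` of `hvar` is `2 ^ 2 / 0.01`.
  have hsmall : ν {ω | ε / (2 * D) ≤ |X ω - ∫ ω, X ω ∂ν|} ≤ ENNReal.ofReal 0.01 := by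
    refine hcheb.trans (ENNReal.ofReal_le_ofReal ?_)
    rw [div_le_iff₀ (by positivity)]
    refine hV.trans ?_
    rw [div_le_iff₀ hS0, div_pow]
    have : Ψ ^ 2 * (2 * D) ^ 2 ≤ 0.01 * (ε ^ 2 * S) := by nlinarith
    calc Ψ ^ 2 = Ψ ^ 2 * (2 * D) ^ 2 / (2 * D) ^ 2 := by field_simp
      _ ≤ 0.01 * (ε ^ 2 * S) / (2 * D) ^ 2 := by gcongr
      _ = _ := by ring
  have hmeas : MeasurableSet {ω | ε / (2 * D) ≤ |X ω - ∫ ω, X ω ∂ν|} :=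
    measurableSet_le measurable_const (hXm.sub_const _).abs
  have hcompl := prob_compl_eq_one_sub (μ := ν) hmeas
  calc ENNReal.ofReal 0.99 = 1 - ENNReal.ofReal 0.01 := by
        rw [← ENNReal.ofReal_one, ← ENNReal.ofReal_sub _ (by norm_num)]
        norm_num
    _ ≤ 1 - ν {ω | ε / (2 * D) ≤ |X ω - ∫ ω, X ω ∂ν|} := tsub_le_tsub_left hsmall 1
    _ = ν {ω | ε / (2 * D) ≤ |X ω - ∫ ω, X ω ∂ν|}ᶜ := hcompl.symm
    _ ≤ _ := measure_mono fun ω hω => by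
      simp only [Set.mem_compl_iff, Set.mem_ofPred_eq, not_le] at hω
      rw [lt_div_iff₀ (by positivity)] at hω
      change |X ω * D - D * m| ≤ ε
      rw [← hEX] at hbias
      rw [show X ω * D - D * m = (X ω - ∫ ω, X ω ∂ν) * D + (∫ ω, X ω ∂ν - m) * D by ring]
      refine (abs_add_le _ _).trans ?_
      rw [abs_mul, abs_mul, abs_of_pos hD]
      linarith

end WeightedMean

/-! ### Accuracy and cost of the pricer -/

section Bias

variable {m N : ℕ} {K c : Fin m → ℝ} {a r σ T x₀ δ R : ℝ} {ψ : ℝ → ℝ}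

theorem abs_le_of_eq_sum (hψ : ∀ x, ψ x = a + ∑ j, c j * (Set.Ici (K j)).indicator 1 x) (x : ℝ) :
    |ψ x| ≤ |a| + ∑ j, |c j| := by
  rw [hψ]
  refine (abs_add_le _ _).trans (add_le_add_right
    ((Finset.abs_sum_le_sum_abs _ _).trans (Finset.sum_le_sum fun j _ => ?_)) _)
  rw [abs_mul]
  refine mul_le_of_le_one_right (abs_nonneg _) ?_
  by_cases h : K j ≤ x <;> simp [h]

/-- For `s > 0` the terminal price increases with the Brownian value, so each half-line indicator
becomes monotone. The constant part `a` is reproduced exactly, because the weights are normalised.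
-/
theorem abs_mean_payoff_sub_integral_le
    (hψ : ∀ x, ψ x = a + ∑ j, c j * (Set.Ici (K j)).indicator 1 x) (hσ : 0 < σ) (hδ : 0 < δ)
    (hN : 0 < N) (hl : x₀ ≤ -R) (hr : R ≤ x₀ + N * δ) {s : ℝ} (hs : 0 < s) :
    |(∑ i ∈ Finset.range N, bell (x₀ + i * δ) * ψ (terminalPrice r σ T s (x₀ + i * δ))) /
        (∑ i ∈ Finset.range N, bell (x₀ + i * δ)) -
      ∫ x, ψ (terminalPrice r σ T s x) ∂(gaussianReal 0 1)| ≤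
      (∑ j, |c j|) * (N * δ ^ 2 + δ + 10 * Real.exp (-R)) := by
  set f : Fin m → ℝ → ℝ := fun j x => (Set.Ici (K j)).indicator 1 (terminalPrice r σ T s x) with hf
  have hmono : ∀ j, Monotone (f j) := fun j x y hxy => by
    have hxy := monotone_terminalPrice r hσ T hs hxy
    by_cases h : K j ≤ terminalPrice r σ T s x
    · simp [hf, h, h.trans hxy]
    · simp only [hf, Set.indicator, Set.mem_Ici, h, if_false]
      split_ifs <;> simp
  have h0 : ∀ j x, 0 ≤ f j x := fun j x => Set.indicator_nonneg (fun _ _ => zero_le_one) _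
  have h1 : ∀ j x, f j x ≤ 1 := fun j x => by
    by_cases h : K j ≤ terminalPrice r σ T s x <;> simp [hf, h]
  have hψf : ∀ x, ψ (terminalPrice r σ T s x) = a + ∑ j, c j * f j x := fun x => hψ _
  simp only [hψf]
  set S := ∑ i ∈ Finset.range N, bell (x₀ + i * δ) with hS
  have hS0 : 0 < S := Finset.sum_pos (fun i _ => bell_pos _) ⟨0, Finset.mem_range.2 hN⟩
  have hmean : (∑ i ∈ Finset.range N, bell (x₀ + i * δ) * (a + ∑ j, c j * f j (x₀ + i * δ))) / S =
      a + ∑ j, c j * ((∑ i ∈ Finset.range N, bell (x₀ + i * δ) * f j (x₀ + i * δ)) / S) := by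
    have e : ∑ i ∈ Finset.range N, bell (x₀ + i * δ) * (a + ∑ j, c j * f j (x₀ + i * δ)) =
        a * S + ∑ j, c j * ∑ i ∈ Finset.range N, bell (x₀ + i * δ) * f j (x₀ + i * δ) := by
      simp only [mul_add, Finset.sum_add_distrib, Finset.mul_sum, hS]
      rw [Finset.sum_comm (s := Finset.range N)]
      congr 1
      · exact Finset.sum_congr rfl fun i _ => mul_comm _ _
      · exact Finset.sum_congr rfl fun j _ => Finset.sum_congr rfl fun i _ => by ring
    rw [e, add_div, mul_div_cancel_right₀ _ hS0.ne', Finset.sum_div]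
    simp only [mul_div_assoc]
  have hint : ∀ j, Integrable (f j) (gaussianReal 0 1) := fun j =>
    Integrable.of_bound (hmono j).measurable.aestronglyMeasurable 1 (ae_of_all _ fun x => by
      rw [Real.norm_of_nonneg (h0 j x)]
      exact h1 j x)
  have hG : ∫ x, (a + ∑ j, c j * f j x) ∂(gaussianReal 0 1) =
      a + ∑ j, c j * ∫ x, f j x ∂(gaussianReal 0 1) := by
    rw [integral_add (integrable_const _) (integrable_finsetSum _ fun j _ => (hint j).const_mul _),
      integral_finsetSum _ fun j _ => (hint j).const_mul _]
    simp [integral_const_mul]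
  rw [hmean, hG, add_sub_add_left_eq_sub, ← Finset.sum_sub_distrib, Finset.sum_mul]
  refine (Finset.abs_sum_le_sum_abs _ _).trans (Finset.sum_le_sum fun j _ => ?_)
  rw [← mul_sub, abs_mul]
  exact mul_le_mul_of_nonneg_left
    (abs_mean_sub_integral_gaussianReal_le (hmono j) (h0 j) (h1 j) hδ hN hl hr) (abs_nonneg _)

theorem abs_integral_mean_payoff_sub_le
    (hψ : ∀ x, ψ x = a + ∑ j, c j * (Set.Ici (K j)).indicator 1 x) (hψm : Measurable ψ)
    (hσ : 0 < σ) (hδ : 0 < δ) (hN : 0 < N) (hl : x₀ ≤ -R) (hr : R ≤ x₀ + N * δ)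
    {π₀ : Measure ℝ} [IsProbabilityMeasure π₀] (hπ : ∀ᵐ s ∂π₀, 0 < s) :
    |∫ s, (∑ i ∈ Finset.range N, bell (x₀ + i * δ) * ψ (terminalPrice r σ T s (x₀ + i * δ))) /
        (∑ i ∈ Finset.range N, bell (x₀ + i * δ)) ∂π₀ -
      ∫ s, ∫ x, ψ (terminalPrice r σ T s x) ∂(gaussianReal 0 1) ∂π₀| ≤
      (∑ j, |c j|) * (N * δ ^ 2 + δ + 10 * Real.exp (-R)) := by
  have hm : Measurable fun p : ℝ × ℝ => ψ (terminalPrice r σ T p.1 p.2) :=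
    hψm.comp (measurable_terminalPrice r σ T)
  have hb := abs_le_of_eq_sum hψ
  have hint1 : ∀ x, Integrable (fun s => ψ (terminalPrice r σ T s x)) π₀ := fun x =>
    Integrable.of_bound (hm.comp (measurable_id.prodMk measurable_const)).aestronglyMeasurable _
      (ae_of_all _ fun s => hb _)
  have hint2 : Integrable (fun s => ∫ x, ψ (terminalPrice r σ T s x) ∂(gaussianReal 0 1)) π₀ :=
    (Integrable.of_bound hm.aestronglyMeasurable _ (ae_of_all _ fun s => hb _) :
      Integrable (fun p : ℝ × ℝ => ψ (terminalPrice r σ T p.1 p.2))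
        (π₀.prod (gaussianReal 0 1))).integral_prod_left
  rw [← integral_sub ((integrable_finsetSum _ fun i _ => (hint1 _).const_mul _).div_const _) hint2]
  rw [← Real.norm_eq_abs]
  refine (norm_integral_le_of_norm_le_const
    (C := (∑ j, |c j|) * (N * δ ^ 2 + δ + 10 * Real.exp (-R))) ?_).trans_eq
    (by rw [probReal_univ, mul_one])
  exact hπ.mono fun s hs => abs_mean_payoff_sub_integral_le hψ hσ hδ hN hl hr hs

end Bias

/-- The parameters that the pricer chooses. -/
theorem exists_grid {A ε M : ℝ} (hM : 0 ≤ M) (hA : 2 + 34 * Real.exp M ≤ A) (hε : 0 < ε)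
    (hε1 : ε < 1) {q J : ℕ} (hq : q = ⌈A ^ 4 / ε ^ 2⌉₊) (hJ : J = ⌈A * Real.log (2 / ε) * q⌉₊) :
    0 < q ∧ 0 < J ∧ J ≤ 2 * q ^ 2 ∧ A ^ 4 / ε ^ 2 ≤ q ∧ (q : ℝ) ≤ 2 * A ^ 4 / ε ^ 2 ∧
      (J : ℝ) ≤ A * Real.log (2 / ε) * q + 1 ∧
      A * Real.log (2 / ε) ≤ J / q ∧
      (2 * J : ℕ) * (1 / q : ℝ) ^ 2 + 1 / q + 10 * Real.exp (-(A * Real.log (2 / ε) - M)) ≤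
        17 * Real.exp M * ε / A := by
  set l := Real.log (2 / ε) with hl
  have hM1 : 1 ≤ Real.exp M := Real.one_le_exp hM
  have hA2 : 36 ≤ A := by linarith
  have hlog2 := Real.log_two_gt_d9
  have hε2 : ε ^ 2 ≤ 1 := pow_le_one₀ hε.le hε1.le
  have hε2' : ε ^ 2 ≤ ε := by nlinarith
  have hll : Real.log 2 ≤ l := Real.log_le_log (by norm_num) (by rw [le_div_iff₀ hε]; linarith)
  have hl0 : 0 < l := by linarith
  have hlε : l ≤ 2 / ε := (Real.log_le_self (by positivity))
  have hA4 : A ≤ A ^ 4 := le_self_pow₀ (by linarith) (by norm_num)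
  have hA43 : A ^ 4 = A ^ 3 * A := by ring
  have hA3 : A ≤ A ^ 3 := le_self_pow₀ (by linarith) (by norm_num)
  have hAε : 1 ≤ A ^ 4 / ε ^ 2 := by rw [le_div_iff₀ (by positivity)]; linarith
  have hq1 : A ^ 4 / ε ^ 2 ≤ q := hq ▸ Nat.le_ceil _
  have hq2 : (q : ℝ) < A ^ 4 / ε ^ 2 + 1 := hq ▸ Nat.ceil_lt_add_one (by positivity)
  have hq0 : (0 : ℝ) < q := by linarith
  have hJ1 : A * l * q ≤ J := hJ ▸ Nat.le_ceil _
  have hJ2 : (J : ℝ) < A * l * q + 1 := hJ ▸ Nat.ceil_lt_add_one (by positivity)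
  have hJ0 : (0 : ℝ) < J := lt_of_lt_of_le (by positivity) hJ1
  have hqε : A ^ 4 ≤ q * ε ^ 2 := by rwa [div_le_iff₀ (by positivity)] at hq1
  have hAl : A * l ≤ 2 * A / ε := by
    calc A * l ≤ A * (2 / ε) := by gcongr
      _ = _ := by ring
  have hAlq : A * l ≤ q := by
    refine hAl.trans (le_trans ?_ hq1)
    rw [div_le_div_iff₀ hε (by positivity)]
    exact mul_le_mul (by nlinarith) hε2' (by positivity) (by positivity)
  have hinv : (1 : ℝ) / q ≤ ε ^ 2 / A ^ 4 := by
    rw [div_le_div_iff₀ hq0 (by positivity)]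
    linarith
  have hinv' : ε ^ 2 / A ^ 4 ≤ ε / A := by gcongr
  refine ⟨by exact_mod_cast hq0, by exact_mod_cast hJ0, ?_, hq1, ?_, hJ2.le,
    by rwa [le_div_iff₀ hq0], ?_⟩
  · have : (J : ℝ) ≤ (2 * q ^ 2 : ℕ) := by
      push_cast
      have : (1 : ℝ) ≤ q := by linarith
      nlinarith
    exact_mod_cast this
  · rw [mul_div_assoc]
    linarith
  -- The three error terms, namely length times mesh, mesh and tail, contribute `6`, `1` and `10`,
  -- which gives the factor `17`.
  · have t1 : (2 * J : ℕ) * (1 / q : ℝ) ^ 2 ≤ 6 * (ε / A) := by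
      have e1 : (2 * J : ℕ) * (1 / q : ℝ) ^ 2 ≤ 2 * (A * l * (1 / q)) + 2 * (1 / q) ^ 2 := by
        push_cast
        have : (J : ℝ) * (1 / q) ^ 2 ≤ (A * l * q + 1) * (1 / q) ^ 2 := by gcongr
        have h : (A * l * q + 1) * (1 / q : ℝ) ^ 2 = A * l * (1 / q) + (1 / q) ^ 2 := by field_simp
        linarith
      have e2 : A * l * (1 / q) ≤ 2 * (ε / A) := by
        calc A * l * (1 / q) ≤ 2 * A / ε * (ε ^ 2 / A ^ 4) := by gcongr
          _ = 2 * (ε / A ^ 3) := by field_simp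
          _ ≤ 2 * (ε / A) := by gcongr
      have e3 : (1 / q : ℝ) ^ 2 ≤ ε / A := by
        have : (1 : ℝ) / q ≤ 1 := by rw [div_le_one hq0]; linarith
        have h0 : (0 : ℝ) ≤ 1 / q := by positivity
        nlinarith
      linarith
    have t2 : Real.exp (-(A * l - M)) ≤ Real.exp M * (ε / A) := by
      -- One copy of `l` in the exponent yields `ε / 2`; the other `A - 1` copies are at least `log
      -- 2` each and yield `2 ^ (-(A - 1)) ≤ 2 / A`.
      have e1 : -(A * l - M) ≤ M + (-l + -((A - 1) * Real.log 2)) := by nlinarith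
      have e2 : Real.exp (-l) = ε / 2 := by
        rw [Real.exp_neg, hl, Real.exp_log (by positivity), inv_div]
      have e3 : Real.exp (-((A - 1) * Real.log 2)) ≤ 2 / A := by
        rw [Real.exp_neg, inv_le_comm₀ (Real.exp_pos _) (by positivity), inv_div]
        have := Real.add_one_le_exp ((A - 1) * Real.log 2)
        nlinarith
      refine (Real.exp_le_exp.2 e1).trans ?_
      rw [Real.exp_add, Real.exp_add, e2]
      refine mul_le_mul_of_nonneg_left ?_ (Real.exp_pos _).le
      calc ε / 2 * Real.exp (-((A - 1) * Real.log 2)) ≤ ε / 2 * (2 / A) := by gcongr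
        _ = ε / A := by ring
    have hεA : 0 ≤ ε / A := by positivity
    calc _ ≤ 6 * (ε / A) + ε / A + 10 * (Real.exp M * (ε / A)) := by linarith
      _ ≤ 17 * (Real.exp M * (ε / A)) := by nlinarith
      _ = _ := by ring

/-- The pricer is accurate with high probability, and its cost is of order `ε⁻² log (2 / ε)`. -/
theorem pricer_spec (L : Lattice) (r : ℝ) {σ T : ℝ} (hσ : 0 < σ) (hT : 0 < T) {ψ : ℝ → ℝ}
    (hψ : IsPiecewiseConstant ψ) :
    ∃ A₀ : ℝ, ∀ A : ℝ, A₀ ≤ A → ∃ C : ℝ, ∀ (π₀ : Measure ℝ) [IsProbabilityMeasure π₀],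
      (∀ᵐ s ∂π₀, 0 < s) →
      ∀ (Ω : Type*) [MeasurableSpace Ω] (P : Measure Ω) [IsProbabilityMeasure P]
        (S₀ : Ω → ℝ) (W : ℝ≥0 → Ω → ℝ),
        HasLaw S₀ π₀ P → IsBrownianReal W P → IndepFun S₀ (fun ω t => W t ω) P →
      ∀ ε : ℝ, 0 < ε → ε < 1 →
        (∀ τ, cost (pricer L) (payoffOracle L r σ T ψ) [r, σ, T, A, ε] τ ≤
          ENNReal.ofReal (C * ε ^ (-2 : ℤ) * Real.log (2 / ε) ^ 1)) ∧
        ENNReal.ofReal 0.99 ≤ tapeMeasure π₀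
          {τ | |output (pricer L) (payoffOracle L r σ T ψ) [r, σ, T, A, ε] τ -
                optionPrice P r σ T ψ S₀ W| ≤ ε} := by
  obtain ⟨m, K, a, c, hsum⟩ := hψ.exists_eq_sum
  set D := Real.exp (-r * T) with hD
  set M := |L.shift r σ T| with hM
  set Ψ := |a| + ∑ j, |c j| with hΨ
  have hD0 : 0 < D := Real.exp_pos _
  have hc0 : 0 ≤ ∑ j, |c j| := Finset.sum_nonneg fun j _ => abs_nonneg _
  have hΨ0 : 0 ≤ Ψ := add_nonneg (abs_nonneg _) hc0
  have hE := Real.exp_pos M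
  -- The first two summands are what `exists_grid` needs, with `exp M` paying for the off-centre
  -- grid. The third brings the discounted bias below `ε / 2`, the last makes the variance small
  -- enough for Chebyshev's inequality.
  refine ⟨2 + 34 * Real.exp M + 34 * Real.exp M * ((∑ j, |c j|) * D) + 20 * (D * Ψ), fun A hA =>
    ⟨136 + 12 * A ^ 4 + 62 * A ^ 5, ?_⟩⟩
  intro π₀ _ hπ Ω _ P _ S₀ W hS hW hSW ε hε hε1
  have hcD : 0 ≤ 34 * Real.exp M * ((∑ j, |c j|) * D) := by positivity
  have hDΨ : 0 ≤ D * Ψ := by positivity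
  obtain ⟨q, hq⟩ : ∃ q, q = ⌈A ^ 4 / ε ^ 2⌉₊ := ⟨_, rfl⟩
  obtain ⟨J, hJ⟩ : ∃ J, J = ⌈A * Real.log (2 / ε) * q⌉₊ := ⟨_, rfl⟩
  obtain ⟨hq0, hJ0, hJq, hq1, hq2, hJ2, hR, herr⟩ :=
    exists_grid (abs_nonneg (L.shift r σ T)) (by linarith) hε hε1 hq hJ
  rw [← hM] at herr
  set x₀ := -(J / q + L.shift r σ T) with hx₀
  have hrun := fun τ => pricer_run L (payoffOracle L r σ T ψ) τ r σ T A ε hq hJ hJq hq0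
    (x := fun i => x₀ + i * (1 / q)) fun i => rfl
  have hA0 : 36 ≤ A := by linarith [Real.one_le_exp (abs_nonneg (L.shift r σ T))]
  have hqpos : (0 : ℝ) < q := by exact_mod_cast hq0
  constructor
  · intro τ
    refine (hrun τ).1.trans ?_
    rw [← ENNReal.ofReal_natCast]
    refine ENNReal.ofReal_le_ofReal ?_
    have hlog2 := Real.log_two_gt_d9
    have hll : Real.log 2 ≤ Real.log (2 / ε) :=
      Real.log_le_log (by norm_num) (by rw [le_div_iff₀ hε]; linarith)
    set l := Real.log (2 / ε)
    rw [pow_one, zpow_neg, zpow_ofNat]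
    push_cast
    have hu : 1 ≤ (ε ^ 2)⁻¹ := (one_le_inv₀ (by positivity)).2 (pow_le_one₀ hε.le hε1.le)
    rw [div_eq_mul_inv] at hq2
    set u := (ε ^ 2)⁻¹
    have h1 : 1 ≤ 2 * (u * l) := by nlinarith
    have h2 : (q : ℝ) ≤ 4 * A ^ 4 * (u * l) := by
      have : 2 * A ^ 4 * u * 1 ≤ 2 * A ^ 4 * u * (2 * l) := by
        gcongr
        linarith
      linarith
    have h3 : A * l * q ≤ A * l * (2 * A ^ 4 * u) :=
      mul_le_mul_of_nonneg_left hq2 (mul_nonneg (by linarith) (by linarith))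
    have h4 : (J : ℝ) ≤ 2 * A ^ 5 * (u * l) + 2 * (u * l) := by
      have : A * l * (2 * A ^ 4 * u) = 2 * A ^ 5 * (u * l) := by ring
      linarith
    linarith
  · have hpos : ∀ i, 0 < bell (x₀ + (i : ℕ) * (1 / q)) := fun i => bell_pos _
    have hle : ∀ i, bell (x₀ + (i : ℕ) * (1 / q)) ≤ 1 := fun i => bell_le_one _
    have hφ : ∀ i : ℕ, Measurable fun s => ψ (terminalPrice r σ T s (x₀ + i * (1 / q))) := fun i =>
      hψ.measurable.comp ((measurable_terminalPrice r σ T).comp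
        (measurable_id.prodMk measurable_const))
    have hδ : (0 : ℝ) < 1 / q := by positivity
    have hN : 0 < 2 * J := by omega
    have hl : x₀ ≤ -(A * Real.log (2 / ε) - M) := by
      linarith [neg_abs_le (L.shift r σ T)]
    have hr : A * Real.log (2 / ε) - M ≤ x₀ + (2 * J : ℕ) * (1 / q) := by
      have : ((2 * J : ℕ) : ℝ) * (1 / q) = 2 * (J / q) := by push_cast; ring
      rw [this]
      linarith [le_abs_self (L.shift r σ T)]
    have hbias := abs_integral_mean_payoff_sub_le (r := r) (T := T) hsum hψ.measurable hσ hδ hN hl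
      hr hπ
    have herr1 : 17 * Real.exp M * ε / A ≤ 1 := by
      rw [div_le_one (by linarith)]
      nlinarith
    have hmass := one_le_mul_sum_bell hδ.le hl hr (herr.trans herr1)
    have key := measure_abs_weightedMean_sub_le (μ := π₀) hpos hle hφ
      (fun i s => abs_le_of_eq_sum hsum _) hN hD0 hε
      (m := ∫ s, ∫ x, ψ (terminalPrice r σ T s x) ∂(gaussianReal 0 1) ∂π₀) ?_ ?_
    · rw [optionPrice_eq hS hW hSW r σ hT hψ.measurable (abs_le_of_eq_sum hsum), ← hD]
      refine key.trans_eq ?_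
      rw [tapeMeasure]
      -- The pricer draws no random bits, so the event depends on the initial prices only.
      rw [← (measurePreserving_snd (μ := Measure.infinitePi fun _ : ℕ =>
        (PMF.uniformOfFintype Bool).toMeasure) (ν := Measure.infinitePi fun _ : ℕ =>
          π₀)).measure_preimage]
      · congr 1
        ext τ
        simp only [Set.mem_preimage, Set.mem_ofPred_eq]
        rw [(hrun τ).2]
        have hgrid : ∀ i ∈ Finset.range (2 * J), bell (x₀ + i * (1 / q)) *
            payoffOracle L r σ T ψ (4 * q ^ 2) (τ.2 i) (2 * q ^ 2 - J + i) =
            bell (x₀ + i * (1 / q)) * ψ (terminalPrice r σ T (τ.2 i) (x₀ + i * (1 / q))) :=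
          fun i hi => by
            rw [payoffOracle_grid L r hσ hT ψ _ hq0 hJq (Finset.mem_range.1 hi).le]
        rw [Finset.sum_congr rfl hgrid]
      · refine (measurableSet_le ?_ measurable_const).nullMeasurableSet
        exact ((((Finset.measurable_sum _ fun i _ => ((hφ i).comp
          (measurable_pi_apply i)).const_mul _).div_const _).mul_const _).sub_const _).abs
    · refine (mul_le_mul_of_nonneg_right (hbias.trans (mul_le_mul_of_nonneg_left herr hc0))
        hD0.le).trans ?_
      rw [mul_div_assoc', div_mul_eq_mul_div, div_le_iff₀ (by linarith)]
      have := mul_le_mul_of_nonneg_right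
        (show 34 * Real.exp M * ((∑ j, |c j|) * D) ≤ A by linarith) hε.le
      linarith
    · have h1 : (20 * (D * Ψ)) ^ 2 ≤ A ^ 2 := by
        gcongr
        linarith
      have h2 : A ^ 2 ≤ A ^ 4 := pow_le_pow_right₀ (by linarith) (by norm_num)
      -- The total weight is at least `q ≥ A ^ 4 / ε ^ 2`, so the variance is of order `ε ^ 2`.
      have h3 : (q : ℝ) ≤ ∑ i ∈ Finset.range (2 * J), bell (x₀ + i * (1 / q)) := by
        rwa [one_div_mul_eq_div, one_le_div hqpos] at hmass
      have h4 : A ^ 4 ≤ ε ^ 2 * q := by rwa [div_le_iff₀' (by positivity)] at hq1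
      have h5 := mul_le_mul_of_nonneg_left h3 (sq_nonneg ε)
      have h6 : 400 * (D * Ψ) ^ 2 = (20 * (D * Ψ)) ^ 2 := by ring
      linarith

end OptionPricing

theorem mainTheorem8 (L : OptionPricing.Lattice) :
    -- sampling the payoff in the binomial model, exactly and in expected cost `O(log n)`
    (∃ sampler : List OptionPricing.Instr,
      ∀ r σ T : ℝ, 0 < σ → 0 < T →
      ∃ C : ℝ, ∀ (ψ : ℝ → ℝ), OptionPricing.IsPiecewiseConstant ψ →
      ∀ (π₀ : Measure ℝ) [IsProbabilityMeasure π₀], (∀ᵐ s ∂π₀, 0 < s) →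
      ∀ n : ℕ, 2 ≤ n → L.prob r σ (T / n) ∈ Set.Icc (0 : ℝ) 1 →
        (OptionPricing.tapeMeasure π₀).map
            (OptionPricing.output sampler (OptionPricing.payoffOracle L r σ T ψ) [r, σ, T, n]) =
          (OptionPricing.bopmLaw L r σ T π₀ n).map ψ ∧
        ∫⁻ τ, OptionPricing.cost sampler (OptionPricing.payoffOracle L r σ T ψ) [r, σ, T, n] τ
            ∂(OptionPricing.tapeMeasure π₀) ≤ ENNReal.ofReal (C * Real.log n)) ∧
    -- estimating the price to additive error `ε` with probability `0.99` in cost `Õ(ε⁻²)`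
    (∃ (pricer : List OptionPricing.Instr) (c : ℕ),
      ∀ r σ T : ℝ, 0 < σ → 0 < T →
      ∀ (ψ : ℝ → ℝ), OptionPricing.IsPiecewiseConstant ψ →
      ∃ A₀ : ℝ, ∀ A : ℝ, A₀ ≤ A →
      ∃ C : ℝ, ∀ (π₀ : Measure ℝ) [IsProbabilityMeasure π₀], (∀ᵐ s ∂π₀, 0 < s) →
      ∀ (Ω : Type*) [MeasurableSpace Ω] (P : Measure Ω) [IsProbabilityMeasure P]
        (S₀ : Ω → ℝ) (W : ℝ≥0 → Ω → ℝ),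
        HasLaw S₀ π₀ P → IsBrownianReal W P → IndepFun S₀ (fun ω t => W t ω) P →
      ∀ ε : ℝ, 0 < ε → ε < 1 →
        (∀ τ, OptionPricing.cost pricer (OptionPricing.payoffOracle L r σ T ψ) [r, σ, T, A, ε] τ ≤
          ENNReal.ofReal (C * ε ^ (-2 : ℤ) * Real.log (2 / ε) ^ c)) ∧
        ENNReal.ofReal 0.99 ≤ OptionPricing.tapeMeasure π₀
          {τ | |OptionPricing.output pricer (OptionPricing.payoffOracle L r σ T ψ)
                  [r, σ, T, A, ε] τ -
                OptionPricing.optionPrice P r σ T ψ S₀ W| ≤ ε}) := by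
  refine ⟨⟨OptionPricing.sampler L, fun r σ T hσ hT => ?_⟩, OptionPricing.pricer L, 1, fun r σ T hσ hT ψ hψ =>
    OptionPricing.pricer_spec L r hσ hT hψ⟩
  obtain ⟨C, hC⟩ := OptionPricing.sampler_spec L r hσ hT
  exact ⟨C, fun ψ hψ π₀ _ _ n hn hp => hC ψ hψ π₀ n hn hp⟩
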